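/- **Setting.** Let $k\ge 1$. On one probability space, for every sample size $n$, let $(X_{ni},Z_{ni},u_{ni})$, $i=1,\dots,n$, be random vectors with values in $\mathbb{R}^k\times\mathbb{R}^p\times\mathbb{R}$ whose joint distribution may change with $n$, and let $y_{ni}=X_{ni}'\beta_n+Z_{ni}'\gamma_n+u_{ni}$ with $\beta_n\in\mathbb{R}^k$, $\gamma_n\in\mathbb{R}^p$. The index $n$ is dropped below. Let $z_1,\dots,z_S$ be the distinct values among $Z_1,\dots,Z_n$; stratum $s$ is $\{i: Z_i=z_s\}$ and $n_s$ is its size. Let $D$ be the $n\times n$ matrix that subtracts from every coordinate of a vector the mean over the stratum of that coordinate, let $X$ be the $n\times k$ matrix with rows $X_i'$, let $\tilde X=DX$, and for $v\in\mathbb{R}^n$ let $\Sigma(v)$ be the diagonal matrix with entries $[Dv]_i^2$. For a fixed $\beta_0\in\mathbb{R}^k$ the within-strata heteroskedasticity-robust Wald statistic is $$\mathcal W=v'\tilde X\bigl(\tilde X'\Sigma(v)\tilde X\bigr)^{-1}\tilde X'v,\qquad v=y-X\beta_0,$$ where the inverse is the Moore–Penrose inverse if the matrix is singular. For $i$ in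 stratum $s$ put $m_i=m^s=n_s^{-1}\sum_{j:Z_j=z_s}\operatorname{E}[X_j\mid Z_j]$ (so $m_i=\operatorname{E}[X_i\mid Z_i]$ a.s. whenever the conditional mean $\operatorname{E}[X_j\mid Z_j=z]$ is the same function of $z$ for all units $j$), and let $$\Omega_n=n^{-1}\sum_{i=1}^n\operatorname{E}\bigl[(X_i-m_i)(X_i-m_i)'u_i^2\mid Z_1,\dots,Z_n\bigr].$$ Let $c_n\ge n^{1/2}$ with $c_n/n\to0$, let $\mathcal I_n=\{s:n_s\ge c_n\}$, $\mathcal J_n=\{s:n_s<c_n\}$, and let $V_{n\mathcal I}=\sum_{s\in\mathcal I_n}\frac{n_s}{n}\sigma_u^{s2}Q^s$, $V_{n\mathcal J}=\sum_{s\in\mathcal J_n}\frac{n_s}{n}\sigma_u^{s2}Q^s$, where $\sigma_u^{s2}=n_s^{-1}\sum_{i:Z_i=z_s}\operatorname{E}[u_i^2\mid Z_i]$ and $Q^s=n_s^{-1}\sum_{i:Z_i=z_s}\operatorname{E}[X_iX_i'\mid Z_i]-m^s m^{s\prime}$. **Assumption.** (a) For every $n$, the vectors $(X_i,Z_i,u_i)$,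 $i=1,\dots,n$, are independent. (b) $\operatorname{E}[X_iu_i\mid Z_i]=0$ and $\operatorname{E}[u_i\mid Z_i]=0$ a.s. for all $n$ and $i$. (c) There are $m>2$ and $M_0<\infty$ not depending on $n$ with $\operatorname{E}[\|X_i\|^{2m}\mid Z_i]<M_0$ and $\operatorname{E}[|u_i|^{2m}\mid Z_i]<M_0$ a.s. for all $n$ and $i$. (d) There is $\lambda>0$ with $\liminf_n\lambda_{\min}(\Omega_n)>\lambda$ a.s.; if $\liminf_n|\mathcal I_n|\ge1$ a.s., then also $\liminf_n\lambda_{\min}(V_{n\mathcal I})>\lambda$ a.s.; if $|\mathcal J_n|\to\infty$ a.s., then also $\liminf_n\lambda_{\min}(V_{n\mathcal J})>\lambda$ a.s. (e) $S/n\to0$ a.s. **Theorem (asymptotic behavior of $\mathcal W$).** Under this assumption: 1. If $\beta_n=\beta_0+hn^{-1/2}$ with $h\in\mathbb{R}^k$ fixed, and $\Omega_n^{-1/2}\operatorname{E}[n^{-1}\tilde X'\tilde X]$ converges in probability to a nonrandom matrix $G$, then $\mathcal W$ converges in distribution to the noncentral chi-squared distribution $\chi^2_k(\|Gh\|^2)$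 with $k$ degrees of freedom and noncentrality parameter $\|Gh\|^2$. If $h=0$, that is, $\beta_n=\beta_0$, the existence of the limit $G$ is not needed, and $\mathcal W$ converges in distribution to $\chi^2_k(0)=\chi^2_k$. 2. If $n^{1/2}\|\operatorname{E}[n^{-1}\tilde X'\tilde X](\beta_n-\beta_0)\|\to\infty$, then $\mathcal W\to\infty$ in probability, that is, $P(\mathcal W\le M)\to0$ for every $M\in\mathbb{R}$. -/

import Mathlib

open MeasureTheory ProbabilityTheory Filter Topology
open scoped Matrix

namespace StratifiedWald

/-- Vectors in `ℝᵈ` with the Euclidean norm. -/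
abbrev Vec (d : ℕ) : Type := EuclideanSpace ℝ (Fin d)

section MatrixNotions

/-- The smallest eigenvalue of a real symmetric matrix. -/
noncomputable def lambdaMin {k : ℕ} (A : Matrix (Fin k) (Fin k) ℝ) : ℝ :=
  sInf (spectrum ℝ A)

/-- The Moore-Penrose inverse of a real symmetric matrix: in an orthonormal eigenbasis every
nonzero eigenvalue is inverted and the eigenvalue zero is kept. -/
noncomputable def symmInv {k : ℕ} (A : Matrix (Fin k) (Fin k) ℝ) : Matrix (Fin k) (Fin k) ℝ :=
  cfc (fun t : ℝ => t⁻¹) A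

/-- The inverse `A^{-1/2}` of the symmetric square root of a positive definite matrix. -/
noncomputable def invSqrt {k : ℕ} (A : Matrix (Fin k) (Fin k) ℝ) : Matrix (Fin k) (Fin k) ℝ :=
  cfc (fun t : ℝ => (√t)⁻¹) A

/-- On invertible symmetric matrices `symmInv` is the usual inverse. -/
theorem symmInv_eq_inv {k : ℕ} {A : Matrix (Fin k) (Fin k) ℝ} (hA : A.IsHermitian)
    (hdet : IsUnit A.det) : symmInv A = A⁻¹ := by
  have hu : IsUnit A := (Matrix.isUnit_iff_isUnit_det A).2 hdet
  have h := cfc_ringInverse_id (R := ℝ) A hu hA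
  rw [symmInv, h, Matrix.nonsing_inv_eq_ringInverse]

end MatrixNotions

section Statistic

variable {n k p : ℕ}

open scoped Classical in
/-- The stratum of the value `c`: the units `j` with `z j = c`. -/
noncomputable def stratum (z : Fin n → Vec p) (c : Vec p) : Finset (Fin n) :=
  Finset.univ.filter (fun j => z j = c)

open scoped Classical in
/-- The set of distinct observed values; its cardinality is the number of strata. -/
noncomputable def strata (z : Fin n → Vec p) : Finset (Vec p) :=
  Finset.univ.image z

open scoped Classical in
/-- The within-strata demeaning matrix: `(D v)_i` is `v_i` minus the mean of `v` over the stratum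
of `i`. -/
noncomputable def demean (z : Fin n → Vec p) : Matrix (Fin n) (Fin n) ℝ :=
  1 - Matrix.of (fun i j => if z j = z i then ((stratum z (z i)).card : ℝ)⁻¹ else 0)

/-- The regressors demeaned within strata, as an `n × k` matrix. -/
noncomputable def Xtilde (x : Fin n → Vec k) (z : Fin n → Vec p) : Matrix (Fin n) (Fin k) ℝ :=
  demean z * Matrix.of (fun i a => x i a)

/-- The diagonal matrix with diagonal entries `(D v)_i ^ 2`. -/
noncomputable def sigmaMat (z : Fin n → Vec p) (v : Fin n → ℝ) : Matrix (Fin n) (Fin n) ℝ :=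
  Matrix.diagonal (fun i => ((demean z *ᵥ v) i) ^ 2)

/-- The function `g`, that is `v' X̃ (X̃' Σ(v) X̃)⁻¹ X̃' v`. -/
noncomputable def gForm (x : Fin n → Vec k) (z : Fin n → Vec p) (v : Fin n → ℝ) : ℝ :=
  ((Xtilde x z)ᵀ *ᵥ v) ⬝ᵥ
    (symmInv ((Xtilde x z)ᵀ * sigmaMat z v * Xtilde x z) *ᵥ ((Xtilde x z)ᵀ *ᵥ v))

/-- The heteroskedasticity-robust Wald statistic for `β = β₀`. -/
noncomputable def wald (x : Fin n → Vec k) (z : Fin n → Vec p) (y : Fin n → ℝ) (β₀ : Vec k) : ℝ :=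
  gForm x z (fun i => y i - inner ℝ (x i) β₀)

end Statistic

section Population

variable {Ω : Type*} [MeasurableSpace Ω] {n k p : ℕ}

/-- The σ-algebra generated by `Z_i`. -/
abbrev sigmaZ (Z : Fin n → Ω → Vec p) (i : Fin n) : MeasurableSpace Ω :=
  MeasurableSpace.comap (Z i) inferInstance

/-- The σ-algebra generated by `Z_1, …, Z_n`. -/
abbrev sigmaAllZ (Z : Fin n → Ω → Vec p) : MeasurableSpace Ω :=
  MeasurableSpace.comap (fun ω i => Z i ω) inferInstance

/-- The average over the stratum of the value `c` of the conditional means `E[X_j | Z_j]`. -/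
noncomputable def stratumMean (μ : Measure Ω) (X : Fin n → Ω → Vec k) (Z : Fin n → Ω → Vec p)
    (c : Vec p) (ω : Ω) : Vec k :=
  ((stratum (fun j => Z j ω) c).card : ℝ)⁻¹ •
    ∑ j ∈ stratum (fun j => Z j ω) c, (μ[X j | sigmaZ Z j]) ω

/-- The covariance matrix `Ω_n` of the Wald statistic:
`n⁻¹ ∑ i, E[(X_i - m_i) (X_i - m_i)' u_i ^ 2 | Z_1, …, Z_n]`, where `m_i` is the average of the
conditional means over the stratum of `i`. -/
noncomputable def omegaMat (μ : Measure Ω) (X : Fin n → Ω → Vec k) (Z : Fin n → Ω → Vec p)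
    (u : Fin n → Ω → ℝ) (ω : Ω) : Matrix (Fin k) (Fin k) ℝ :=
  Matrix.of fun a b => (n : ℝ)⁻¹ * ∑ i,
    (μ[fun ω' => (X i ω' a - stratumMean μ X Z (Z i ω') ω' a) *
        (X i ω' b - stratumMean μ X Z (Z i ω') ω' b) * u i ω' ^ 2 | sigmaAllZ Z]) ω

/-- The average error variance `σ_u^{s2}` in the stratum of the value `c`. -/
noncomputable def sigmaSq (μ : Measure Ω) (Z : Fin n → Ω → Vec p) (u : Fin n → Ω → ℝ)
    (c : Vec p) (ω : Ω) : ℝ :=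
  ((stratum (fun j => Z j ω) c).card : ℝ)⁻¹ *
    ∑ j ∈ stratum (fun j => Z j ω) c, (μ[fun ω' => u j ω' ^ 2 | sigmaZ Z j]) ω

/-- The matrix `Q^s` of the stratum of the value `c`. -/
noncomputable def qMat (μ : Measure Ω) (X : Fin n → Ω → Vec k) (Z : Fin n → Ω → Vec p)
    (c : Vec p) (ω : Ω) : Matrix (Fin k) (Fin k) ℝ :=
  Matrix.of fun a b =>
    ((stratum (fun j => Z j ω) c).card : ℝ)⁻¹ *
      ∑ j ∈ stratum (fun j => Z j ω) c, (μ[fun ω' => X j ω' a * X j ω' b | sigmaZ Z j]) ω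
    - stratumMean μ X Z c ω a * stratumMean μ X Z c ω b

/-- The matrix `∑ (n_s / n) σ_u^{s2} Q^s` over a set `T` of strata. -/
noncomputable def vMat (μ : Measure Ω) (X : Fin n → Ω → Vec k) (Z : Fin n → Ω → Vec p)
    (u : Fin n → Ω → ℝ) (T : Finset (Vec p)) (ω : Ω) : Matrix (Fin k) (Fin k) ℝ :=
  ∑ c ∈ T, (((stratum (fun j => Z j ω) c).card : ℝ) / n * sigmaSq μ Z u c ω) • qMat μ X Z c ω

open scoped Classical in
/-- The strata with at least `t` units. -/
noncomputable def largeStrata (z : Fin n → Vec p) (t : ℝ) : Finset (Vec p) :=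
  (strata z).filter (fun c => t ≤ ((stratum z c).card : ℝ))

open scoped Classical in
/-- The strata with fewer than `t` units. -/
noncomputable def smallStrata (z : Fin n → Vec p) (t : ℝ) : Finset (Vec p) :=
  (strata z).filter (fun c => ((stratum z c).card : ℝ) < t)

/-- The matrix `E[n⁻¹ X̃' X̃]`. -/
noncomputable def meanGram (μ : Measure Ω) (X : Fin n → Ω → Vec k) (Z : Fin n → Ω → Vec p) :
    Matrix (Fin k) (Fin k) ℝ :=
  Matrix.of fun a b => ∫ ω, (n : ℝ)⁻¹ *
    ((Xtilde (fun i => X i ω) (fun i => Z i ω))ᵀ * Xtilde (fun i => X i ω) (fun i => Z i ω)) a b ∂μ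

end Population

/-- The large sample conditions on a triangular array `(X_{ni}, Z_{ni}, u_{ni})`, `i = 1, …, n`;
`c n` is the threshold between small and large strata. -/
structure LargeSample {Ω : Type*} [MeasurableSpace Ω] (μ : Measure Ω) {k p : ℕ} (c : ℕ → ℝ)
    (X : (n : ℕ) → Fin n → Ω → Vec k) (Z : (n : ℕ) → Fin n → Ω → Vec p)
    (u : (n : ℕ) → Fin n → Ω → ℝ) : Prop where
  measurable_X : ∀ n i, Measurable (X n i)
  measurable_Z : ∀ n i, Measurable (Z n i)
  measurable_u : ∀ n i, Measurable (u n i)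
  threshold_ge : ∀ n : ℕ, √(n : ℝ) ≤ c n
  threshold_small : Tendsto (fun n : ℕ => c n / (n : ℝ)) atTop (𝓝 0)
  /-- Independence across units, for every sample size. -/
  indep : ∀ n, iIndepFun (fun i ω => (X n i ω, Z n i ω, u n i ω)) μ
  /-- Exogeneity given `Z_i`. -/
  exog_X : ∀ n i, μ[fun ω => u n i ω • X n i ω | sigmaZ (Z n) i] =ᵐ[μ] 0
  exog_one : ∀ n i, μ[u n i | sigmaZ (Z n) i] =ᵐ[μ] 0
  /-- Uniformly bounded conditional moments. -/
  moments : ∃ m > (2 : ℝ), ∃ M₀ : ℝ, ∀ n i,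
    Integrable (fun ω => ‖X n i ω‖ ^ (2 * m)) μ ∧ Integrable (fun ω => |u n i ω| ^ (2 * m)) μ ∧
    (∀ᵐ ω ∂μ, (μ[fun ω' => ‖X n i ω'‖ ^ (2 * m) | sigmaZ (Z n) i]) ω < M₀) ∧
    (∀ᵐ ω ∂μ, (μ[fun ω' => |u n i ω'| ^ (2 * m) | sigmaZ (Z n) i]) ω < M₀)
  /-- Nondegeneracy. The lower limits are taken in the extended reals. -/
  nondegenerate : ∃ lam > (0 : ℝ),
    (∀ᵐ ω ∂μ, (lam : EReal) <
      liminf (fun n => ((lambdaMin (omegaMat μ (X n) (Z n) (u n) ω) : ℝ) : EReal)) atTop) ∧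
    ((∀ᵐ ω ∂μ, (1 : ℕ∞) ≤
        liminf (fun n => ((largeStrata (fun i => Z n i ω) (c n)).card : ℕ∞)) atTop) →
      ∀ᵐ ω ∂μ, (lam : EReal) < liminf (fun n => ((lambdaMin (vMat μ (X n) (Z n) (u n)
        (largeStrata (fun i => Z n i ω) (c n)) ω) : ℝ) : EReal)) atTop) ∧
    ((∀ᵐ ω ∂μ, Tendsto (fun n => (smallStrata (fun i => Z n i ω) (c n)).card) atTop atTop) →
      ∀ᵐ ω ∂μ, (lam : EReal) < liminf (fun n => ((lambdaMin (vMat μ (X n) (Z n) (u n)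
        (smallStrata (fun i => Z n i ω) (c n)) ω) : ℝ) : EReal)) atTop)
  /-- The number of strata is negligible compared to the sample size. -/
  few_strata : ∀ᵐ ω ∂μ,
    Tendsto (fun n : ℕ => ((strata (fun i => Z n i ω)).card : ℝ) / (n : ℝ)) atTop (𝓝 0)

/-- The noncentral chi-squared distribution with `k` degrees of freedom and noncentrality `c ≥ 0`:
the law of the sum of squares of `k` independent normal variables with variance one whose squared
means sum up to `c` (the law depends on the means only through `c`; all are taken equal here). -/
noncomputable def noncentralChiSq (k : ℕ) (c : ℝ) : Measure ℝ :=
  (Measure.pi fun _ : Fin k => gaussianReal √(c / k) 1).map (fun x => ∑ i, x i ^ 2)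

instance (k : ℕ) (c : ℝ) : IsProbabilityMeasure (noncentralChiSq k c) :=
  Measure.isProbabilityMeasure_map
    (Finset.measurable_sum _ fun i _ => (measurable_pi_apply i).pow_const 2).aemeasurable

end StratifiedWald

/-!
Demeaning within strata removes `γ`, so the Wald statistic is a quadratic form in the demeaned regressors `X̃` and the
demeaned residuals `X̃ (β - β₀) + u - ū`, where `ū` are the stratum means of the errors (`wald_eq_waldForm`). Given
`Z_1, …, Z_n`, the pairs `(X_i, u_i)` are independent, each with its own conditional law (`map_data_eq_compProd`). All
bounds are therefore proved for independent units with fixed strata under moment conditions that are uniform in the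
strata (`UnitBounds`), and then integrated over the strata.

The demeaned regressors are `X_i - m_i` minus the errors of the stratum means. Those errors and `ū` have fourth moments
of the order `n_s ^ (-2)`. Since the reciprocals `1 / n_s`, summed over the units, give the number `S` of strata
(`sum_inv_card_stratum`), and `S / n → 0`, they affect neither the estimated variance nor the score: the sum of
products of such errors is centred, and by the Efron–Stein inequality its mean square is of the order `S` only
(`integral_sq_sum_sMean_mul_sMean_le`). What remains of the score is `n ^ (-1 / 2) ∑ (X_i - m_i) u_i`. Its conditional
characteristic function is Gaussian with variance `Ω_n` up to a Lindeberg bound (`norm_charFun_score_sub_le`), so that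
`Ω_n ^ (-1 / 2)` times this sum is asymptotically standard Gaussian although `Ω_n` is random
(`UnitArray.tendstoInDistribution_score`). The estimated variance is consistent for `Ω_n` by a weak law of large numbers
for uniformly integrable summands, and `X̃' X̃ / n` concentrates around its mean, because removing one unit changes a
within-strata sum of squares little (`integral_sq_withinSq_sub_le`).

Along local alternatives the score is thus the mean of `X̃' X̃ / n` applied to `h`, plus the leading sum, up to a vanishing
error, and the limit law follows from Slutsky's theorem and the rotation invariance of the standard Gaussian law
(`WaldLimits.tendstoInDistribution`, `map_stdGaussian_norm_add_sq`).

For distant alternatives the estimated variance is neither consistent nor known to be invertible. The statistic is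
nevertheless at least the squared length of the score divided by the trace of the estimated variance
(`waldForm_nonneg_and_le`). Since `Ω_n` is bounded below and the errors can be truncated, the mean of `X̃' X̃ / n` is
bounded below too (`WaldLimits.exists_gram_ge`), which makes the squared length of the score grow at least like
`n |β_n - β₀|²`, while the trace is at most of the order `1 + |β_n - β₀|²` (`WaldLimits.tendsto_wald_atTop`).
-/

namespace StratifiedWald

/-! ### The Efron–Stein inequality -/

theorem integral_sq_sub_const {α : Type*} [MeasurableSpace α] (P : Measure α)
    [IsProbabilityMeasure P] {f : α → ℝ} (hf : MemLp f 2 P) (a : ℝ) :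
    ∫ x, (f x - a) ^ 2 ∂P = ∫ x, f x ^ 2 ∂P - 2 * a * (∫ x, f x ∂P) + a ^ 2 := by
  have h1 : Integrable (fun x => 2 * a * f x) P := (hf.integrable (by norm_num)).const_mul _
  have h2 : Integrable (fun x => f x ^ 2) P := hf.integrable_sq
  have h3 : Integrable (fun x => f x ^ 2 - 2 * a * f x) P := h2.sub h1
  have e : ∀ x, (f x - a) ^ 2 = f x ^ 2 - 2 * a * f x + a ^ 2 := fun x => by ring
  simp_rw [e]
  rw [integral_add h3 (integrable_const _), integral_sub h2 h1, integral_const_mul]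
  simp

theorem integral_sq_sub_integral_le {α : Type*} [MeasurableSpace α] (P : Measure α)
    [IsProbabilityMeasure P] {f : α → ℝ} (hf : MemLp f 2 P) (c : ℝ) :
    ∫ x, (f x - ∫ y, f y ∂P) ^ 2 ∂P ≤ ∫ x, (f x - c) ^ 2 ∂P := by
  rw [integral_sq_sub_const P hf, integral_sq_sub_const P hf]
  nlinarith [sq_nonneg (∫ x, f x ∂P - c)]

theorem sq_integral_le {α : Type*} [MeasurableSpace α] (P : Measure α) [IsProbabilityMeasure P]
    {f : α → ℝ} (hf : MemLp f 2 P) : (∫ x, f x ∂P) ^ 2 ≤ ∫ x, f x ^ 2 ∂P := by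
  have h : (0 : ℝ) ≤ ∫ x, (f x - ∫ y, f y ∂P) ^ 2 ∂P := integral_nonneg fun x => sq_nonneg _
  rw [integral_sq_sub_const P hf] at h
  nlinarith

section prod
variable {A B : Type*} [MeasurableSpace A] [MeasurableSpace B] (P : Measure A) (Q : Measure B)
  [IsProbabilityMeasure P] [IsProbabilityMeasure Q]

theorem ae_memLp_two_section {f : A × B → ℝ} (hm : Measurable f) (hf : MemLp f 2 (P.prod Q)) :
    ∀ᵐ y ∂Q, MemLp (fun x => f (x, y)) 2 P := by
  have := hf.integrable_sq.prod_left_ae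
  filter_upwards [this] with y hy
  exact (memLp_two_iff_integrable_sq (hm.comp measurable_prodMk_right).aestronglyMeasurable).2 hy

theorem memLp_two_integral_left {f : A × B → ℝ} (hm : Measurable f) (hf : MemLp f 2 (P.prod Q)) :
    MemLp (fun y => ∫ x, f (x, y) ∂P) 2 Q := by
  have hsm : StronglyMeasurable (fun y => ∫ x, f (x, y) ∂P) :=
    hm.stronglyMeasurable.integral_prod_left'
  refine (memLp_two_iff_integrable_sq hsm.aestronglyMeasurable).2 ?_
  refine Integrable.mono' hf.integrable_sq.integral_prod_right (hsm.measurable.pow_const 2).aestronglyMeasurable ?_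
  filter_upwards [ae_memLp_two_section P Q hm hf] with y hy
  rw [Real.norm_of_nonneg (sq_nonneg _)]
  exact sq_integral_le P hy

theorem integral_sq_integral_left_le {f : A × B → ℝ} (hm : Measurable f) (hf : MemLp f 2 (P.prod Q)) :
    ∫ y, (∫ x, f (x, y) ∂P) ^ 2 ∂Q ≤ ∫ p, f p ^ 2 ∂(P.prod Q) := by
  rw [integral_prod_symm _ hf.integrable_sq]
  refine integral_mono_ae (memLp_two_integral_left P Q hm hf).integrable_sq
    hf.integrable_sq.integral_prod_right ?_
  filter_upwards [ae_memLp_two_section P Q hm hf] with y hy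
  exact sq_integral_le P hy

/-- Conditioning on the second coordinate splits the variance into the mean conditional variance, which is at most the
mean square distance to any `f₀` free of the first coordinate, and the variance of the conditional mean. -/
theorem integral_sq_sub_integral_prod_le {f f₀ : A × B → ℝ} (hm : Measurable f)
    (hf : MemLp f 2 (P.prod Q)) (hf₀ : MemLp f₀ 2 (P.prod Q))
    (h₀ : ∀ x x' y, f₀ (x, y) = f₀ (x', y)) :
    ∫ p, (f p - ∫ q, f q ∂(P.prod Q)) ^ 2 ∂(P.prod Q) ≤
      ∫ p, (f p - f₀ p) ^ 2 ∂(P.prod Q) +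
      ∫ y, ((∫ x, f (x, y) ∂P) - ∫ y', (∫ x, f (x, y') ∂P) ∂Q) ^ 2 ∂Q := by
  set g : B → ℝ := fun y => ∫ x, f (x, y) ∂P with hg
  have hgL : MemLp g 2 Q := memLp_two_integral_left P Q hm hf
  have hgm : Measurable g := hm.stronglyMeasurable.integral_prod_left'.measurable
  have hc : ∫ q, f q ∂(P.prod Q) = ∫ y, g y ∂Q :=
    integral_prod_symm _ (hf.integrable (by norm_num))
  rw [hc]
  set c := ∫ y, g y ∂Q
  have hL1 : MemLp (fun p : A × B => f p - c) 2 (P.prod Q) := hf.sub (memLp_const c)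
  have hL0 : MemLp (fun p : A × B => f p - f₀ p) 2 (P.prod Q) := hf.sub hf₀
  have hL2 : MemLp (fun y => g y - c) 2 Q := hgL.sub (memLp_const c)
  rw [integral_prod_symm _ hL1.integrable_sq, integral_prod_symm _ hL0.integrable_sq,
    ← integral_add hL0.integrable_sq.integral_prod_right hL2.integrable_sq]
  refine integral_mono_ae hL1.integrable_sq.integral_prod_right
    (hL0.integrable_sq.integral_prod_right.add hL2.integrable_sq) ?_
  filter_upwards [ae_memLp_two_section P Q hm hf] with y hy
  have hne : Nonempty A := by
    by_contra h
    rw [not_nonempty_iff] at h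
    exact IsProbabilityMeasure.ne_zero P (Measure.eq_zero_of_isEmpty P)
  obtain ⟨x₀⟩ := hne
  have hle := integral_sq_sub_integral_le P hy (f₀ (x₀, y))
  have h2 : ∫ x, (f (x, y) - f₀ (x, y)) ^ 2 ∂P = ∫ x, (f (x, y) - f₀ (x₀, y)) ^ 2 ∂P := by
    congr 1; ext x; rw [h₀ x x₀ y]
  have e : ∫ x, (f (x, y) - c) ^ 2 ∂P = ∫ x, (f (x, y) - g y) ^ 2 ∂P + (g y - c) ^ 2 := by
    rw [integral_sq_sub_const P hy, integral_sq_sub_const P hy]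
    ring
  rw [e, h2]
  gcongr
end prod

/-- The **Efron–Stein inequality**: the variance of a function of independent coordinates is at most the sum over `i`
of the mean square distance to any function `f' i` that does not depend on the coordinate `i`. -/
theorem efron_stein {E : Type*} [MeasurableSpace E] : ∀ {n : ℕ} (P : Fin n → Measure E)
    [∀ i, IsProbabilityMeasure (P i)] {f : (Fin n → E) → ℝ} {f' : Fin n → (Fin n → E) → ℝ}
    (_ : Measurable f) (_ : MemLp f 2 (Measure.pi P)) (_ : ∀ i, Measurable (f' i))
    (_ : ∀ i, MemLp (f' i) 2 (Measure.pi P))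
    (_ : ∀ i w x, f' i (Function.update w i x) = f' i w),
    ∫ w, (f w - ∫ w', f w' ∂(Measure.pi P)) ^ 2 ∂(Measure.pi P) ≤
      ∑ i, ∫ w, (f w - f' i w) ^ 2 ∂(Measure.pi P) := by
  intro n
  induction n with
  | zero =>
    intro P _ f f' _ _ _ _ _
    have : ∀ w : Fin 0 → E, f w = f default := fun w => by rw [Subsingleton.elim w default]
    simp [this]
  | succ n ih =>
    intro P _ f f' hm hf hm' hf' hind
    let φ := MeasurableEquiv.piFinSuccAbove (fun _ : Fin (n+1) => E) 0
    have hφ : MeasurePreserving φ (Measure.pi P) ((P 0).prod (Measure.pi fun j => P (Fin.succ j))) := by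
      exact measurePreserving_piFinSuccAbove P 0
    have hψ := hφ.symm
    set Q := Measure.pi fun j : Fin n => P (Fin.succ j) with hQ
    have tr : ∀ G : (Fin (n+1) → E) → ℝ, ∫ w, G w ∂(Measure.pi P) = ∫ p, G (φ.symm p) ∂((P 0).prod Q) :=
      fun G => (hψ.integral_comp φ.symm.measurableEmbedding G).symm
    have hφs : ∀ x y, φ.symm (x, y) = Fin.cons x y := by
      intro x y; simp [φ]; rfl
    rw [tr, tr, Fin.sum_univ_succ]
    have hF : MemLp (fun p => f (φ.symm p)) 2 ((P 0).prod Q) := hf.comp_measurePreserving hψ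
    have hFm : Measurable (fun p => f (φ.symm p)) := hm.comp φ.symm.measurable
    have hF' : ∀ i, MemLp (fun p => f' i (φ.symm p)) 2 ((P 0).prod Q) :=
      fun i => (hf' i).comp_measurePreserving hψ
    have hFm' : ∀ i, Measurable (fun p => f' i (φ.symm p)) := fun i => (hm' i).comp φ.symm.measurable
    refine (integral_sq_sub_integral_prod_le (P 0) Q hFm hF (hF' 0) ?_).trans ?_
    · intro x x' y
      simp only [hφs]
      rw [← hind 0 (Fin.cons x' y) x]
      simp
    · rw [tr]
      gcongr
      refine (ih (fun j => P (Fin.succ j)) (f := fun y => ∫ x, f (φ.symm (x, y)) ∂(P 0))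
        (f' := fun i y => ∫ x, f' i.succ (φ.symm (x, y)) ∂(P 0))
        hFm.stronglyMeasurable.integral_prod_left'.measurable
        (memLp_two_integral_left _ _ hFm hF)
        (fun i => (hFm' i.succ).stronglyMeasurable.integral_prod_left'.measurable)
        (fun i => memLp_two_integral_left _ _ (hFm' i.succ) (hF' i.succ)) ?_).trans ?_
      · intro i w x
        congr 1
        ext a
        simp only [hφs]
        rw [← hind i.succ (Fin.cons a w) x]
        simp [Fin.cons_update]
      · refine Finset.sum_le_sum fun i _ => ?_
        rw [tr]
        have hD := hF.sub (hF' i.succ)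
        have hDm := hFm.sub (hFm' i.succ)
        refine le_trans (le_of_eq ?_) (integral_sq_integral_left_le (P 0) Q hDm hD)
        refine integral_congr_ae ?_
        filter_upwards [ae_memLp_two_section _ _ hFm hF, ae_memLp_two_section _ _ (hFm' i.succ) (hF' i.succ)]
          with y h1 h2
        rw [← integral_sub (h1.integrable (by norm_num)) (h2.integrable (by norm_num))]

/-! ### Sums of independent variables: law of large numbers and fourth moments -/

section pi
variable {E : Type*} [MeasurableSpace E] {n : ℕ} (P : Fin n → Measure E) [∀ i, IsProbabilityMeasure (P i)]

theorem integral_pi_eval (i : Fin n) {G : E → ℝ} (hG : Measurable G) :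
    ∫ w, G (w i) ∂(Measure.pi P) = ∫ x, G x ∂(P i) := by
  rw [← (measurePreserving_eval P i).map_eq,
    integral_map (measurable_pi_apply i).aemeasurable hG.aestronglyMeasurable]

theorem integrable_pi_eval (i : Fin n) {G : E → ℝ} (hG : Integrable G (P i)) :
    Integrable (fun w => G (w i)) (Measure.pi P) :=
  (measurePreserving_eval P i).integrable_comp_of_integrable hG

theorem memLp_pi_eval (i : Fin n) {G : E → ℝ} {p : ENNReal} (hG : MemLp G p (P i)) :
    MemLp (fun w : Fin n → E => G (w i)) p (Measure.pi P) :=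
  hG.comp_measurePreserving (measurePreserving_eval P i)

theorem integral_sq_sum_sub_le {g : Fin n → E → ℝ} (hm : ∀ i, Measurable (g i))
    (hg : ∀ i, MemLp (g i) 2 (P i)) :
    ∫ w, (∑ i, (g i (w i) - ∫ x, g i x ∂(P i))) ^ 2 ∂(Measure.pi P) ≤ ∑ i, ∫ x, g i x ^ 2 ∂(P i) := by
  have hgw : ∀ i, MemLp (fun w : Fin n → E => g i (w i)) 2 (Measure.pi P) :=
    fun i => memLp_pi_eval P i (hg i)
  have hgm : ∀ i, Measurable (fun w : Fin n → E => g i (w i)) :=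
    fun i => (hm i).comp (measurable_pi_apply i)
  have h := efron_stein P (f := fun w => ∑ j, g j (w j))
    (f' := fun i w => ∑ j ∈ Finset.univ.erase i, g j (w j))
    (Finset.measurable_fun_sum _ fun j _ => hgm j) (memLp_finsetSum _ fun j _ => hgw j)
    (fun i => Finset.measurable_fun_sum _ fun j _ => hgm j)
    (fun i => memLp_finsetSum _ fun j _ => hgw j) ?_
  · rw [integral_finsetSum _ fun j _ => (hgw j).integrable (by norm_num)] at h
    simp_rw [fun i => integral_pi_eval P i (hm i), ← Finset.sum_sub_distrib] at h
    refine h.trans (Finset.sum_le_sum fun i _ => le_of_eq ?_)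
    rw [← integral_pi_eval P i ((hm i).pow_const 2)]
    congr 1
    ext w
    rw [← Finset.add_sum_erase _ _ (Finset.mem_univ i)]
    ring
  · intro i w x
    refine Finset.sum_congr rfl fun j hj => ?_
    rw [Function.update_of_ne (Finset.ne_of_mem_erase hj)]

theorem integral_abs_le_sqrt {α : Type*} [MeasurableSpace α] (μ : Measure α) [IsProbabilityMeasure μ]
    {f : α → ℝ} (hf : MemLp f 2 μ) : ∫ x, |f x| ∂μ ≤ √(∫ x, f x ^ 2 ∂μ) := by
  refine Real.le_sqrt_of_sq_le ?_
  have := sq_integral_le μ hf.norm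
  simpa using this

/-- A weak law of large numbers in `L¹` that needs first moments only: the parts of the summands truncated at `K` are
controlled by their variance, and the tails enter once through themselves and once through their means. -/
theorem integral_abs_sum_sub_le {g : Fin n → E → ℝ} (hm : ∀ i, Measurable (g i))
    (hg : ∀ i, Integrable (g i) (P i)) {K τ : ℝ} (hK : 0 ≤ K)
    (hτ : ∀ i, ∫ x, {x | K < |g i x|}.indicator (fun x => |g i x|) x ∂(P i) ≤ τ) :
    ∫ w, |∑ i, (g i (w i) - ∫ x, g i x ∂(P i))| ∂(Measure.pi P) ≤ √n * K + n * (2 * τ) := by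
  have hS : ∀ i, MeasurableSet {x | K < |g i x|} :=
    fun i => measurableSet_lt measurable_const (hm i).abs
  -- `b` are the truncated parts of the summands and `r` their tails
  set b : Fin n → E → ℝ := fun i => {x | K < |g i x|}ᶜ.indicator (g i) with hb
  set r : Fin n → E → ℝ := fun i => {x | K < |g i x|}.indicator (g i) with hr
  have hbm : ∀ i, Measurable (b i) := fun i => (hm i).indicator (hS i).compl
  have hrm : ∀ i, Measurable (r i) := fun i => (hm i).indicator (hS i)
  have hbK : ∀ i x, |b i x| ≤ K := by
    intro i x
    by_cases hx : K < |g i x|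
    · have : x ∉ {x | K < |g i x|}ᶜ := by simpa using hx
      rw [hb]; simp only [Set.indicator_of_notMem this, abs_zero]; exact hK
    · have : x ∈ {x | K < |g i x|}ᶜ := hx
      rw [hb]; simp only [Set.indicator_of_mem this]; exact not_lt.1 hx
  have hbL : ∀ i, MemLp (b i) 2 (P i) := fun i =>
    MemLp.of_bound (hbm i).aestronglyMeasurable K (ae_of_all _ fun x => hbK i x)
  have hrI : ∀ i, Integrable (r i) (P i) := fun i => (hg i).indicator (hS i)
  have hbI : ∀ i, Integrable (b i) (P i) := fun i => (hg i).indicator (hS i).compl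
  have hsum : ∀ i x, g i x = b i x + r i x := fun i x => by
    rw [hb, hr]; simp only; rw [add_comm]
    exact (congrFun (Set.indicator_self_add_compl {x | K < |g i x|} (g i)) x).symm
  have hint : ∀ i, ∫ x, g i x ∂(P i) = ∫ x, b i x ∂(P i) + ∫ x, r i x ∂(P i) := fun i => by
    rw [← integral_add (hbI i) (hrI i)]
    exact integral_congr_ae (ae_of_all _ fun x => hsum i x)
  have hrτ : ∀ i, ∫ x, |r i x| ∂(P i) ≤ τ := fun i => by
    refine le_trans (le_of_eq ?_) (hτ i)
    congr 1; ext x; rw [hr]; simp only; rw [← Real.norm_eq_abs, norm_indicator_eq_indicator_norm]; rfl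
  have hBL : MemLp (fun w : Fin n → E => ∑ i, (b i (w i) - ∫ x, b i x ∂(P i))) 2 (Measure.pi P) :=
    memLp_finsetSum _ fun i _ => (memLp_pi_eval P i (hbL i)).sub (memLp_const _)
  have hRI : ∀ i, Integrable (fun w : Fin n → E => |r i (w i)|) (Measure.pi P) := fun i =>
    integrable_pi_eval P i (hrI i).abs
  have hpt : ∀ w : Fin n → E, |∑ i, (g i (w i) - ∫ x, g i x ∂(P i))| ≤
      |∑ i, (b i (w i) - ∫ x, b i x ∂(P i))| + ∑ i, (|r i (w i)| + τ) := by
    intro w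
    have : ∑ i, (g i (w i) - ∫ x, g i x ∂(P i)) = ∑ i, (b i (w i) - ∫ x, b i x ∂(P i)) +
        ∑ i, (r i (w i) - ∫ x, r i x ∂(P i)) := by
      rw [← Finset.sum_add_distrib]
      refine Finset.sum_congr rfl fun i _ => ?_
      rw [hsum, hint]; ring
    rw [this]
    refine (abs_add_le _ _).trans (add_le_add le_rfl ?_)
    refine (Finset.abs_sum_le_sum_abs _ _).trans (Finset.sum_le_sum fun i _ => ?_)
    refine (abs_sub _ _).trans (add_le_add le_rfl ?_)
    exact abs_integral_le_integral_abs.trans (hrτ i)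
  have hI2 : Integrable (fun w : Fin n → E => ∑ i, (|r i (w i)| + τ)) (Measure.pi P) :=
    integrable_finsetSum _ fun i _ => (hRI i).add (integrable_const _)
  have hI1 := (hBL.integrable (by norm_num)).abs
  refine (integral_mono_of_nonneg (ae_of_all _ fun _ => abs_nonneg _) (hI1.add hI2)
    (ae_of_all _ hpt)).trans ?_
  simp only [Pi.add_apply]
  rw [integral_add hI1 hI2]
  refine add_le_add ?_ ?_
  · refine (integral_abs_le_sqrt _ hBL).trans ?_
    refine Real.sqrt_le_iff.2 ⟨by positivity, (integral_sq_sum_sub_le P hbm hbL).trans ?_⟩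
    have : ∀ i, ∫ x, b i x ^ 2 ∂(P i) ≤ K ^ 2 := fun i => by
      have : ∫ x, b i x ^ 2 ∂(P i) ≤ ∫ x, K ^ 2 ∂(P i) :=
        integral_mono (hbL i).integrable_sq (integrable_const _) fun x => by
          simpa using pow_le_pow_left₀ (abs_nonneg _) (hbK i x) 2
      simpa using this
    refine (Finset.sum_le_sum fun i _ => this i).trans (le_of_eq ?_)
    simp [mul_pow]
  · rw [integral_finsetSum _ fun i _ => (hRI i).fun_add (integrable_const _)]
    have : ∀ i, ∫ w, (|r i (w i)| + τ) ∂(Measure.pi P) ≤ 2 * τ := fun i => by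
      rw [integral_add (hRI i) (integrable_const _), integral_pi_eval P i (hrm i).abs]
      simp only [integral_const, probReal_univ, one_smul]
      linarith [hrτ i]
    refine (Finset.sum_le_sum fun i _ => this i).trans (le_of_eq ?_)
    simp

end pi

theorem integrable_pow_of_memLp_four {α : Type*} [MeasurableSpace α] {μ : Measure α} [IsProbabilityMeasure μ]
    {f : α → ℝ} (hf : MemLp f 4 μ) {j : ℕ} (hj : j ≤ 4) : Integrable (fun x => f x ^ j) μ := by
  have h := (hf.mono_exponent (p := j) (by exact_mod_cast hj)).integrable_norm_pow'
  refine h.mono' (hf.1.pow j) (ae_of_all _ fun x => ?_)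
  simp

/-- The fourth moment of a sum of independent centred variables is of the order of the square of the number of
summands, because every summand of the expansion with an odd power vanishes in the mean. -/
theorem integral_sum_pow_four_le {Ω ι : Type*} [MeasurableSpace Ω] {μ : Measure Ω} [IsProbabilityMeasure μ]
    {Y : ι → Ω → ℝ} (hm : ∀ i, Measurable (Y i)) (hY : ∀ i, MemLp (Y i) 4 μ)
    (hind : iIndepFun Y μ) (h0 : ∀ i, ∫ ω, Y i ω ∂μ = 0) {M : ℝ}
    (hM : ∀ i, ∫ ω, Y i ω ^ 4 ∂μ ≤ M) (s : Finset ι) :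
    ∫ ω, (∑ i ∈ s, Y i ω) ^ 4 ∂μ ≤ 3 * M * (s.card : ℝ) ^ 2 := by
  classical
  have hY2 : ∀ i, ∫ ω, Y i ω ^ 2 ∂μ ≤ √M := fun i => by
    refine Real.le_sqrt_of_sq_le ((sq_integral_le μ ?_).trans (le_trans (le_of_eq ?_) (hM i)))
    · refine (memLp_two_iff_integrable_sq ((hm i).pow_const 2).aestronglyMeasurable).2 ?_
      simpa [← pow_mul] using integrable_pow_of_memLp_four (hY i) (j := 4) le_rfl
    · simp [← pow_mul]
  -- the induction on the number of summands needs the mean and the second moment as well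
  suffices H : (∫ ω, (∑ i ∈ s, Y i ω) ^ 2 ∂μ ≤ s.card * √M) ∧ (∫ ω, (∑ i ∈ s, Y i ω) ∂μ = 0) ∧
    ∫ ω, (∑ i ∈ s, Y i ω) ^ 4 ∂μ ≤ 3 * M * (s.card : ℝ) ^ 2 from H.2.2
  induction s using Finset.induction_on with
  | empty => simp
  | insert i s his ih =>
    obtain ⟨ih2, ih1, ih4⟩ := ih
    have hSL : MemLp (fun ω => ∑ j ∈ s, Y j ω) 4 μ := memLp_finsetSum _ fun j _ => hY j
    have hSm : Measurable (fun ω => ∑ j ∈ s, Y j ω) := Finset.measurable_fun_sum _ fun j _ => hm j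
    set S : Ω → ℝ := fun ω => ∑ j ∈ s, Y j ω with hS
    have hSi : IndepFun S (Y i) μ := by
      have := hind.indepFun_finsetSum_of_notMem hm his
      rwa [show (∑ j ∈ s, Y j) = S by ext ω; simp [hS]] at this
    have hM0 : 0 ≤ M := (integral_nonneg fun ω => by positivity).trans (hM i)
    have iS : ∀ j ≤ 4, Integrable (fun ω => S ω ^ j) μ := fun j hj => integrable_pow_of_memLp_four hSL hj
    have iY : ∀ j ≤ 4, Integrable (fun ω => Y i ω ^ j) μ := fun j hj => integrable_pow_of_memLp_four (hY i) hj
    have hprodind : ∀ j l : ℕ, IndepFun (fun ω => S ω ^ j) (fun ω => Y i ω ^ l) μ := fun j l =>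
      hSi.comp (φ := fun x => x ^ j) (ψ := fun x => x ^ l) (by fun_prop) (by fun_prop)
    have iSY : ∀ j ≤ 4, ∀ l ≤ 4, Integrable (fun ω => S ω ^ j * Y i ω ^ l) μ := fun j hj l hl =>
      (hprodind j l).integrable_mul (iS j hj) (iY l hl)
    have eSY : ∀ j l : ℕ, ∫ ω, S ω ^ j * Y i ω ^ l ∂μ = (∫ ω, S ω ^ j ∂μ) * ∫ ω, Y i ω ^ l ∂μ := fun j l =>
      (hprodind j l).integral_fun_mul_eq_mul_integral (hSm.pow_const j).aestronglyMeasurable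
        ((hm i).pow_const l).aestronglyMeasurable
    have hY0 : ∫ ω, Y i ω ^ 1 ∂μ = 0 := by simpa using h0 i
    have hS0 : ∫ ω, S ω ^ 1 ∂μ = 0 := by simpa using ih1
    simp_rw [Finset.sum_insert his, Finset.card_insert_of_notMem his]
    change ∫ ω, (Y i ω + S ω) ^ 2 ∂μ ≤ _ ∧ ∫ ω, (Y i ω + S ω) ∂μ = _ ∧ ∫ ω, (Y i ω + S ω) ^ 4 ∂μ ≤ _
    refine ⟨?_, ?_, ?_⟩
    · have e : ∀ ω, (Y i ω + S ω) ^ 2 = Y i ω ^ 2 + (2 * (S ω ^ 1 * Y i ω ^ 1) + S ω ^ 2) := fun ω => by ring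
      simp_rw [e]
      have i1 := (iSY 1 (by norm_num) 1 (by norm_num)).const_mul 2
      rw [integral_add (iY 2 (by norm_num)) (i1.fun_add (iS 2 (by norm_num))),
        integral_add i1 (iS 2 (by norm_num)), integral_const_mul, eSY, hY0]
      push_cast
      linarith [hY2 i]
    · have i1 := iY 1 (by norm_num)
      have i2 := iS 1 (by norm_num)
      simp only [pow_one] at i1 i2
      rw [integral_add i1 i2, h0, ih1, add_zero]
    · have e : ∀ ω, (Y i ω + S ω) ^ 4 = Y i ω ^ 4 + (4 * (S ω ^ 1 * Y i ω ^ 3) +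
          (6 * (S ω ^ 2 * Y i ω ^ 2) + (4 * (S ω ^ 3 * Y i ω ^ 1) + S ω ^ 4))) := fun ω => by ring
      simp_rw [e]
      have j4 := iS 4 le_rfl
      have j3 := (iSY 3 (by norm_num) 1 (by norm_num)).const_mul 4
      have j2 := (iSY 2 (by norm_num) 2 (by norm_num)).const_mul 6
      have j1 := (iSY 1 (by norm_num) 3 (by norm_num)).const_mul 4
      rw [integral_add (iY 4 le_rfl) (j1.fun_add (j2.fun_add (j3.fun_add j4))), integral_add j1 (j2.fun_add (j3.fun_add j4)),
        integral_add j2 (j3.fun_add j4), integral_add j3 j4]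
      simp only [integral_const_mul, eSY, hY0, hS0, mul_zero, zero_mul, zero_add]
      have hb : (∫ ω, S ω ^ 2 ∂μ) * ∫ ω, Y i ω ^ 2 ∂μ ≤ s.card * √M * √M :=
        mul_le_mul ih2 (hY2 i) (integral_nonneg fun ω => by positivity) (by positivity)
      rw [mul_assoc, Real.mul_self_sqrt hM0] at hb
      push_cast
      nlinarith [hM i]

/-! ### Characteristic functions of sums of independent variables -/

/-- Second order Taylor bound for `exp (i x)` in Lindeberg form: the cubic remainder counts for `|x| ≤ η` and a multiple
of `x ^ 2` for `|x| > η`. -/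
theorem norm_exp_mul_I_sub_taylor_le {η : ℝ} (hη : 0 < η) (hη1 : η ≤ 1) (x : ℝ) :
    ‖Complex.exp (x * Complex.I) - (1 + x * Complex.I - (x : ℂ) ^ 2 / 2)‖ ≤
      η * x ^ 2 + 4 * {y : ℝ | η < |y|}.indicator (fun y => y ^ 2) x := by
  have hx3 : |x| ≤ 1 → ‖Complex.exp (x * Complex.I) - (1 + x * Complex.I - (x : ℂ) ^ 2 / 2)‖ ≤ |x| ^ 3 := by
    intro hx
    have h := Complex.exp_bound (x := x * Complex.I) (by simpa using hx) (n := 3) (by norm_num)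
    simp only [Finset.sum_range_succ, Finset.sum_range_zero, Nat.factorial] at h
    have e : (1 + x * Complex.I - (x : ℂ) ^ 2 / 2) = 0 + (↑x * Complex.I) ^ 0 / ((1:ℕ):ℂ)
      + (↑x * Complex.I) ^ 1 / ((Nat.succ 0 * 1 : ℕ):ℂ) + (↑x * Complex.I) ^ 2 / (((1 + 1) * (Nat.succ 0 * 1) : ℕ) : ℂ) := by
      push_cast
      simp only [pow_zero, pow_one, mul_pow, Complex.I_sq]; ring
    simp only [Nat.succ_eq_add_one] at e h
    rw [e]
    refine h.trans ?_
    simp only [norm_mul, Complex.norm_real, Complex.norm_I, mul_one, Real.norm_eq_abs]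
    have : 0 ≤ |x| ^ 3 := by positivity
    push_cast
    nlinarith
  by_cases hxη : η < |x|
  · rw [Set.indicator_of_mem (by exact hxη)]
    by_cases hx1 : |x| ≤ 1
    · refine (hx3 hx1).trans ?_
      have h2 := sq_abs x
      nlinarith [abs_nonneg x, sq_nonneg x, mul_nonneg hη.le (sq_nonneg x), mul_nonneg (sq_nonneg |x|) (sub_nonneg.2 hx1)]
    · push Not at hx1
      have h1 : ‖Complex.exp (x * Complex.I)‖ = 1 := Complex.norm_exp_ofReal_mul_I x
      have h2 : ‖(1 + x * Complex.I - (x : ℂ) ^ 2 / 2)‖ ≤ 1 + |x| + x ^ 2 / 2 := by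
        refine (norm_sub_le _ _).trans (add_le_add ((norm_add_le _ _).trans ?_) ?_)
        · simp
        · simp
      refine (norm_sub_le _ _).trans ?_
      rw [h1]
      have h3 := sq_abs x
      nlinarith [mul_nonneg hη.le (sq_nonneg x)]
  · rw [Set.indicator_of_notMem (by exact hxη)]
    push Not at hxη
    refine (hx3 (hxη.trans hη1)).trans ?_
    have h3 := sq_abs x
    nlinarith [abs_nonneg x, mul_nonneg (sq_nonneg |x|) (sub_nonneg.2 hxη)]

/-- The characteristic function of a centred variable is close to one minus half the variance, up to its truncated
second moment. -/
theorem norm_charFun_sub_le {α : Type*} [MeasurableSpace α] (P : Measure α) [IsProbabilityMeasure P]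
    {ζ : α → ℝ} (hm : Measurable ζ) (hL : MemLp ζ 2 P) (h0 : ∫ x, ζ x ∂P = 0) {η : ℝ} (hη : 0 < η)
    (hη1 : η ≤ 1) :
    ‖∫ x, Complex.exp (ζ x * Complex.I) ∂P - (1 - (∫ x, ζ x ^ 2 ∂P : ℝ) / 2 : ℂ)‖ ≤
      η * ∫ x, ζ x ^ 2 ∂P + 4 * ∫ x, {y | η < |ζ y|}.indicator (fun y => ζ y ^ 2) x ∂P := by
  have i1 : Integrable (fun x => (ζ x : ℂ)) P := (hL.integrable (by norm_num)).ofReal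
  have i2 : Integrable (fun x => ((ζ x ^ 2 : ℝ) : ℂ)) P := hL.integrable_sq.ofReal
  have i3 : Integrable (fun x => Complex.exp (ζ x * Complex.I)) P := by
    refine Integrable.of_bound (C := 1) (by fun_prop) (ae_of_all _ fun x => ?_)
    rw [Complex.norm_exp_ofReal_mul_I]
  have i4 : Integrable (fun x => {y | η < |ζ y|}.indicator (fun y => ζ y ^ 2) x) P :=
    hL.integrable_sq.indicator (measurableSet_lt measurable_const hm.abs)
  have i5 : Integrable (fun x => (1 + ζ x * Complex.I - (ζ x : ℂ) ^ 2 / 2)) P := by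
    have := ((integrable_const (1:ℂ)).add (i1.mul_const Complex.I)).sub (i2.div_const 2) (μ := P)
    refine this.congr (ae_of_all _ fun x => ?_)
    simp
  have e : ∫ x, (1 + ζ x * Complex.I - (ζ x : ℂ) ^ 2 / 2) ∂P = (1 - (∫ x, ζ x ^ 2 ∂P : ℝ) / 2 : ℂ) := by
    have h2 : ∀ x, (ζ x : ℂ) ^ 2 / 2 = ((ζ x ^ 2 : ℝ) : ℂ) / 2 := fun x => by push_cast; ring
    simp_rw [h2]
    rw [integral_sub (f := fun x => (1 + ζ x * Complex.I : ℂ)) ((integrable_const _).add (i1.mul_const _)) (i2.div_const _),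
      integral_add (integrable_const _) (i1.mul_const _), integral_mul_const, integral_div,
      integral_complex_ofReal, integral_complex_ofReal, h0]
    simp
  rw [← e, ← integral_sub i3 i5]
  refine (norm_integral_le_integral_norm _).trans ?_
  rw [← integral_const_mul, ← integral_const_mul, ← integral_add (hL.integrable_sq.const_mul _) (i4.const_mul _)]
  refine integral_mono (i3.sub i5).norm ((hL.integrable_sq.const_mul _).add (i4.const_mul _)) fun x => ?_
  exact norm_exp_mul_I_sub_taylor_le hη hη1 (ζ x)

theorem norm_prod_sub_prod_le_sum {ι : Type*} (s : Finset ι) {a b : ι → ℂ} (ha : ∀ i, ‖a i‖ ≤ 1)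
    (hb : ∀ i, ‖b i‖ ≤ 1) : ‖∏ i ∈ s, a i - ∏ i ∈ s, b i‖ ≤ ∑ i ∈ s, ‖a i - b i‖ := by
  classical
  induction s using Finset.induction_on with
  | empty => simp
  | insert i s his ih =>
    rw [Finset.prod_insert his, Finset.prod_insert his, Finset.sum_insert his]
    have e : a i * ∏ j ∈ s, a j - b i * ∏ j ∈ s, b j =
      (a i - b i) * ∏ j ∈ s, a j + b i * (∏ j ∈ s, a j - ∏ j ∈ s, b j) := by ring
    rw [e]
    refine (norm_add_le _ _).trans (add_le_add ?_ ?_)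
    · rw [norm_mul]
      refine mul_le_of_le_one_right (norm_nonneg _) ?_
      rw [norm_prod]
      exact Finset.prod_le_one (fun _ _ => norm_nonneg _) fun j _ => ha j
    · rw [norm_mul]
      exact (mul_le_of_le_one_left (norm_nonneg _) (hb i)).trans ih

theorem abs_exp_neg_sub_le {x : ℝ} (hx : 0 ≤ x) : |Real.exp (-x) - (1 - x)| ≤ x ^ 2 := by
  have h1 : 1 - x ≤ Real.exp (-x) := by linarith [Real.add_one_le_exp (-x)]
  rw [abs_of_nonneg (by linarith)]
  by_cases hx1 : x ≤ 1
  · have := Real.abs_exp_sub_one_sub_id_le (x := -x) (by rwa [abs_neg, abs_of_nonneg hx])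
    rw [abs_le] at this
    nlinarith [this.2]
  · have : Real.exp (-x) ≤ 1 := Real.exp_le_one_iff.2 (by linarith)
    nlinarith

/-- A quantitative form of **Lindeberg's theorem**: the characteristic function of a sum of independent centred variables
with total variance `σ` is close to the Gaussian one if every variance `s` and the truncated second moments `τ` are
small. -/
theorem norm_charFun_sum_sub_le {E : Type*} [MeasurableSpace E] {n : ℕ} (P : Fin n → Measure E)
    [∀ i, IsProbabilityMeasure (P i)] {ζ : Fin n → E → ℝ} (hm : ∀ i, Measurable (ζ i))
    (hL : ∀ i, MemLp (ζ i) 2 (P i)) (h0 : ∀ i, ∫ x, ζ i x ∂(P i) = 0) {η σ s τ : ℝ} (hη : 0 < η)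
    (hη1 : η ≤ 1) (hσ : ∑ i, ∫ x, ζ i x ^ 2 ∂(P i) = σ) (hs : ∀ i, ∫ x, ζ i x ^ 2 ∂(P i) ≤ s)
    (hτ : ∑ i, ∫ x, {y | η < |ζ i y|}.indicator (fun y => ζ i y ^ 2) x ∂(P i) ≤ τ) :
    ‖∫ w, Complex.exp ((∑ i, ζ i (w i) : ℝ) * Complex.I) ∂(Measure.pi P) - Complex.exp (-(σ / 2 : ℝ))‖ ≤
      η * σ + 4 * τ + s * σ := by
  have e1 : ∫ w, Complex.exp ((∑ i, ζ i (w i) : ℝ) * Complex.I) ∂(Measure.pi P) =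
      ∏ i, ∫ x, Complex.exp (ζ i x * Complex.I) ∂(P i) := by
    rw [← integral_fintype_prod_eq_prod (fun i x => Complex.exp (ζ i x * Complex.I))]
    congr 1; ext w
    rw [← Complex.exp_sum]; push_cast; rw [Finset.sum_mul]
  have e2 : Complex.exp (-(σ / 2 : ℝ)) = ∏ i, Complex.exp (-((∫ x, ζ i x ^ 2 ∂(P i)) / 2 : ℝ)) := by
    rw [← Complex.exp_sum, ← hσ]; push_cast; rw [Finset.sum_neg_distrib, Finset.sum_div]
  have hv : ∀ i, 0 ≤ ∫ x, ζ i x ^ 2 ∂(P i) := fun i => integral_nonneg fun x => sq_nonneg _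
  rw [e1, e2]
  refine (norm_prod_sub_prod_le_sum _ (fun i => ?_) fun i => ?_).trans ?_
  · refine (norm_integral_le_integral_norm _).trans ?_
    simp [Complex.norm_exp_ofReal_mul_I]
  · rw [Complex.norm_exp]
    refine Real.exp_le_one_iff.2 ?_
    simp only [Complex.neg_re, Complex.ofReal_re]
    linarith [hv i]
  · have hi : ∀ i, ‖∫ x, Complex.exp (ζ i x * Complex.I) ∂(P i) -
        Complex.exp (-((∫ x, ζ i x ^ 2 ∂(P i)) / 2 : ℝ))‖ ≤ η * ∫ x, ζ i x ^ 2 ∂(P i) +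
        4 * ∫ x, {y | η < |ζ i y|}.indicator (fun y => ζ i y ^ 2) x ∂(P i) + s * ∫ x, ζ i x ^ 2 ∂(P i) := by
      intro i
      refine (norm_sub_le_norm_sub_add_norm_sub _ (1 - (∫ x, ζ i x ^ 2 ∂(P i) : ℝ) / 2 : ℂ) _).trans
        (add_le_add (norm_charFun_sub_le (P i) (hm i) (hL i) (h0 i) hη hη1) ?_)
      have h := abs_exp_neg_sub_le (x := (∫ x, ζ i x ^ 2 ∂(P i)) / 2) (by linarith [hv i])
      rw [norm_sub_rev]
      have e3 : Complex.exp (-((∫ x, ζ i x ^ 2 ∂(P i)) / 2 : ℝ)) - (1 - (∫ x, ζ i x ^ 2 ∂(P i) : ℝ) / 2 : ℂ)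
        = ((Real.exp (-((∫ x, ζ i x ^ 2 ∂(P i)) / 2)) - (1 - (∫ x, ζ i x ^ 2 ∂(P i)) / 2) : ℝ) : ℂ) := by
        push_cast; ring
      rw [e3, Complex.norm_real, Real.norm_eq_abs]
      refine h.trans ?_
      nlinarith [hs i, hv i]
    refine (Finset.sum_le_sum fun i _ => hi i).trans ?_
    rw [Finset.sum_add_distrib, Finset.sum_add_distrib, ← Finset.mul_sum, ← Finset.mul_sum, ← Finset.mul_sum, hσ]
    linarith

/-! ### Stratum means -/

section strata
variable {n k p : ℕ}

theorem mem_stratum {z : Fin n → Vec p} {c : Vec p} {j : Fin n} : j ∈ stratum z c ↔ z j = c := by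
  simp [stratum]

theorem card_stratum_pos (z : Fin n → Vec p) (i : Fin n) : 0 < ((stratum z (z i)).card : ℝ) := by
  exact_mod_cast Finset.card_pos.2 ⟨i, mem_stratum.2 rfl⟩

theorem one_le_card_stratum (z : Fin n → Vec p) (i : Fin n) : 1 ≤ ((stratum z (z i)).card : ℝ) := by
  exact_mod_cast Finset.card_pos.2 ⟨i, mem_stratum.2 rfl⟩

/-- The mean of `f` over the stratum of the unit `i`. -/
noncomputable def sMean (z : Fin n → Vec p) (f : Fin n → ℝ) (i : Fin n) : ℝ :=
  ((stratum z (z i)).card : ℝ)⁻¹ * ∑ j ∈ stratum z (z i), f j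

theorem sMean_eq_of_eq {z : Fin n → Vec p} (f : Fin n → ℝ) {i j : Fin n} (h : z i = z j) :
    sMean z f i = sMean z f j := by
  rw [sMean, sMean, h]

theorem sMean_add (z : Fin n → Vec p) (f g : Fin n → ℝ) (i : Fin n) :
    sMean z (fun j => f j + g j) i = sMean z f i + sMean z g i := by
  simp only [sMean, Finset.sum_add_distrib, mul_add]

theorem sMean_sub (z : Fin n → Vec p) (f g : Fin n → ℝ) (i : Fin n) :
    sMean z (fun j => f j - g j) i = sMean z f i - sMean z g i := by
  simp only [sMean, Finset.sum_sub_distrib, mul_sub]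

theorem sMean_mul_const (z : Fin n → Vec p) (f : Fin n → ℝ) (c : ℝ) (i : Fin n) :
    sMean z (fun j => f j * c) i = sMean z f i * c := by
  simp only [sMean, ← Finset.sum_mul, mul_assoc]

theorem sMean_sum {ι : Type*} (s : Finset ι) (z : Fin n → Vec p) (f : ι → Fin n → ℝ) (i : Fin n) :
    sMean z (fun j => ∑ b ∈ s, f b j) i = ∑ b ∈ s, sMean z (f b) i := by
  simp only [sMean, Finset.mul_sum]
  rw [Finset.sum_comm]

theorem sMean_of_stratum_const (z : Fin n → Vec p) (f : Fin n → ℝ) (i : Fin n)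
    (h : ∀ j, z j = z i → f j = f i) : sMean z f i = f i := by
  rw [sMean, Finset.sum_congr rfl fun j hj => h j (mem_stratum.1 hj), Finset.sum_const, nsmul_eq_mul,
    ← mul_assoc, inv_mul_cancel₀ (card_stratum_pos z i).ne', one_mul]

theorem sMean_sMean (z : Fin n → Vec p) (f : Fin n → ℝ) (i : Fin n) :
    sMean z (fun j => sMean z f j) i = sMean z f i :=
  sMean_of_stratum_const z (fun j => sMean z f j) i fun _ hj => sMean_eq_of_eq f hj

open scoped Classical in
/-- As a sum over all units, stratum means are visibly measurable in the strata. -/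
theorem sMean_eq_sum (z : Fin n → Vec p) (f : Fin n → ℝ) (i : Fin n) :
    sMean z f i = ∑ j, if z j = z i then ((stratum z (z i)).card : ℝ)⁻¹ * f j else 0 := by
  rw [sMean, Finset.mul_sum, ← Finset.sum_filter]
  rfl

/-- Taking stratum means is a symmetric operator. -/
theorem sum_sMean_mul (z : Fin n → Vec p) (f g : Fin n → ℝ) :
    ∑ i, sMean z f i * g i = ∑ i, f i * sMean z g i := by
  classical
  simp_rw [sMean_eq_sum, Finset.sum_mul, Finset.mul_sum]
  rw [Finset.sum_comm]
  refine Finset.sum_congr rfl fun j _ => Finset.sum_congr rfl fun i _ => ?_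
  by_cases h : z i = z j
  · rw [if_pos h, if_pos h.symm, h]; ring
  · rw [if_neg h, if_neg (Ne.symm h)]; ring

theorem sum_sMean (z : Fin n → Vec p) (f : Fin n → ℝ) : ∑ i, sMean z f i = ∑ i, f i := by
  have h := sum_sMean_mul z f (fun _ => 1)
  simp only [mul_one] at h
  rw [h]
  refine Finset.sum_congr rfl fun i _ => ?_
  rw [sMean_of_stratum_const z (fun _ => (1:ℝ)) i fun _ _ => rfl, mul_one]

theorem sum_sMean_mul_sMean (z : Fin n → Vec p) (f g : Fin n → ℝ) :
    ∑ i, sMean z f i * sMean z g i = ∑ i, sMean z f i * g i := by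
  rw [← sum_sMean_mul z (fun i => sMean z f i) g]
  simp_rw [sMean_sMean]

/-- The reciprocals of the stratum sizes, summed over all units, count the strata. Errors of stratum means have variance
of the order of these reciprocals, so that the number of strata measures their total size. -/
theorem sum_inv_card_stratum (z : Fin n → Vec p) :
    ∑ i, ((stratum z (z i)).card : ℝ)⁻¹ = (strata z).card := by
  classical
  rw [Finset.card_eq_sum_ones, Nat.cast_sum, strata,
    ← Finset.sum_fiberwise_of_maps_to (s := Finset.univ) (t := Finset.univ.image z) (g := z)
      (fun i _ => Finset.mem_image_of_mem _ (Finset.mem_univ i))]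
  refine Finset.sum_congr rfl fun c hc => ?_
  obtain ⟨i, -, rfl⟩ := Finset.mem_image.1 hc
  rw [Finset.sum_congr rfl (g := fun _ => ((stratum z (z i)).card : ℝ)⁻¹)
    fun j hj => by rw [(Finset.mem_filter.1 hj).2]]
  have : (Finset.univ.filter fun j => z j = z i) = stratum z (z i) := by
    ext j; simp [mem_stratum]
  rw [this, Finset.sum_const, nsmul_eq_mul, mul_inv_cancel₀ (card_stratum_pos z i).ne']
  simp

theorem card_strata_le (z : Fin n → Vec p) : ((strata z).card : ℝ) ≤ n := by
  classical
  have : (strata z).card ≤ n := by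
    simpa [strata] using Finset.card_image_le (s := Finset.univ) (f := z)
  exact_mod_cast this

theorem sMean_pow_le (z : Fin n → Vec p) (f : Fin n → ℝ) (i : Fin n) {m : ℕ} (hm : Even m) :
    sMean z f i ^ m ≤ sMean z (fun j => f j ^ m) i := by
  have h := Real.pow_arith_mean_le_arith_mean_pow_of_even (stratum z (z i))
    (fun _ => ((stratum z (z i)).card : ℝ)⁻¹) f (fun _ _ => by positivity) (by
      rw [Finset.sum_const, nsmul_eq_mul, mul_inv_cancel₀ (card_stratum_pos z i).ne']) hm
  simpa only [sMean, Finset.mul_sum] using h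

theorem sMean_mono (z : Fin n → Vec p) {f g : Fin n → ℝ} (h : ∀ i, f i ≤ g i) (i : Fin n) :
    sMean z f i ≤ sMean z g i :=
  mul_le_mul_of_nonneg_left (Finset.sum_le_sum fun j _ => h j) (by positivity)

theorem sMean_const (z : Fin n → Vec p) (c : ℝ) (i : Fin n) : sMean z (fun _ => c) i = c :=
  sMean_of_stratum_const z (fun _ => c) i fun _ _ => rfl

theorem add_pow_four_le (a b : ℝ) : (a + b) ^ 4 ≤ 8 * (a ^ 4 + b ^ 4) := by
  nlinarith [sq_nonneg (a - b), sq_nonneg (a + b), sq_nonneg (a ^ 2 - b ^ 2), mul_nonneg (sq_nonneg (a - b)) (sq_nonneg (a + b)), sq_nonneg ((a-b)^2), sq_nonneg (a*(a-b)), sq_nonneg (b*(a-b)), sq_nonneg (a*b)]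

theorem sub_pow_four_le (a b : ℝ) : (a - b) ^ 4 ≤ 8 * (a ^ 4 + b ^ 4) := by
  have := add_pow_four_le a (-b)
  rwa [← sub_eq_add_neg, (by norm_num : Even 4).neg_pow] at this

theorem sum_demean_pow_four_le (z : Fin n → Vec p) (f : Fin n → ℝ) :
    ∑ i, (f i - sMean z f i) ^ 4 ≤ 16 * ∑ i, f i ^ 4 := by
  have : ∀ i, (f i - sMean z f i) ^ 4 ≤ 8 * (f i ^ 4 + sMean z (fun j => f j ^ 4) i) := fun i =>
    (sub_pow_four_le _ _).trans (by gcongr; exact sMean_pow_le z f i (by norm_num))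
  refine (Finset.sum_le_sum fun i _ => this i).trans (le_of_eq ?_)
  rw [← Finset.mul_sum, Finset.sum_add_distrib, sum_sMean]
  ring

theorem demean_mulVec (z : Fin n → Vec p) (v : Fin n → ℝ) (i : Fin n) :
    (demean z *ᵥ v) i = v i - sMean z v i := by
  classical
  rw [demean, Matrix.sub_mulVec, Matrix.one_mulVec, Pi.sub_apply, sMean_eq_sum]
  congr 1
  simp only [Matrix.mulVec, dotProduct, Matrix.of_apply, ite_mul, zero_mul]

theorem Xtilde_apply (x : Fin n → Vec k) (z : Fin n → Vec p) (i : Fin n) (a : Fin k) :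
    Xtilde x z i a = x i a - sMean z (fun j => x j a) i := by
  refine Eq.trans ?_ (demean_mulVec z (fun j => x j a) i)
  simp [Xtilde, Matrix.mul_apply, Matrix.mulVec, dotProduct]

theorem sum_Xtilde_mul_sMean (x : Fin n → Vec k) (z : Fin n → Vec p) (a : Fin k) (g : Fin n → ℝ) :
    ∑ i, Xtilde x z i a * sMean z g i = 0 := by
  simp_rw [Xtilde_apply, sub_mul, Finset.sum_sub_distrib, sum_sMean_mul_sMean]
  rw [sum_sMean_mul, sub_self]

/-- Since demeaning is an orthogonal projection, `X̃' v` depends on the demeaned `v` only. -/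
theorem transpose_Xtilde_mulVec (x : Fin n → Vec k) (z : Fin n → Vec p) (v : Fin n → ℝ) (a : Fin k) :
    ((Xtilde x z)ᵀ *ᵥ v) a = ∑ i, Xtilde x z i a * (demean z *ᵥ v) i := by
  simp_rw [demean_mulVec, mul_sub, Finset.sum_sub_distrib, sum_Xtilde_mul_sMean, sub_zero]
  simp [Matrix.mulVec, dotProduct]

theorem middle_apply (x : Fin n → Vec k) (z : Fin n → Vec p) (v : Fin n → ℝ) (a b : Fin k) :
    ((Xtilde x z)ᵀ * sigmaMat z v * Xtilde x z) a b =
      ∑ i, (Xtilde x z i a * (demean z *ᵥ v) i) * (Xtilde x z i b * (demean z *ᵥ v) i) := by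
  rw [Matrix.mul_apply]
  refine Finset.sum_congr rfl fun i _ => ?_
  rw [sigmaMat, Matrix.mul_diagonal, Matrix.transpose_apply]
  ring

/-- Demeaning removes `γ`, because `Z_i` is constant on the strata. -/
theorem demean_model (x : Fin n → Vec k) (z : Fin n → Vec p) (u : Fin n → ℝ) (δ : Vec k) (γ : Vec p)
    (i : Fin n) :
    (demean z *ᵥ fun i => inner ℝ (x i) δ + inner ℝ (z i) γ + u i) i =
      ∑ b, Xtilde x z i b * δ b + (u i - sMean z u i) := by
  rw [demean_mulVec, sMean_add, sMean_add,
    sMean_of_stratum_const z (fun j => inner ℝ (z j) γ) i fun j hj => by rw [hj]]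
  have h1 : ∀ j, inner ℝ (x j) δ = ∑ b, x j b * δ b := fun j => by
    simp [PiLp.inner_apply, mul_comm]
  simp_rw [h1, sMean_sum, sMean_mul_const, Xtilde_apply, sub_mul, Finset.sum_sub_distrib]
  ring

/-- The score at the true coefficients is the leading sum of `(X_i - m_i) u_i` minus a sum of products of errors of
stratum means. -/
theorem sum_Xtilde_mul_demean (x : Fin n → Vec k) (z : Fin n → Vec p) (u m : Fin n → ℝ) (a : Fin k) :
    ∑ i, Xtilde x z i a * (u i - sMean z u i) =
      ∑ i, (x i a - sMean z m i) * u i -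
        ∑ i, sMean z (fun j => x j a - m j) i * sMean z u i := by
  simp_rw [sum_sMean_mul_sMean, mul_sub, Finset.sum_sub_distrib, sum_Xtilde_mul_sMean, sub_zero,
    ← Finset.sum_sub_distrib, sMean_sub, Xtilde_apply]
  refine Finset.sum_congr rfl fun i _ => by ring

end strata

/-! ### Symmetric matrices and their functional calculus -/

section matrices
variable {k : ℕ}

theorem continuousOn_spectrum (f : ℝ → ℝ) (A : Matrix (Fin k) (Fin k) ℝ) :
    ContinuousOn f (spectrum ℝ A) := (Matrix.finite_real_spectrum (A := A)).continuousOn f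

theorem isHermitian_cfc (f : ℝ → ℝ) (A : Matrix (Fin k) (Fin k) ℝ) : (cfc f A).IsHermitian :=
  cfc_predicate f A

theorem mul_symmInv_mul {A : Matrix (Fin k) (Fin k) ℝ} (hA : A.IsHermitian) :
    A * symmInv A * A = A := by
  have hA' : IsSelfAdjoint A := hA
  rw [symmInv]
  nth_rewrite 1 [← cfc_id ℝ A]
  nth_rewrite 3 [← cfc_id ℝ A]
  rw [← cfc_mul _ _ A (continuousOn_spectrum _ _) (continuousOn_spectrum _ _),
    ← cfc_mul _ _ A (continuousOn_spectrum _ _) (continuousOn_spectrum _ _)]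
  conv_rhs => rw [← cfc_id ℝ A]
  refine cfc_congr fun t _ => ?_
  by_cases ht : t = 0 <;> simp [ht]

theorem symmInv_mul_symmInv {A : Matrix (Fin k) (Fin k) ℝ} (hA : A.IsHermitian) :
    symmInv A * A * symmInv A = symmInv A := by
  have hA' : IsSelfAdjoint A := hA
  rw [symmInv]
  nth_rewrite 2 [← cfc_id ℝ A]
  rw [← cfc_mul _ _ A (continuousOn_spectrum _ _) (continuousOn_spectrum _ _),
    ← cfc_mul _ _ A (continuousOn_spectrum _ _) (continuousOn_spectrum _ _)]
  refine cfc_congr fun t _ => ?_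
  by_cases ht : t = 0 <;> simp [ht]

theorem symmInv_smul {A : Matrix (Fin k) (Fin k) ℝ} (hA : A.IsHermitian) (c : ℝ) :
    symmInv (c • A) = c⁻¹ • symmInv A := by
  have hA' : IsSelfAdjoint A := hA
  rw [symmInv, symmInv, ← cfc_comp_smul c (fun t : ℝ => t⁻¹) A ((Set.Finite.image _ (Matrix.finite_real_spectrum (A := A))).continuousOn _),
    ← cfc_smul c⁻¹ (fun t : ℝ => t⁻¹) A (continuousOn_spectrum _ _)]
  refine cfc_congr fun t _ => ?_
  simp [mul_comm]

theorem le_of_lt_lambdaMin {A : Matrix (Fin k) (Fin k) ℝ} (hA : A.IsHermitian) {lam : ℝ}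
    (h : lam < lambdaMin A) (x : Fin k → ℝ) : lam * (x ⬝ᵥ x) ≤ x ⬝ᵥ (A *ᵥ x) := by
  have hB : (A - lam • (1 : Matrix (Fin k) (Fin k) ℝ)).IsHermitian := by
    refine hA.sub ?_
    ext i j
    simp [Matrix.one_apply, eq_comm]
  have hpsd : (A - lam • (1 : Matrix (Fin k) (Fin k) ℝ)).PosSemidef := by
    rw [hB.posSemidef_iff_eigenvalues_nonneg]
    intro i
    have hi : hB.eigenvalues i ∈ spectrum ℝ (A - lam • (1 : Matrix (Fin k) (Fin k) ℝ)) :=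
      hB.spectrum_real_eq_range_eigenvalues ▸ ⟨i, rfl⟩
    have h2 : hB.eigenvalues i + lam ∈ spectrum ℝ A := by
      rw [spectrum.mem_iff] at hi ⊢
      rw [Algebra.algebraMap_eq_smul_one] at hi ⊢
      rw [add_smul]
      rwa [sub_sub_eq_add_sub] at hi
    have h3 : lambdaMin A ≤ hB.eigenvalues i + lam :=
      csInf_le (Matrix.finite_real_spectrum (A := A)).bddBelow h2
    simp only [Pi.zero_apply]
    linarith
  have := hpsd.dotProduct_mulVec_nonneg x
  simp only [star_trivial, Matrix.sub_mulVec, Matrix.smul_mulVec, Matrix.one_mulVec, dotProduct_sub,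
    dotProduct_smul, smul_eq_mul] at this
  linarith

theorem isUnit_det_of_le {A : Matrix (Fin k) (Fin k) ℝ} {lam : ℝ} (hlam : 0 < lam)
    (h : ∀ x : Fin k → ℝ, lam * (x ⬝ᵥ x) ≤ x ⬝ᵥ (A *ᵥ x)) : IsUnit A.det := by
  by_contra hdet
  rw [isUnit_iff_ne_zero, not_not] at hdet
  obtain ⟨v, hv, hAv⟩ := Matrix.exists_mulVec_eq_zero_iff.2 hdet
  have := h v
  rw [hAv, dotProduct_zero] at this
  have h2 : 0 < v ⬝ᵥ v := lt_of_le_of_ne (by simpa using dotProduct_star_self_nonneg v) fun h0 => hv (dotProduct_self_eq_zero.1 h0.symm)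
  nlinarith

theorem dotProduct_mulVec_of_symm {A : Matrix (Fin k) (Fin k) ℝ} (hA : Aᵀ = A) (x y : Fin k → ℝ) :
    x ⬝ᵥ (A *ᵥ y) = (A *ᵥ x) ⬝ᵥ y := by
  rw [Matrix.dotProduct_mulVec, ← Matrix.mulVec_transpose, hA]

theorem dotProduct_self_nonneg' {ι : Type*} [Fintype ι] (x : ι → ℝ) : 0 ≤ x ⬝ᵥ x := by
  simpa using dotProduct_star_self_nonneg x

theorem dotProduct_sq_le {ι : Type*} [Fintype ι] (x y : ι → ℝ) : (x ⬝ᵥ y) ^ 2 ≤ (x ⬝ᵥ x) * (y ⬝ᵥ y) := by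
  have := Finset.sum_mul_sq_le_sq_mul_sq Finset.univ x y
  simpa [dotProduct, sq] using this

theorem mulVec_dotProduct_mulVec_le {ι : Type*} [Fintype ι] (Y : Matrix ι (Fin k) ℝ) (x : Fin k → ℝ) :
    (Y *ᵥ x) ⬝ᵥ (Y *ᵥ x) ≤ (Yᵀ * Y).trace * (x ⬝ᵥ x) := by
  have h : (Yᵀ * Y).trace = ∑ i, (Y i) ⬝ᵥ (Y i) := by
    simp only [Matrix.trace, Matrix.diag, Matrix.mul_apply, Matrix.transpose_apply, dotProduct]
    rw [Finset.sum_comm]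
  rw [h, Finset.sum_mul]
  refine Finset.sum_le_sum fun i _ => ?_
  rw [← sq]
  exact dotProduct_sq_le _ _

/-- For a Gram matrix `V = Yᵀ Y` that may be singular, `s = Yᵀ o` satisfies `|s|² ≤ tr V · s' V⁺ s`: the matrix
`T = Y - Y V⁺ V` satisfies `Tᵀ T = 0`, hence `s` lies in the range of `V`, and the bound is Cauchy–Schwarz for the form
`V`. -/
theorem form_symmInv_gram {ι : Type*} [Fintype ι] (Y : Matrix ι (Fin k) ℝ) (o : ι → ℝ) :
    0 ≤ (Yᵀ *ᵥ o) ⬝ᵥ (symmInv (Yᵀ * Y) *ᵥ (Yᵀ *ᵥ o)) ∧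
    (Yᵀ *ᵥ o) ⬝ᵥ (Yᵀ *ᵥ o) ≤
      (Yᵀ * Y).trace * ((Yᵀ *ᵥ o) ⬝ᵥ (symmInv (Yᵀ * Y) *ᵥ (Yᵀ *ᵥ o))) := by
  have hV : (Yᵀ * Y).IsHermitian := by
    simpa using Matrix.isHermitian_conjTranspose_mul_self Y
  set V := Yᵀ * Y with hVdef
  set R := symmInv V with hR
  have hRt : Rᵀ = R := by
    have := isHermitian_cfc (fun t : ℝ => t⁻¹) V
    simpa [Matrix.IsHermitian, hR, symmInv] using this
  have hVt : Vᵀ = V := by simpa [Matrix.IsHermitian] using hV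
  have h1 : V * R * V = V := mul_symmInv_mul hV
  have h2 : R * V * R = R := symmInv_mul_symmInv hV
  set T := Y - Y * (R * V) with hT
  have hTt : Tᵀ * T = 0 := by
    have e : Tᵀ = Yᵀ - V * R * Yᵀ := by
      rw [hT, Matrix.transpose_sub, Matrix.transpose_mul, Matrix.transpose_mul, hRt, hVt]
    rw [e, hT, Matrix.sub_mul, Matrix.mul_sub, Matrix.mul_sub]
    have e1 : Yᵀ * (Y * (R * V)) = V := by rw [← Matrix.mul_assoc, ← hVdef, ← Matrix.mul_assoc, h1]
    have e2 : V * R * Yᵀ * Y = V := by rw [Matrix.mul_assoc, ← hVdef, h1]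
    have e3 : V * R * Yᵀ * (Y * (R * V)) = V := by
      rw [← Matrix.mul_assoc, e2, ← Matrix.mul_assoc, h1]
    rw [e1, e2, e3, ← hVdef]; simp
  have hT0 : T = 0 := by
    have : Tᴴ * T = 0 := by simpa using hTt
    exact Matrix.conjTranspose_mul_self_eq_zero.1 this
  have hYt : Yᵀ = V * R * Yᵀ := by
    have : Tᵀ = 0 := by rw [hT0]; simp
    rw [hT, Matrix.transpose_sub, Matrix.transpose_mul, Matrix.transpose_mul, hRt, hVt, sub_eq_zero] at this
    exact this
  set s := Yᵀ *ᵥ o with hs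
  set w := R *ᵥ s with hw
  have hsw : V *ᵥ w = s := by
    rw [hw, hs, Matrix.mulVec_mulVec, Matrix.mulVec_mulVec, ← hYt]
  have hform : ∀ x y : Fin k → ℝ, x ⬝ᵥ (V *ᵥ y) = (Y *ᵥ x) ⬝ᵥ (Y *ᵥ y) := fun x y => by
    rw [hVdef, ← Matrix.mulVec_mulVec, Matrix.dotProduct_mulVec, Matrix.vecMul_transpose]
  have hq : s ⬝ᵥ w = (Y *ᵥ w) ⬝ᵥ (Y *ᵥ w) := by
    rw [← hform, hsw, dotProduct_comm]
  have hq0 : 0 ≤ s ⬝ᵥ w := hq ▸ dotProduct_self_nonneg' _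
  refine ⟨hq0, ?_⟩
  have hss : s ⬝ᵥ s = (Y *ᵥ s) ⬝ᵥ (Y *ᵥ w) := by rw [← hform, hsw]
  have htr : 0 ≤ V.trace := by
    rw [hVdef, Matrix.trace]
    exact Finset.sum_nonneg fun a _ => by
      simp only [Matrix.diag, Matrix.mul_apply, Matrix.transpose_apply]
      exact Finset.sum_nonneg fun i _ => mul_self_nonneg _
  have hcs := dotProduct_sq_le (Y *ᵥ s) (Y *ᵥ w)
  rw [← hss, ← hq] at hcs
  have hle := mulVec_dotProduct_mulVec_le Y s
  by_cases h0 : s ⬝ᵥ s = 0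
  · rw [h0]; positivity
  · have hpos : 0 < s ⬝ᵥ s := lt_of_le_of_ne (dotProduct_self_nonneg' _) (Ne.symm h0)
    have h3 : (s ⬝ᵥ s) * (s ⬝ᵥ s) ≤ (s ⬝ᵥ s) * (V.trace * (s ⬝ᵥ w)) := by
      calc (s ⬝ᵥ s) * (s ⬝ᵥ s) = (s ⬝ᵥ s) ^ 2 := by ring
        _ ≤ _ := hcs
        _ ≤ (V.trace * (s ⬝ᵥ s)) * (s ⬝ᵥ w) := by gcongr
        _ = _ := by ring
    exact le_of_mul_le_mul_left h3 hpos

/-- The sum of the absolute values of the entries. -/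
def entrySum (A : Matrix (Fin k) (Fin k) ℝ) : ℝ := ∑ a, ∑ b, |A a b|

theorem abs_le_sqrt_dotProduct_self {ι : Type*} [Fintype ι] (x : ι → ℝ) (a : ι) : |x a| ≤ √(x ⬝ᵥ x) := by
  refine Real.abs_le_sqrt ?_
  rw [dotProduct, sq]
  exact Finset.single_le_sum (f := fun i => x i * x i) (fun i _ => mul_self_nonneg _) (Finset.mem_univ a)

theorem abs_form_le (A : Matrix (Fin k) (Fin k) ℝ) (x y : Fin k → ℝ) :
    |x ⬝ᵥ (A *ᵥ y)| ≤ entrySum A * (√(x ⬝ᵥ x) * √(y ⬝ᵥ y)) := by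
  rw [dotProduct, entrySum, Finset.sum_mul]
  refine (Finset.abs_sum_le_sum_abs _ _).trans (Finset.sum_le_sum fun a _ => ?_)
  rw [Matrix.mulVec, dotProduct, Finset.mul_sum, Finset.sum_mul]
  refine (Finset.abs_sum_le_sum_abs _ _).trans (Finset.sum_le_sum fun b _ => ?_)
  rw [abs_mul, abs_mul]
  have h1 := abs_le_sqrt_dotProduct_self x a
  have h2 := abs_le_sqrt_dotProduct_self y b
  calc |x a| * (|A a b| * |y b|) = |A a b| * (|x a| * |y b|) := by ring
    _ ≤ _ := by gcongr

/-- On matrices bounded below by `lam`, the quadratic form of the inverse is Lipschitz in the matrix. -/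
theorem abs_form_inv_sub_le {A B : Matrix (Fin k) (Fin k) ℝ} (hA : A.IsHermitian) (hB : B.IsHermitian)
    {lam : ℝ} (hlam : 0 < lam)
    (h : ∀ x : Fin k → ℝ, lam * (x ⬝ᵥ x) ≤ x ⬝ᵥ (A *ᵥ x)) (hAB : entrySum (B - A) ≤ lam / 2) (s : Fin k → ℝ) :
    |s ⬝ᵥ (symmInv B *ᵥ s) - s ⬝ᵥ (symmInv A *ᵥ s)| ≤ 2 / lam ^ 2 * entrySum (B - A) * (s ⬝ᵥ s) := by
  have hB' : ∀ x : Fin k → ℝ, lam / 2 * (x ⬝ᵥ x) ≤ x ⬝ᵥ (B *ᵥ x) := fun x => by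
    have h1 := abs_form_le (B - A) x x
    rw [Real.mul_self_sqrt (dotProduct_self_nonneg' x), Matrix.sub_mulVec, dotProduct_sub] at h1
    have h2 := h x
    have h3 := mul_le_mul_of_nonneg_right hAB (dotProduct_self_nonneg' x)
    have := (abs_le.1 h1).1
    linarith
  have hAd := isUnit_det_of_le hlam h
  have hBd := isUnit_det_of_le (half_pos hlam) hB'
  rw [symmInv_eq_inv hA hAd, symmInv_eq_inv hB hBd]
  have bound : ∀ {C : Matrix (Fin k) (Fin k) ℝ} {l : ℝ}, 0 < l → IsUnit C.det →
      (∀ x : Fin k → ℝ, l * (x ⬝ᵥ x) ≤ x ⬝ᵥ (C *ᵥ x)) →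
      √((C⁻¹ *ᵥ s) ⬝ᵥ (C⁻¹ *ᵥ s)) ≤ √(s ⬝ᵥ s) / l := by
    intro C l hl hC hCx
    set w := C⁻¹ *ᵥ s
    have hw : C *ᵥ w = s := by
      rw [Matrix.mulVec_mulVec, Matrix.mul_nonsing_inv _ hC, Matrix.one_mulVec]
    have h1 := hCx w
    rw [hw] at h1
    have h2 : w ⬝ᵥ s ≤ √(w ⬝ᵥ w) * √(s ⬝ᵥ s) := by
      rw [← Real.sqrt_mul (dotProduct_self_nonneg' w)]
      exact Real.le_sqrt_of_sq_le (dotProduct_sq_le w s)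
    rw [le_div_iff₀ hl]
    have h3 : √(w ⬝ᵥ w) * √(w ⬝ᵥ w) = w ⬝ᵥ w := Real.mul_self_sqrt (dotProduct_self_nonneg' w)
    by_cases h0 : √(w ⬝ᵥ w) = 0
    · rw [h0, zero_mul]; positivity
    · have hpos : 0 < √(w ⬝ᵥ w) := lt_of_le_of_ne (Real.sqrt_nonneg _) (Ne.symm h0)
      have : √(w ⬝ᵥ w) * (√(w ⬝ᵥ w) * l) ≤ √(w ⬝ᵥ w) * √(s ⬝ᵥ s) := by
        rw [← mul_assoc, h3]; linarith
      exact le_of_mul_le_mul_left this hpos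
  have bA := bound hlam hAd h
  have bB := bound (half_pos hlam) hBd hB'
  set v := A⁻¹ *ᵥ s
  set w := B⁻¹ *ᵥ s
  have hv : A *ᵥ v = s := by rw [Matrix.mulVec_mulVec, Matrix.mul_nonsing_inv _ hAd, Matrix.one_mulVec]
  have hw : B *ᵥ w = s := by rw [Matrix.mulVec_mulVec, Matrix.mul_nonsing_inv _ hBd, Matrix.one_mulVec]
  -- the resolvent identity `B⁻¹ - A⁻¹ = - A⁻¹ (B - A) B⁻¹`
  have e : s ⬝ᵥ w - s ⬝ᵥ v = - (v ⬝ᵥ ((B - A) *ᵥ w)) := by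
    have hAt : Aᵀ = A := by simpa [Matrix.IsHermitian] using hA
    rw [Matrix.sub_mulVec, hw, dotProduct_sub, dotProduct_comm s v, dotProduct_mulVec_of_symm hAt v w, hv]
    ring
  rw [e, abs_neg]
  refine (abs_form_le _ _ _).trans ?_
  have hn : 0 ≤ entrySum (B - A) := Finset.sum_nonneg fun _ _ => Finset.sum_nonneg fun _ _ => abs_nonneg _
  calc entrySum (B - A) * (√(v ⬝ᵥ v) * √(w ⬝ᵥ w))
      ≤ entrySum (B - A) * (√(s ⬝ᵥ s) / lam * (√(s ⬝ᵥ s) / (lam / 2))) := by gcongr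
    _ = entrySum (B - A) * ((√(s ⬝ᵥ s) * √(s ⬝ᵥ s)) / lam / (lam / 2)) := by ring
    _ = _ := by rw [Real.mul_self_sqrt (dotProduct_self_nonneg' s)]; field_simp

theorem spectrum_pos_of_le {A : Matrix (Fin k) (Fin k) ℝ} (hA : A.IsHermitian) {lam : ℝ} (hlam : 0 < lam)
    (h : ∀ x : Fin k → ℝ, lam * (x ⬝ᵥ x) ≤ x ⬝ᵥ (A *ᵥ x)) {t : ℝ} (ht : t ∈ spectrum ℝ A) : 0 < t := by
  have hpd : A.PosDef := by
    refine Matrix.PosDef.of_dotProduct_mulVec_pos hA fun x hx => ?_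
    have h2 : 0 < x ⬝ᵥ x := lt_of_le_of_ne (dotProduct_self_nonneg' x) fun h0 => hx (dotProduct_self_eq_zero.1 h0.symm)
    simpa using lt_of_lt_of_le (mul_pos hlam h2) (h x)
  rw [hA.spectrum_real_eq_range_eigenvalues] at ht
  obtain ⟨i, rfl⟩ := ht
  exact hpd.eigenvalues_pos i

theorem invSqrt_transpose (A : Matrix (Fin k) (Fin k) ℝ) : (invSqrt A)ᵀ = invSqrt A := by
  have := isHermitian_cfc (fun t : ℝ => (√t)⁻¹) A
  simpa [Matrix.IsHermitian, invSqrt] using this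

theorem invSqrt_mul_invSqrt {A : Matrix (Fin k) (Fin k) ℝ} (hA : A.IsHermitian)
    {lam : ℝ} (hlam : 0 < lam) (h : ∀ x : Fin k → ℝ, lam * (x ⬝ᵥ x) ≤ x ⬝ᵥ (A *ᵥ x)) :
    invSqrt A * invSqrt A = symmInv A := by
  rw [invSqrt, symmInv, ← cfc_mul _ _ A (continuousOn_spectrum _ _) (continuousOn_spectrum _ _)]
  refine cfc_congr fun t ht => ?_
  rw [← mul_inv, Real.mul_self_sqrt (spectrum_pos_of_le hA hlam h ht).le]

theorem invSqrt_mul_mul_invSqrt {A : Matrix (Fin k) (Fin k) ℝ} (hA : A.IsHermitian)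
    {lam : ℝ} (hlam : 0 < lam) (h : ∀ x : Fin k → ℝ, lam * (x ⬝ᵥ x) ≤ x ⬝ᵥ (A *ᵥ x)) :
    invSqrt A * A * invSqrt A = 1 := by
  have hA' : IsSelfAdjoint A := hA
  rw [invSqrt]
  nth_rewrite 2 [← cfc_id ℝ A]
  rw [← cfc_mul _ _ A (continuousOn_spectrum _ _) (continuousOn_spectrum _ _),
    ← cfc_mul _ _ A (continuousOn_spectrum _ _) (continuousOn_spectrum _ _), ← cfc_one ℝ A]
  refine cfc_congr fun t ht => ?_
  have ht := spectrum_pos_of_le hA hlam h ht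
  have h2 := Real.mul_self_sqrt ht.le
  have h3 := (Real.sqrt_pos.2 ht).ne'
  simp only [id, Pi.one_apply]
  field_simp
  rw [sq, h2]

theorem invSqrt_mulVec_self_le {A : Matrix (Fin k) (Fin k) ℝ} (hA : A.IsHermitian)
    {lam : ℝ} (hlam : 0 < lam) (h : ∀ x : Fin k → ℝ, lam * (x ⬝ᵥ x) ≤ x ⬝ᵥ (A *ᵥ x)) (s : Fin k → ℝ) :
    lam * ((invSqrt A *ᵥ s) ⬝ᵥ (invSqrt A *ᵥ s)) ≤ s ⬝ᵥ s := by
  have h1 := h (invSqrt A *ᵥ s)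
  refine h1.trans (le_of_eq ?_)
  rw [← dotProduct_mulVec_of_symm (invSqrt_transpose A), Matrix.mulVec_mulVec,
    Matrix.mulVec_mulVec, invSqrt_mul_mul_invSqrt hA hlam h, Matrix.one_mulVec]

theorem invSqrt_form {A : Matrix (Fin k) (Fin k) ℝ} (hA : A.IsHermitian)
    {lam : ℝ} (hlam : 0 < lam) (h : ∀ x : Fin k → ℝ, lam * (x ⬝ᵥ x) ≤ x ⬝ᵥ (A *ᵥ x)) (s : Fin k → ℝ) :
    (invSqrt A *ᵥ s) ⬝ᵥ (invSqrt A *ᵥ s) = s ⬝ᵥ (symmInv A *ᵥ s) := by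
  rw [← dotProduct_mulVec_of_symm (invSqrt_transpose A), Matrix.mulVec_mulVec,
    invSqrt_mul_invSqrt hA hlam h]

/-- A pointwise limit of continuous functions on the line is a pointwise limit of polynomials. -/
theorem exists_polynomial_tendsto {f : ℝ → ℝ} {g : ℕ → ℝ → ℝ} (hg : ∀ j, Continuous (g j))
    (hgf : ∀ t, Tendsto (fun j => g j t) atTop (𝓝 (f t))) :
    ∃ q : ℕ → Polynomial ℝ, ∀ t, Tendsto (fun j => (q j).eval t) atTop (𝓝 (f t)) := by
  have hq : ∀ j : ℕ, ∃ q : Polynomial ℝ, ∀ t ∈ Set.Icc (-(j:ℝ)) j, |q.eval t - g j t| < 1 / ((j:ℝ) + 1) :=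
    fun j => exists_polynomial_near_of_continuousOn _ _ (g j) (hg j).continuousOn _ (by positivity)
  choose q hq using hq
  refine ⟨q, fun t => ?_⟩
  have h1 : Tendsto (fun j => (q j).eval t - g j t) atTop (𝓝 0) := by
    refine squeeze_zero_norm' ?_ tendsto_one_div_add_atTop_nhds_zero_nat
    filter_upwards [tendsto_natCast_atTop_atTop.eventually_ge_atTop |t|] with j hj
    exact (hq j t (abs_le.1 hj)).le
  simpa using h1.add (hgf t)

theorem tendsto_cfc_apply {A : Matrix (Fin k) (Fin k) ℝ} (hA : A.IsHermitian) {f : ℝ → ℝ} {g : ℕ → ℝ → ℝ}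
    (hgf : ∀ t, Tendsto (fun j => g j t) atTop (𝓝 (f t))) (a b : Fin k) :
    Tendsto (fun j => cfc (g j) A a b) atTop (𝓝 (cfc f A a b)) := by
  have : ∀ F : ℝ → ℝ, cfc F A a b = ∑ i, (hA.eigenvectorUnitary : Matrix (Fin k) (Fin k) ℝ) a i * F (hA.eigenvalues i) *
      (hA.eigenvectorUnitary : Matrix (Fin k) (Fin k) ℝ) b i := fun F => by
    rw [hA.cfc_eq, Matrix.IsHermitian.cfc]
    simp [Matrix.mul_apply, Matrix.diagonal_apply, Unitary.conjStarAlgAut_apply]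
  simp_rw [this]
  exact tendsto_finsetSum _ fun i _ => ((hgf _).const_mul _).mul_const _

/-- The entries of `cfc f A` are measurable in `A` if `f` is a pointwise limit of continuous functions, because
polynomials in `A` have measurable entries. -/
theorem measurable_cfc_apply {α : Type*} [MeasurableSpace α] {A : α → Matrix (Fin k) (Fin k) ℝ}
    (hA : ∀ ω, (A ω).IsHermitian) (hm : ∀ a b, Measurable fun ω => A ω a b) {f : ℝ → ℝ} {g : ℕ → ℝ → ℝ}
    (hg : ∀ j, Continuous (g j)) (hgf : ∀ t, Tendsto (fun j => g j t) atTop (𝓝 (f t))) (a b : Fin k) :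
    Measurable fun ω => cfc f (A ω) a b := by
  obtain ⟨q, hq⟩ := exists_polynomial_tendsto hg hgf
  have hpow : ∀ (j : ℕ) (a b : Fin k), Measurable fun ω => (A ω ^ j) a b := by
    intro j
    induction j with
    | zero => intro a b; simp
    | succ j ih =>
      intro a b
      simp only [pow_succ, Matrix.mul_apply]
      exact Finset.measurable_fun_sum _ fun i _ => (ih a i).mul (hm i b)
  have hpol : ∀ j, Measurable fun ω => cfc (fun t => (q j).eval t) (A ω) a b := by
    intro j
    have : ∀ ω, cfc (fun t => (q j).eval t) (A ω) a b = ∑ i ∈ Finset.range ((q j).natDegree + 1), (q j).coeff i * (A ω ^ i) a b := by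
      intro ω
      have hA' : IsSelfAdjoint (A ω) := hA ω
      rw [cfc_polynomial (q j) (A ω), Polynomial.aeval_eq_sum_range, Matrix.sum_apply]
      exact Finset.sum_congr rfl fun c _ => Matrix.smul_apply _ _ _ _
    simp_rw [this]
    exact Finset.measurable_fun_sum _ fun i _ => (hpow i a b).const_mul _
  exact measurable_of_tendsto_metrizable hpol (tendsto_pi_nhds.2 fun ω => tendsto_cfc_apply (hA ω) hq a b)

/-- The convention `0⁻¹ = 0` is respected by the continuous approximations `t / (t ^ 2 + 1 / (j + 1))` of `t⁻¹`, so that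
singular matrices need no separate treatment. -/
theorem measurable_symmInv_apply {α : Type*} [MeasurableSpace α] {A : α → Matrix (Fin k) (Fin k) ℝ}
    (hA : ∀ ω, (A ω).IsHermitian) (hm : ∀ a b, Measurable fun ω => A ω a b) (a b : Fin k) :
    Measurable fun ω => symmInv (A ω) a b := by
  refine measurable_cfc_apply hA hm (f := fun t : ℝ => t⁻¹)
    (g := fun j t => t / (t ^ 2 + 1 / ((j : ℝ) + 1))) (fun j => ?_) (fun t => ?_) a b
  · refine continuous_id.div (by fun_prop) fun t => ?_
    positivity
  · by_cases ht : t = 0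
    · simp [ht]
    · have h1 : Tendsto (fun j : ℕ => t / (t ^ 2 + 1 / ((j : ℝ) + 1))) atTop (𝓝 (t / (t ^ 2 + 0))) :=
        tendsto_const_nhds.div (tendsto_const_nhds.add tendsto_one_div_add_atTop_nhds_zero_nat) (by simpa using ht)
      convert h1 using 2
      field_simp; simp

theorem measurable_invSqrt_apply {α : Type*} [MeasurableSpace α] {A : α → Matrix (Fin k) (Fin k) ℝ}
    (hA : ∀ ω, (A ω).IsHermitian) (hm : ∀ a b, Measurable fun ω => A ω a b) (a b : Fin k) :
    Measurable fun ω => invSqrt (A ω) a b := by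
  refine measurable_cfc_apply hA hm (f := fun t : ℝ => (√t)⁻¹)
    (g := fun j t => √t / (√t ^ 2 + 1 / ((j : ℝ) + 1))) (fun j => ?_) (fun t => ?_) a b
  · refine Real.continuous_sqrt.div (by fun_prop) fun t => ?_
    positivity
  · by_cases ht : √t = 0
    · simp [ht]
    · have h1 : Tendsto (fun j : ℕ => √t / (√t ^ 2 + 1 / ((j : ℝ) + 1))) atTop (𝓝 (√t / (√t ^ 2 + 0))) :=
        tendsto_const_nhds.div (tendsto_const_nhds.add tendsto_one_div_add_atTop_nhds_zero_nat)
          (by rw [add_zero]; exact pow_ne_zero 2 ht)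
      convert h1 using 2
      field_simp; simp

end matrices

/-! ### Fourth moments of stratum means -/

theorem memLp_four_of_integrable {α : Type*} [MeasurableSpace α] {μ : Measure α} {f : α → ℝ} (hm : Measurable f)
    (h : Integrable (fun x => f x ^ 4) μ) : MemLp f 4 μ := by
  have := (integrable_norm_rpow_iff (μ := μ) (p := 4) hm.aestronglyMeasurable (by norm_num) (by norm_num)).1
  · refine this ?_
    refine h.congr (ae_of_all _ fun x => ?_)
    simp only [ENNReal.toReal_ofNat, Real.norm_eq_abs]
    rw [show (4:ℝ) = ((4:ℕ):ℝ) by norm_num, Real.rpow_natCast, (by decide : Even 4).pow_abs]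

theorem integrable_pow_four {α : Type*} [MeasurableSpace α] {μ : Measure α} {f : α → ℝ} (h : MemLp f 4 μ) :
    Integrable (fun x => f x ^ 4) μ := by
  have := (integrable_norm_rpow_iff (p := 4) h.1 (by norm_num) (by norm_num)).2 h
  refine this.congr (ae_of_all _ fun x => ?_)
  simp only [ENNReal.toReal_ofNat, Real.norm_eq_abs]
  rw [show (4:ℝ) = ((4:ℕ):ℝ) by norm_num, Real.rpow_natCast, (by decide : Even 4).pow_abs]

theorem sq_mul_sq_le (a b : ℝ) {N : ℝ} (hN : 0 < N) : (a * b) ^ 2 ≤ (a ^ 4 / N + N * b ^ 4) / 2 := by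
  have : 0 ≤ (a ^ 2 / N - b ^ 2) ^ 2 * N := by positivity
  have e : (a ^ 2 / N - b ^ 2) ^ 2 * N = a ^ 4 / N + N * b ^ 4 - 2 * (a * b) ^ 2 := by
    field_simp; ring
  linarith

theorem integrable_sq_mul {α : Type*} [MeasurableSpace α] {μ : Measure α} {f g : α → ℝ}
    (hf : MemLp f 4 μ) (hg : MemLp g 4 μ) : Integrable (fun x => (f x * g x) ^ 2) μ := by
  refine (((integrable_pow_four hf).div_const 1).fun_add ((integrable_pow_four hg).const_mul 1) |>.div_const 2).mono'
    ((hf.1.mul hg.1).pow 2) (ae_of_all _ fun x => ?_)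
  rw [Real.norm_of_nonneg (sq_nonneg _)]
  exact sq_mul_sq_le _ _ one_pos

theorem memLp_two_mul {α : Type*} [MeasurableSpace α] {μ : Measure α} {f g : α → ℝ}
    (hf : MemLp f 4 μ) (hg : MemLp g 4 μ) : MemLp (fun x => f x * g x) 2 μ :=
  (memLp_two_iff_integrable_sq (hf.1.mul hg.1)).2 (integrable_sq_mul hf hg)

theorem integral_sq_mul_le {α : Type*} [MeasurableSpace α] {μ : Measure α} {f g : α → ℝ}
    (hf : MemLp f 4 μ) (hg : MemLp g 4 μ) {N A B : ℝ} (hN : 0 < N) (hA : ∫ x, f x ^ 4 ∂μ ≤ A)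
    (hB : ∫ x, g x ^ 4 ∂μ ≤ B) : ∫ x, (f x * g x) ^ 2 ∂μ ≤ (A / N + N * B) / 2 := by
  have i1 := (integrable_pow_four hf).div_const N
  have i2 := (integrable_pow_four hg).const_mul N
  refine (integral_mono (integrable_sq_mul hf hg) ((i1.fun_add i2).div_const 2)
    fun x => sq_mul_sq_le (f x) (g x) hN).trans ?_
  rw [integral_div, integral_add i1 i2, integral_div, integral_const_mul]
  gcongr

section fixed
variable {E : Type*} [MeasurableSpace E] {n p : ℕ} (P : Fin n → Measure E) [∀ i, IsProbabilityMeasure (P i)]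
  (z : Fin n → Vec p)

theorem memLp_sMean {f : Fin n → E → ℝ} {q : ENNReal} (hf : ∀ j, MemLp (f j) q (P j)) (i : Fin n) :
    MemLp (fun w : Fin n → E => sMean z (fun j => f j (w j)) i) q (Measure.pi P) := by
  simp only [sMean]
  exact (memLp_finsetSum _ fun j _ => memLp_pi_eval P j (hf j)).const_mul _

theorem measurable_sMean_eval {f : Fin n → E → ℝ} (hf : ∀ j, Measurable (f j)) (i : Fin n) :
    Measurable (fun w : Fin n → E => sMean z (fun j => f j (w j)) i) := by
  simp only [sMean]
  exact (Finset.measurable_fun_sum _ fun j _ => (hf j).comp (measurable_pi_apply j)).const_mul _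

theorem integral_sMean_pow_four_le {ξ : Fin n → E → ℝ} (hm : ∀ j, Measurable (ξ j)) (hξ : ∀ j, MemLp (ξ j) 4 (P j))
    (h0 : ∀ j, ∫ x, ξ j x ∂(P j) = 0) {M : ℝ} (hM : ∀ j, ∫ x, ξ j x ^ 4 ∂(P j) ≤ M) (i : Fin n) :
    ∫ w, sMean z (fun j => ξ j (w j)) i ^ 4 ∂(Measure.pi P) ≤ 3 * M / ((stratum z (z i)).card : ℝ) ^ 2 := by
  have h := integral_sum_pow_four_le (μ := Measure.pi P) (Y := fun j w => ξ j (w j))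
    (fun j => (hm j).comp (measurable_pi_apply j)) (fun j => memLp_pi_eval P j (hξ j))
    (iIndepFun_pi fun j => (hm j).aemeasurable)
    (fun j => by rw [integral_pi_eval P j (hm j), h0])
    (fun j => by rw [integral_pi_eval P j ((hm j).pow_const 4)]; exact hM j) (stratum z (z i))
  simp only [sMean, mul_pow]
  rw [integral_const_mul]
  have hc := card_stratum_pos z i
  calc _ ≤ ((stratum z (z i)).card : ℝ)⁻¹ ^ 4 * (3 * M * ((stratum z (z i)).card : ℝ) ^ 2) := by gcongr
    _ = _ := by field_simp

theorem integral_sq_mul_sMean_le {α ξ : Fin n → E → ℝ} (hα : ∀ j, MemLp (α j) 4 (P j))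
    (hαm : ∀ j, Measurable (α j))
    (hm : ∀ j, Measurable (ξ j)) (hξ : ∀ j, MemLp (ξ j) 4 (P j))
    (h0 : ∀ j, ∫ x, ξ j x ∂(P j) = 0) {M : ℝ} (hMα : ∀ j, ∫ x, α j x ^ 4 ∂(P j) ≤ M)
    (hM : ∀ j, ∫ x, ξ j x ^ 4 ∂(P j) ≤ M) (i : Fin n) :
    ∫ w, (α i (w i) * sMean z (fun j => ξ j (w j)) i) ^ 2 ∂(Measure.pi P) ≤
      2 * M * ((stratum z (z i)).card : ℝ)⁻¹ := by
  have hc := card_stratum_pos z i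
  refine (integral_sq_mul_le (memLp_pi_eval P i (hα i)) (memLp_sMean P z hξ i) hc
    (A := M) (by rw [integral_pi_eval P i ((hαm i).pow_const 4)]; exact hMα i)
    (integral_sMean_pow_four_le P z hm hξ h0 hM i)).trans (le_of_eq ?_)
  field_simp; ring

theorem integral_sq_sMean_mul_sMean_le {ξ υ : Fin n → E → ℝ}
    (hm : ∀ j, Measurable (ξ j)) (hξ : ∀ j, MemLp (ξ j) 4 (P j))
    (h0 : ∀ j, ∫ x, ξ j x ∂(P j) = 0) {M : ℝ} (hM : ∀ j, ∫ x, ξ j x ^ 4 ∂(P j) ≤ M)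
    (hυm : ∀ j, Measurable (υ j)) (hυ : ∀ j, MemLp (υ j) 4 (P j))
    (hυ0 : ∀ j, ∫ x, υ j x ∂(P j) = 0) (hMυ : ∀ j, ∫ x, υ j x ^ 4 ∂(P j) ≤ M) (i : Fin n) :
    ∫ w, (sMean z (fun j => ξ j (w j)) i * sMean z (fun j => υ j (w j)) i) ^ 2 ∂(Measure.pi P) ≤
      3 * M * ((stratum z (z i)).card : ℝ)⁻¹ := by
  have hc := one_le_card_stratum z i
  have hM0 : 0 ≤ M := (integral_nonneg fun x => by positivity).trans (hM i)
  refine (integral_sq_mul_le (memLp_sMean P z hξ i) (memLp_sMean P z hυ i) one_pos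
    (integral_sMean_pow_four_le P z hm hξ h0 hM i)
    (integral_sMean_pow_four_le P z hυm hυ hυ0 hMυ i)).trans ?_
  have : (3 * M / ((stratum z (z i)).card : ℝ) ^ 2) ≤ 3 * M / ((stratum z (z i)).card : ℝ) := by
    gcongr
    nlinarith
  rw [div_one, one_mul, add_self_div_two]
  exact this

/-- Deleting the contribution of the unit `i` from a sum of products of stratum means. -/
theorem sum_sMean_mul_sMean_update (a b : Fin n → ℝ) (i : Fin n) :
    ∑ l, sMean z a l * sMean z b l - ∑ l, sMean z (Function.update a i 0) l * sMean z (Function.update b i 0) l =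
      a i * sMean z b i + b i * sMean z a i - a i * b i * ((stratum z (z i)).card : ℝ)⁻¹ := by
  have hu : ∀ (f g : Fin n → ℝ), ∑ l, f l * Function.update g i 0 l = ∑ l, f l * g l - f i * g i := by
    intro f g
    rw [← Finset.add_sum_erase _ _ (Finset.mem_univ i), ← Finset.add_sum_erase _ (fun l => f l * g l) (Finset.mem_univ i)]
    rw [Function.update_self, Finset.sum_congr rfl (g := fun l => f l * g l) fun l hl => by
      rw [Function.update_of_ne (Finset.ne_of_mem_erase hl)]]
    ring
  have hs : sMean z (Function.update a i 0) i = sMean z a i - a i * ((stratum z (z i)).card : ℝ)⁻¹ := by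
    have hi : i ∈ stratum z (z i) := mem_stratum.2 rfl
    rw [sMean, sMean, ← Finset.add_sum_erase _ _ hi, ← Finset.add_sum_erase _ a hi, Function.update_self,
      Finset.sum_congr rfl (g := a) fun l hl => by
        rw [Function.update_of_ne (Finset.ne_of_mem_erase hl)]]
    ring
  rw [sum_sMean_mul_sMean, sum_sMean_mul_sMean, hu, hs, sum_sMean_mul z (Function.update a i 0)]
  have h2 : ∑ l, Function.update a i 0 l * sMean z b l = ∑ l, sMean z b l * Function.update a i 0 l :=
    Finset.sum_congr rfl fun _ _ => mul_comm _ _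
  rw [h2, hu, sum_sMean_mul z b a, Finset.sum_congr rfl fun l _ => mul_comm (sMean z a l) (b l)]
  ring

/-- The sum of products of stratum means of two uncorrelated centred variables has mean square of the order of the number
of strata. Its mean vanishes, and the Efron–Stein inequality applies with the contribution of one unit deleted. -/
theorem integral_sq_sum_sMean_mul_sMean_le {ξ υ : Fin n → E → ℝ}
    (hm : ∀ j, Measurable (ξ j)) (hξ : ∀ j, MemLp (ξ j) 4 (P j))
    (h0 : ∀ j, ∫ x, ξ j x ∂(P j) = 0) {M : ℝ} (hM : ∀ j, ∫ x, ξ j x ^ 4 ∂(P j) ≤ M)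
    (hυm : ∀ j, Measurable (υ j)) (hυ : ∀ j, MemLp (υ j) 4 (P j))
    (hυ0 : ∀ j, ∫ x, υ j x ∂(P j) = 0) (hMυ : ∀ j, ∫ x, υ j x ^ 4 ∂(P j) ≤ M)
    (hξυ : ∀ j, ∫ x, ξ j x * υ j x ∂(P j) = 0) :
    ∫ w, (∑ i, sMean z (fun j => ξ j (w j)) i * sMean z (fun j => υ j (w j)) i) ^ 2 ∂(Measure.pi P) ≤
      15 * M * (strata z).card := by
  set f : (Fin n → E) → ℝ := fun w => ∑ i, sMean z (fun j => ξ j (w j)) i * sMean z (fun j => υ j (w j)) i with hf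
  set f' : Fin n → (Fin n → E) → ℝ := fun i w => ∑ l, sMean z (fun j => Function.update ξ i 0 j (w j)) l *
    sMean z (fun j => Function.update υ i 0 j (w j)) l with hf'
  have hupd : ∀ (g : Fin n → E → ℝ) (i : Fin n) (w : Fin n → E),
      (fun j => Function.update g i 0 j (w j)) = Function.update (fun j => g j (w j)) i 0 := by
    intro g i w
    ext j
    by_cases h : j = i
    · subst h; simp
    · simp [Function.update_of_ne h]
  have hum : ∀ (g : Fin n → E → ℝ), (∀ j, Measurable (g j)) → ∀ i j, Measurable (Function.update g i 0 j) := by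
    intro g hg i j
    by_cases h : j = i
    · subst h; rw [Function.update_self]; exact measurable_const
    · rw [Function.update_of_ne h]; exact hg j
  have huL : ∀ (g : Fin n → E → ℝ), (∀ j, MemLp (g j) 4 (P j)) → ∀ i j, MemLp (Function.update g i 0 j) 4 (P j) := by
    intro g hg i j
    by_cases h : j = i
    · subst h; rw [Function.update_self]; exact MemLp.zero
    · rw [Function.update_of_ne h]; exact hg j
  have hM0 : ∀ i : Fin n, 0 ≤ M := fun i => (integral_nonneg fun x => by positivity).trans (hM i)
  -- distinct units are independent, and the two variables of one unit are uncorrelated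
  have hmean : ∫ w, f w ∂(Measure.pi P) = 0 := by
    have e : ∀ w, f w = ∑ i, ∑ j ∈ stratum z (z i), ((stratum z (z i)).card : ℝ)⁻¹ * (ξ j (w j) * υ i (w i)) := by
      intro w
      rw [hf]
      simp only
      rw [sum_sMean_mul_sMean]
      refine Finset.sum_congr rfl fun i _ => ?_
      rw [sMean, ← Finset.mul_sum, mul_assoc, Finset.sum_mul]
    simp_rw [e]
    have hI : ∀ i j, Integrable (fun w : Fin n → E => ξ j (w j) * υ i (w i)) (Measure.pi P) := fun i j =>
      (memLp_two_mul (memLp_pi_eval P j (hξ j)) (memLp_pi_eval P i (hυ i))).integrable (by norm_num)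
    rw [integral_finsetSum _ fun i _ => integrable_finsetSum _ fun j _ => (hI i j).const_mul _]
    refine Finset.sum_eq_zero fun i _ => ?_
    rw [integral_finsetSum _ fun j _ => (hI i j).const_mul _]
    refine Finset.sum_eq_zero fun j _ => ?_
    rw [integral_const_mul]
    by_cases hij : j = i
    · subst hij
      rw [integral_pi_eval P j (G := fun x => ξ j x * υ j x) ((hm j).mul (hυm j)), hξυ, mul_zero]
    · have hind : iIndepFun (fun j (w : Fin n → E) => w j) (Measure.pi P) :=
        iIndepFun_pi (X := fun _ x => x) fun j => aemeasurable_id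
      have h2 : IndepFun (fun w : Fin n → E => ξ j (w j)) (fun w => υ i (w i)) (Measure.pi P) :=
        (hind.indepFun hij).comp (hm j) (hυm i)
      rw [h2.integral_fun_mul_eq_mul_integral ((hm j).comp (measurable_pi_apply j)).aestronglyMeasurable
        ((hυm i).comp (measurable_pi_apply i)).aestronglyMeasurable, integral_pi_eval P j (hm j), h0]
      simp
  have hes := efron_stein P (f := f) (f' := f')
    (Finset.measurable_fun_sum _ fun i _ => (measurable_sMean_eval z hm i).mul (measurable_sMean_eval z hυm i))
    (memLp_finsetSum _ fun i _ => memLp_two_mul (memLp_sMean P z hξ i) (memLp_sMean P z hυ i))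
    (fun i => Finset.measurable_fun_sum _ fun l _ => (measurable_sMean_eval z (hum ξ hm i) l).mul
      (measurable_sMean_eval z (hum υ hυm i) l))
    (fun i => memLp_finsetSum _ fun l _ => memLp_two_mul (memLp_sMean P z (huL ξ hξ i) l)
      (memLp_sMean P z (huL υ hυ i) l)) ?_
  · simp only [hmean, sub_zero] at hes
    refine hes.trans ?_
    rw [← sum_inv_card_stratum z, Finset.mul_sum]
    refine Finset.sum_le_sum fun i _ => ?_
    have hc := one_le_card_stratum z i
    set N := ((stratum z (z i)).card : ℝ) with hN
    have hpt : ∀ w : Fin n → E, (f w - f' i w) ^ 2 ≤ 3 * ((ξ i (w i) * sMean z (fun j => υ j (w j)) i) ^ 2 +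
        (υ i (w i) * sMean z (fun j => ξ j (w j)) i) ^ 2 + (ξ i (w i) * υ i (w i)) ^ 2 * N⁻¹) := by
      intro w
      have := sum_sMean_mul_sMean_update z (fun j => ξ j (w j)) (fun j => υ j (w j)) i
      rw [← hupd, ← hupd] at this
      rw [hf, hf']
      simp only at this ⊢
      rw [this, ← hN]
      have hNi : N⁻¹ ^ 2 ≤ N⁻¹ := by
        have : N⁻¹ ≤ 1 := inv_le_one_of_one_le₀ hc
        have : 0 ≤ N⁻¹ := by positivity
        nlinarith
      have h3 : (ξ i (w i) * υ i (w i) * N⁻¹) ^ 2 ≤ (ξ i (w i) * υ i (w i)) ^ 2 * N⁻¹ := by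
        rw [mul_pow]; gcongr
      nlinarith [sq_nonneg (ξ i (w i) * sMean z (fun j => υ j (w j)) i - υ i (w i) * sMean z (fun j => ξ j (w j)) i),
        sq_nonneg (ξ i (w i) * sMean z (fun j => υ j (w j)) i + ξ i (w i) * υ i (w i) * N⁻¹),
        sq_nonneg (υ i (w i) * sMean z (fun j => ξ j (w j)) i + ξ i (w i) * υ i (w i) * N⁻¹)]
    have i1 := integrable_sq_mul (memLp_pi_eval P i (hξ i)) (memLp_sMean P z hυ i)
    have i2 := integrable_sq_mul (memLp_pi_eval P i (hυ i)) (memLp_sMean P z hξ i)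
    have i3 := (integrable_sq_mul (memLp_pi_eval P i (hξ i)) (memLp_pi_eval P i (hυ i))).mul_const N⁻¹
    have b1 := integral_sq_mul_sMean_le P z hξ hm hυm hυ hυ0 hM hMυ i
    have b2 := integral_sq_mul_sMean_le P z hυ hυm hm hξ h0 hMυ hM i
    have b3 := integral_sq_mul_le (A := M) (B := M) (memLp_pi_eval P i (hξ i)) (memLp_pi_eval P i (hυ i)) one_pos
      (by rw [integral_pi_eval P i ((hm i).pow_const 4)]; exact hM i)
      (by rw [integral_pi_eval P i ((hυm i).pow_const 4)]; exact hMυ i)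
    refine (integral_mono_of_nonneg (ae_of_all _ fun _ => sq_nonneg _) (((i1.fun_add i2).fun_add i3).const_mul 3)
      (ae_of_all _ hpt)).trans ?_
    rw [integral_const_mul, integral_add (i1.fun_add i2) i3, integral_add i1 i2, integral_mul_const]
    rw [← hN] at b1 b2
    have hNp : 0 ≤ N⁻¹ := by positivity
    have b3' := mul_le_mul_of_nonneg_right b3 hNp
    have : (M / 1 + 1 * M) / 2 * N⁻¹ = M * N⁻¹ := by ring
    rw [this] at b3'
    linarith
  · intro i w x
    have : ∀ (g : Fin n → E → ℝ), (fun j => Function.update g i 0 j (Function.update w i x j)) =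
        fun j => Function.update g i 0 j (w j) := by
      intro g
      ext j
      by_cases h : j = i
      · subst h; simp
      · rw [Function.update_of_ne h, Function.update_of_ne h]
    rw [hf']
    simp only [this]

end fixed

/-! ### Moment bounds for one unit, and the score for fixed strata -/

/-- The size `(1 + ‖x‖²) u²`, which dominates the summands of the covariance matrix. -/
noncomputable def envelope {k : ℕ} (e : Vec k × ℝ) : ℝ := (1 + ‖e.1‖ ^ 2) * e.2 ^ 2

/-- The moment conditions on the law `P` of one unit `(x, u)` given its stratum: bounded fourth moments, exogeneity
(`mean_u` and `mean_xu`), and the bound `ρ` on the tail of the envelope, which expresses uniform integrability when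
`ρ` vanishes at infinity. -/
structure UnitBounds {k : ℕ} (P : Measure (Vec k × ℝ)) (M : ℝ) (ρ : ℝ → ℝ) : Prop where
  x4_int : Integrable (fun e => ‖e.1‖ ^ 4) P
  x4_le : ∫ e, ‖e.1‖ ^ 4 ∂P ≤ M
  u4_int : Integrable (fun e => e.2 ^ 4) P
  u4_le : ∫ e, e.2 ^ 4 ∂P ≤ M
  mean_u : ∫ e, e.2 ∂P = 0
  mean_xu : ∀ a, ∫ e, e.1 a * e.2 ∂P = 0
  tail : ∀ K > 0, ∫ e, {e | K < envelope e}.indicator envelope e ∂P ≤ ρ K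

section coords
variable {k : ℕ}

theorem measurable_coord (a : Fin k) : Measurable (fun e : Vec k × ℝ => e.1 a) := by fun_prop

theorem measurable_envelope : Measurable (envelope (k := k)) := by unfold envelope; fun_prop

theorem envelope_nonneg (e : Vec k × ℝ) : 0 ≤ envelope e := by unfold envelope; positivity

theorem sum_sq_coord (x : Vec k) : ∑ a, x a ^ 2 = ‖x‖ ^ 2 := by
  rw [EuclideanSpace.norm_sq_eq]; simp

theorem coord_pow_four_le (x : Vec k) (a : Fin k) : x a ^ 4 ≤ ‖x‖ ^ 4 := by
  have h : x a ^ 2 ≤ ‖x‖ ^ 2 := by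
    rw [← sum_sq_coord]
    exact Finset.single_le_sum (f := fun a => x a ^ 2) (fun i _ => sq_nonneg _) (Finset.mem_univ a)
  nlinarith [sq_nonneg (x a), sq_nonneg ‖x‖]

variable {P : Measure (Vec k × ℝ)} {M : ℝ} {ρ : ℝ → ℝ}

theorem UnitBounds.memLp_coord (h : UnitBounds P M ρ) (a : Fin k) : MemLp (fun e => e.1 a) 4 P := by
  refine memLp_four_of_integrable (measurable_coord a) (h.x4_int.mono' (by fun_prop) (ae_of_all _ fun e => ?_))
  rw [Real.norm_of_nonneg (by positivity)]
  exact coord_pow_four_le e.1 a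

theorem UnitBounds.integral_coord_le (h : UnitBounds P M ρ) (a : Fin k) : ∫ e, e.1 a ^ 4 ∂P ≤ M :=
  (integral_mono (integrable_pow_four (h.memLp_coord a)) h.x4_int fun e => coord_pow_four_le e.1 a).trans h.x4_le

theorem UnitBounds.memLp_u (h : UnitBounds P M ρ) : MemLp (fun e : Vec k × ℝ => e.2) 4 P :=
  memLp_four_of_integrable measurable_snd h.u4_int

theorem UnitBounds.nonneg (h : UnitBounds P M ρ) : 0 ≤ M :=
  (integral_nonneg fun e => by positivity).trans h.u4_le

theorem pow_four_integral_le {α : Type*} [MeasurableSpace α] {μ : Measure α} [IsProbabilityMeasure μ] {f : α → ℝ}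
    (hf : MemLp f 4 μ) : (∫ x, f x ∂μ) ^ 4 ≤ ∫ x, f x ^ 4 ∂μ := by
  have h1 := sq_integral_le μ (hf.mono_exponent (by norm_num : (2:ENNReal) ≤ 4))
  have h3 : MemLp (fun x => f x ^ 2) 2 μ := by
    simpa [sq] using memLp_two_mul hf hf
  have h2 := sq_integral_le μ h3
  simp only [← pow_mul] at h2
  calc (∫ x, f x ∂μ) ^ 4 = ((∫ x, f x ∂μ) ^ 2) ^ 2 := by ring
    _ ≤ (∫ x, f x ^ 2 ∂μ) ^ 2 := by gcongr
    _ ≤ _ := h2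

theorem integral_sub_pow_four_le {α : Type*} [MeasurableSpace α] {μ : Measure α} [IsProbabilityMeasure μ] {f : α → ℝ}
    (hf : MemLp f 4 μ) {M c : ℝ} (h : ∫ x, f x ^ 4 ∂μ ≤ M) (hc : c ^ 4 ≤ M) : ∫ x, (f x - c) ^ 4 ∂μ ≤ 16 * M := by
  have i1 := integrable_pow_four hf
  refine (integral_mono (integrable_pow_four (hf.sub (memLp_const c)))
    ((i1.fun_add (integrable_const (c ^ 4))).const_mul 8) fun x => sub_pow_four_le (f x) c).trans ?_
  rw [integral_const_mul, integral_add i1 (integrable_const _)]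
  simp
  linarith

theorem envelope_le (e : Vec k × ℝ) : envelope e ≤ 1 + ‖e.1‖ ^ 4 + e.2 ^ 4 := by
  unfold envelope
  nlinarith [sq_nonneg (‖e.1‖ ^ 2 - e.2 ^ 2), sq_nonneg (e.2 ^ 2 - 1), sq_nonneg ‖e.1‖, sq_nonneg e.2,
    sq_nonneg (‖e.1‖ ^ 2)]

theorem UnitBounds.integrable_envelope [IsProbabilityMeasure P] (h : UnitBounds P M ρ) : Integrable envelope P := by
  refine (((integrable_const (1:ℝ)).fun_add h.x4_int).fun_add h.u4_int).mono' measurable_envelope.aestronglyMeasurable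
    (ae_of_all _ fun e => ?_)
  rw [Real.norm_of_nonneg (envelope_nonneg e)]
  exact envelope_le e

theorem UnitBounds.integral_envelope_le [IsProbabilityMeasure P] (h : UnitBounds P M ρ) : ∫ e, envelope e ∂P ≤ 1 + 2 * M := by
  have i1 := (integrable_const (μ := P) (1:ℝ)).fun_add h.x4_int
  refine (integral_mono h.integrable_envelope (i1.fun_add h.u4_int) envelope_le).trans ?_
  rw [integral_add i1 h.u4_int, integral_add (integrable_const _) h.x4_int]
  simp
  linarith [h.x4_le, h.u4_le]

/-- The tail bound of an envelope passes to the functions that it dominates. -/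
theorem integral_indicator_le_of_le {α : Type*} [MeasurableSpace α] {μ : Measure α} {f H : α → ℝ} {B t K : ℝ}
    {S : Set α} (hB : 0 ≤ B) (hH : Integrable H μ) (hHm : Measurable H) (hH0 : ∀ x, 0 ≤ H x)
    (hf0 : ∀ x, 0 ≤ f x) (hfH : ∀ x, f x ≤ B * H x) (hS : ∀ x ∈ S, K < H x)
    (ht : ∫ x, {x | K < H x}.indicator H x ∂μ ≤ t) : ∫ x, S.indicator f x ∂μ ≤ B * t := by
  have hi : Integrable (fun x => {x | K < H x}.indicator H x) μ := hH.indicator (measurableSet_lt measurable_const hHm)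
  refine le_trans (integral_mono_of_nonneg (ae_of_all _ fun x => Set.indicator_nonneg (fun _ _ => hf0 _) x)
    (hi.const_mul B) (ae_of_all _ fun x => ?_)) ?_
  · by_cases hx : x ∈ S
    · simp only
      rw [Set.indicator_of_mem hx, Set.indicator_of_mem (by exact hS x hx)]
      exact hfH x
    · simp only
      rw [Set.indicator_of_notMem hx]
      exact mul_nonneg hB (Set.indicator_nonneg (fun _ _ => hH0 _) x)
  · rw [integral_const_mul]; gcongr

end coords

section fixed
variable {k p n : ℕ} (P : Fin n → Measure (Vec k × ℝ)) (z : Fin n → Vec p)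

/-- The mean of the coordinate `a` of the regressors of unit `j`. -/
noncomputable def unitMean (a : Fin k) (j : Fin n) : ℝ := ∫ e, e.1 a ∂(P j)

/-- The coordinate `a` of `x - m_i`, where `m_i` is the average of the means over the stratum of the unit `i`. -/
noncomputable def devn (a : Fin k) (i : Fin n) (e : Vec k × ℝ) : ℝ := e.1 a - sMean z (unitMean P a) i

/-- The matrix `Ω_n` for fixed strata `z` and unit laws `P`. -/
noncomputable def omegaOf : Matrix (Fin k) (Fin k) ℝ :=
  Matrix.of fun a b => (n : ℝ)⁻¹ * ∑ i, ∫ e, devn P z a i e * devn P z b i e * e.2 ^ 2 ∂(P i)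

/-- The error of the stratum mean of the coordinate `a` of the regressors, that is, its difference from `m_i`. -/
noncomputable def meanErr (w : Fin n → Vec k × ℝ) (a : Fin k) (i : Fin n) : ℝ :=
  sMean z (fun j => (w j).1 a - unitMean P a j) i

theorem measurable_devn (a : Fin k) (i : Fin n) : Measurable (devn P z a i) :=
  (measurable_coord a).sub_const _

variable [∀ i, IsProbabilityMeasure (P i)] {M : ℝ} {ρ : ℝ → ℝ} (h : ∀ i, UnitBounds (P i) M ρ)
include h

theorem unitMean_pow_four_le (a : Fin k) (j : Fin n) : unitMean P a j ^ 4 ≤ M :=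
  (pow_four_integral_le ((h j).memLp_coord a)).trans ((h j).integral_coord_le a)

theorem sMean_unitMean_pow_four_le (a : Fin k) (i : Fin n) : sMean z (unitMean P a) i ^ 4 ≤ M :=
  (sMean_pow_le z _ i (by norm_num)).trans
    ((sMean_mono z (fun j => unitMean_pow_four_le P h a j) i).trans (le_of_eq (sMean_const z M i)))

theorem memLp_devn (a : Fin k) (i : Fin n) : MemLp (devn P z a i) 4 (P i) :=
  ((h i).memLp_coord a).sub (memLp_const _)

theorem integral_devn_pow_four_le (a : Fin k) (i : Fin n) : ∫ e, devn P z a i e ^ 4 ∂(P i) ≤ 16 * M :=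
  integral_sub_pow_four_le ((h i).memLp_coord a) ((h i).integral_coord_le a) (sMean_unitMean_pow_four_le P z h a i)

theorem integral_centred_pow_four_le (a : Fin k) (i : Fin n) :
    ∫ e, (e.1 a - unitMean P a i) ^ 4 ∂(P i) ≤ 16 * M :=
  integral_sub_pow_four_le ((h i).memLp_coord a) ((h i).integral_coord_le a) (unitMean_pow_four_le P h a i)

theorem memLp_centred (a : Fin k) (i : Fin n) : MemLp (fun e : Vec k × ℝ => e.1 a - unitMean P a i) 4 (P i) :=
  ((h i).memLp_coord a).sub (memLp_const _)

theorem integral_centred (a : Fin k) (i : Fin n) : ∫ e, (e.1 a - unitMean P a i) ∂(P i) = 0 := by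
  rw [integral_sub (((h i).memLp_coord a).integrable (by norm_num)) (integrable_const _)]
  simp [unitMean]

theorem integral_coord_sub_mul (a : Fin k) (i : Fin n) (c : ℝ) : ∫ e, (e.1 a - c) * e.2 ∂(P i) = 0 := by
  simp_rw [sub_mul]
  rw [integral_sub ((memLp_two_mul ((h i).memLp_coord a) (h i).memLp_u).integrable (by norm_num))
    (((h i).memLp_u.integrable (by norm_num)).const_mul _), (h i).mean_xu, integral_const_mul, (h i).mean_u]
  simp

omit [∀ i, IsProbabilityMeasure (P i)] in
theorem integral_u_pow_four_le (i : Fin n) : ∫ e, e.2 ^ 4 ∂(P i) ≤ 16 * M := by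
  linarith [(h i).u4_le, (h i).nonneg]

theorem integral_sq_sum_meanErr_mul_le (a : Fin k) :
    ∫ w, (∑ i, meanErr P z w a i * sMean z (fun j => (w j).2) i) ^ 2 ∂(Measure.pi P) ≤
      240 * M * (strata z).card := by
  have := integral_sq_sum_sMean_mul_sMean_le P z (ξ := fun j e => e.1 a - unitMean P a j) (υ := fun _ e => e.2)
    (fun j => (measurable_coord a).sub_const _) (memLp_centred P h a) (integral_centred P h a)
    (integral_centred_pow_four_le P h a) (fun _ => measurable_snd) (fun j => (h j).memLp_u)
    (fun j => (h j).mean_u) (integral_u_pow_four_le P h) (fun j => integral_coord_sub_mul P h a j _)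
  refine this.trans (le_of_eq (by ring))

theorem integral_sum_sq_devn_mul_le (a : Fin k) :
    ∫ w, ∑ i, (devn P z a i (w i) * sMean z (fun j => (w j).2) i) ^ 2 ∂(Measure.pi P) ≤
      48 * M * (strata z).card := by
  rw [integral_finsetSum _ fun i _ => integrable_sq_mul (memLp_pi_eval P i (memLp_devn P z h a i))
    (memLp_sMean P z (f := fun _ e => e.2) (fun j => (h j).memLp_u) i), ← sum_inv_card_stratum z, Finset.mul_sum]
  refine Finset.sum_le_sum fun i _ => (integral_sq_mul_sMean_le P z (fun j => memLp_devn P z h a j)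
    (fun j => measurable_devn P z a j) (fun _ => measurable_snd) (fun j => (h j).memLp_u)
    (fun j => (h j).mean_u) (integral_devn_pow_four_le P z h a) (integral_u_pow_four_le P h) i).trans ?_
  have := (h i).nonneg
  gcongr ?_ * _
  linarith

theorem integral_sum_sq_u_mul_meanErr_le (a : Fin k) :
    ∫ w, ∑ i, ((w i).2 * meanErr P z w a i) ^ 2 ∂(Measure.pi P) ≤ 48 * M * (strata z).card := by
  simp only [meanErr]
  rw [integral_finsetSum _ fun i _ => integrable_sq_mul (memLp_pi_eval P i (h i).memLp_u)
    (memLp_sMean P z (memLp_centred P h a) i), ← sum_inv_card_stratum z, Finset.mul_sum]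
  refine Finset.sum_le_sum fun i _ => (integral_sq_mul_sMean_le P z (fun j => (h j).memLp_u)
    (fun j => measurable_snd) (fun j => (measurable_coord a).sub_const _) (memLp_centred P h a)
    (integral_centred P h a) (integral_u_pow_four_le P h) (integral_centred_pow_four_le P h a) i).trans ?_
  have := (h i).nonneg
  gcongr ?_ * _
  linarith

theorem integral_sum_sq_meanErr_mul_le (a : Fin k) :
    ∫ w, ∑ i, (meanErr P z w a i * sMean z (fun j => (w j).2) i) ^ 2 ∂(Measure.pi P) ≤ 48 * M * (strata z).card := by
  simp only [meanErr]
  rw [integral_finsetSum _ fun i _ => integrable_sq_mul (memLp_sMean P z (memLp_centred P h a) i)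
    (memLp_sMean P z (f := fun _ e => e.2) (fun j => (h j).memLp_u) i), ← sum_inv_card_stratum z, Finset.mul_sum]
  refine Finset.sum_le_sum fun i _ => (integral_sq_sMean_mul_sMean_le P z
    (fun j => (measurable_coord a).sub_const _) (memLp_centred P h a)
    (integral_centred P h a) (integral_centred_pow_four_le P h a)
    (fun _ => measurable_snd) (fun j => (h j).memLp_u) (fun j => (h j).mean_u) (integral_u_pow_four_le P h) i).trans
      (le_of_eq (by ring))

theorem sum_sq_devn_le (i : Fin n) (e : Vec k × ℝ) :
    ∑ a, devn P z a i e ^ 2 ≤ (2 + 2 * k * (1 + M)) * (1 + ‖e.1‖ ^ 2) := by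
  have hM := (h i).nonneg
  have h1 : ∀ a, devn P z a i e ^ 2 ≤ 2 * e.1 a ^ 2 + 2 * (1 + M) := fun a => by
    have h4 := sMean_unitMean_pow_four_le P z h a i
    unfold devn
    set m := sMean z (unitMean P a) i
    have : m ^ 2 ≤ 1 + M := by nlinarith [sq_nonneg (m ^ 2 - 1), sq_nonneg m]
    nlinarith [sq_nonneg (e.1 a + m)]
  refine (Finset.sum_le_sum fun a _ => h1 a).trans ?_
  rw [Finset.sum_add_distrib, ← Finset.mul_sum, sum_sq_coord]
  simp only [Finset.sum_const, Finset.card_univ, Fintype.card_fin, nsmul_eq_mul]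
  have h3 : 0 ≤ ‖e.1‖ ^ 2 * (2 * k * (1 + M)) := by positivity
  nlinarith

theorem abs_devn_mul_devn_mul_le (a b : Fin k) (i : Fin n) (e : Vec k × ℝ) :
    |devn P z a i e * devn P z b i e * e.2 ^ 2| ≤ (2 + 2 * k * (1 + M)) * envelope e := by
  have h1 := sum_sq_devn_le P z h i e
  have ha := Finset.single_le_sum (f := fun a => devn P z a i e ^ 2) (fun i _ => sq_nonneg _) (Finset.mem_univ a)
  have hb := Finset.single_le_sum (f := fun a => devn P z a i e ^ 2) (fun i _ => sq_nonneg _) (Finset.mem_univ b)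
  have h2 : |devn P z a i e * devn P z b i e| ≤ (2 + 2 * k * (1 + M)) * (1 + ‖e.1‖ ^ 2) := by
    rw [abs_le]
    constructor <;>
    nlinarith [sq_nonneg (devn P z a i e - devn P z b i e), sq_nonneg (devn P z a i e + devn P z b i e)]
  rw [abs_mul, abs_of_nonneg (sq_nonneg e.2), envelope, ← mul_assoc]
  gcongr

theorem integrable_devn_mul_devn_mul (a b : Fin k) (i : Fin n) :
    Integrable (fun e => devn P z a i e * devn P z b i e * e.2 ^ 2) (P i) := by
  refine ((h i).integrable_envelope.const_mul _).mono' ?_ (ae_of_all _ fun e => abs_devn_mul_devn_mul_le P z h a b i e)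
  exact (((measurable_devn P z a i).mul (measurable_devn P z b i)).mul (measurable_snd.pow_const 2)).aestronglyMeasurable

/-- The law of large numbers for the variance of the leading score. -/
theorem integral_abs_sum_devn_sub_le (a b : Fin k) {K : ℝ} (hK : 0 < K) :
    ∫ w, |∑ i, devn P z a i (w i) * devn P z b i (w i) * (w i).2 ^ 2 - n * omegaOf P z a b| ∂(Measure.pi P) ≤
      √n * ((2 + 2 * k * (1 + M)) * K) + n * (2 * ((2 + 2 * k * (1 + M)) * ρ K)) := by
  rcases Nat.eq_zero_or_pos n with hn | hn
  · subst hn; simp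
  have hM := (h ⟨0, hn⟩).nonneg
  have hw := integral_abs_sum_sub_le P (g := fun i e => devn P z a i e * devn P z b i e * e.2 ^ 2)
    (fun i => ((measurable_devn P z a i).mul (measurable_devn P z b i)).mul (measurable_snd.pow_const 2))
    (integrable_devn_mul_devn_mul P z h a b) (K := (2 + 2 * k * (1 + M)) * K)
    (τ := (2 + 2 * k * (1 + M)) * ρ K) (by positivity) (fun i => ?_)
  · refine le_trans (le_of_eq ?_) hw
    congr 1; ext w
    rw [Finset.sum_sub_distrib]
    congr 2
    simp only [omegaOf, Matrix.of_apply]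
    rw [mul_inv_cancel_left₀ (by exact_mod_cast hn.ne')]
  · refine integral_indicator_le_of_le (f := fun e => |devn P z a i e * devn P z b i e * e.2 ^ 2|) (K := K) (by positivity) (h i).integrable_envelope measurable_envelope
      envelope_nonneg (fun _ => abs_nonneg _) (fun e => abs_devn_mul_devn_mul_le P z h a b i e) (fun e he => ?_)
      ((h i).tail K hK)
    have h1 := lt_of_lt_of_le he (abs_devn_mul_devn_mul_le P z h a b i e)
    exact lt_of_mul_lt_mul_left h1 (by positivity)

theorem integral_sq_sum_devn_mul_le (a : Fin k) :
    ∫ w, (∑ i, devn P z a i (w i) * (w i).2) ^ 2 ∂(Measure.pi P) ≤ 16 * M * n := by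
  have hw := integral_sq_sum_sub_le P (g := fun i e => devn P z a i e * e.2)
    (fun i => (measurable_devn P z a i).mul measurable_snd)
    (fun i => memLp_two_mul (memLp_devn P z h a i) (h i).memLp_u)
  have h0 : ∀ i, ∫ e, devn P z a i e * e.2 ∂(P i) = 0 := fun i => integral_coord_sub_mul P h a i _
  simp only [h0, sub_zero] at hw
  refine hw.trans ?_
  have : ∀ i, ∫ e, (devn P z a i e * e.2) ^ 2 ∂(P i) ≤ 16 * M := fun i =>
    (integral_sq_mul_le (memLp_devn P z h a i) (h i).memLp_u one_pos (integral_devn_pow_four_le P z h a i)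
      (integral_u_pow_four_le P h i)).trans (le_of_eq (by ring))
  refine (Finset.sum_le_sum fun i _ => this i).trans (le_of_eq ?_)
  simp; ring

/-- The leading score for fixed strata is asymptotically Gaussian in the direction `θ`, with bounds that depend on the
strata only through the quadratic form of `Ω_n`. -/
theorem norm_charFun_score_sub_le (hn : 0 < n) (θ : Fin k → ℝ) {η B : ℝ} (hη : 0 < η) (hη1 : η ≤ 1)
    (hB : 0 < B) (hθ : (2 + 2 * k * (1 + M)) * (θ ⬝ᵥ θ) ≤ B) :
    ‖∫ w, Complex.exp (((√n)⁻¹ * ∑ i, (∑ a, θ a * devn P z a i (w i)) * (w i).2 : ℝ) * Complex.I) ∂(Measure.pi P) -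
      Complex.exp (-((θ ⬝ᵥ (omegaOf P z *ᵥ θ)) / 2 : ℝ))‖ ≤
      η * (θ ⬝ᵥ (omegaOf P z *ᵥ θ)) + 4 * (B * ρ (n * η ^ 2 / B)) + B / n * (1 + 2 * M) * (θ ⬝ᵥ (omegaOf P z *ᵥ θ)) := by
  have hn' : (0 : ℝ) < n := by exact_mod_cast hn
  have hM := (h ⟨0, hn⟩).nonneg
  set ζ : Fin n → Vec k × ℝ → ℝ := fun i e => (√n)⁻¹ * ((∑ a, θ a * devn P z a i e) * e.2) with hζ
  have hζm : ∀ i, Measurable (ζ i) := fun i =>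
    ((Finset.measurable_fun_sum _ fun a _ => (measurable_devn P z a i).const_mul _).mul measurable_snd).const_mul _
  have hζL : ∀ i, MemLp (ζ i) 2 (P i) := fun i =>
    (memLp_two_mul (memLp_finsetSum _ fun a _ => (memLp_devn P z h a i).const_mul _) (h i).memLp_u).const_mul _
  have hsqn : (√(n:ℝ))⁻¹ ^ 2 = (n : ℝ)⁻¹ := by rw [inv_pow, Real.sq_sqrt hn'.le]
  -- the envelope turns truncation of the summands at `η` into truncation of the envelope at `n η ^ 2 / B`
  have hζ2 : ∀ i e, ζ i e ^ 2 ≤ B / n * envelope e := by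
    intro i e
    have h1 : (∑ a, θ a * devn P z a i e) ^ 2 ≤ (θ ⬝ᵥ θ) * ∑ a, devn P z a i e ^ 2 := by
      have := dotProduct_sq_le θ (fun a => devn P z a i e)
      simpa [dotProduct, sq] using this
    have h2 := sum_sq_devn_le P z h i e
    have h3 : (∑ a, θ a * devn P z a i e) ^ 2 ≤ B * (1 + ‖e.1‖ ^ 2) := by
      refine h1.trans ((mul_le_mul_of_nonneg_left h2 (dotProduct_self_nonneg' θ)).trans ?_)
      rw [← mul_assoc, mul_comm (θ ⬝ᵥ θ)]
      gcongr
    rw [hζ]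
    simp only
    rw [mul_pow, hsqn, mul_pow, envelope]
    calc (n : ℝ)⁻¹ * ((∑ a, θ a * devn P z a i e) ^ 2 * e.2 ^ 2) ≤ (n : ℝ)⁻¹ * ((B * (1 + ‖e.1‖ ^ 2)) * e.2 ^ 2) := by gcongr
      _ = _ := by ring
  have hζ0 : ∀ i, ∫ e, ζ i e ∂(P i) = 0 := fun i => by
    rw [hζ]; simp only
    rw [integral_const_mul]
    simp_rw [Finset.sum_mul, mul_assoc]
    rw [integral_finsetSum _ fun a _ => ((memLp_two_mul (memLp_devn P z h a i) (h i).memLp_u).integrable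
      (by norm_num)).const_mul _]
    simp_rw [integral_const_mul]
    have h0 : ∀ a, ∫ e, devn P z a i e * e.2 ∂(P i) = 0 := fun a => integral_coord_sub_mul P h a i _
    simp [h0]
  have hσ : ∑ i, ∫ e, ζ i e ^ 2 ∂(P i) = θ ⬝ᵥ (omegaOf P z *ᵥ θ) := by
    have e1 : ∀ i e, ζ i e ^ 2 = ∑ a, ∑ b, (n:ℝ)⁻¹ * (θ a * θ b) * (devn P z a i e * devn P z b i e * e.2 ^ 2) := by
      intro i e
      rw [hζ]; simp only
      rw [mul_pow, hsqn, mul_pow, sq (∑ a, θ a * devn P z a i e), Finset.sum_mul_sum, Finset.sum_mul, Finset.mul_sum]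
      refine Finset.sum_congr rfl fun a _ => ?_
      rw [Finset.sum_mul, Finset.mul_sum]
      exact Finset.sum_congr rfl fun b _ => by ring
    have e2 : ∀ i, ∫ e, ζ i e ^ 2 ∂(P i) = ∑ a, ∑ b, (n:ℝ)⁻¹ * (θ a * θ b) *
        ∫ e, devn P z a i e * devn P z b i e * e.2 ^ 2 ∂(P i) := by
      intro i
      simp_rw [e1]
      rw [integral_finsetSum _ fun a _ => integrable_finsetSum _ fun b _ =>
        (integrable_devn_mul_devn_mul P z h a b i).const_mul _]
      refine Finset.sum_congr rfl fun a _ => ?_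
      rw [integral_finsetSum _ fun b _ => (integrable_devn_mul_devn_mul P z h a b i).const_mul _]
      simp_rw [integral_const_mul]
    simp_rw [e2]
    rw [Finset.sum_comm]
    simp only [dotProduct, Matrix.mulVec, omegaOf, Matrix.of_apply]
    refine Finset.sum_congr rfl fun a _ => ?_
    rw [Finset.sum_comm, Finset.mul_sum]
    refine Finset.sum_congr rfl fun b _ => ?_
    rw [← Finset.mul_sum]; ring
  have hs : ∀ i, ∫ e, ζ i e ^ 2 ∂(P i) ≤ B / n * (1 + 2 * M) := fun i => by
    refine (integral_mono (hζL i).integrable_sq ((h i).integrable_envelope.const_mul _) fun e => hζ2 i e).trans ?_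
    rw [integral_const_mul]
    gcongr
    exact (h i).integral_envelope_le
  have hτ : ∑ i, ∫ e, {y | η < |ζ i y|}.indicator (fun y => ζ i y ^ 2) e ∂(P i) ≤ B * ρ (n * η ^ 2 / B) := by
    have h1 : ∀ i, ∫ e, {y | η < |ζ i y|}.indicator (fun y => ζ i y ^ 2) e ∂(P i) ≤ B / n * ρ (n * η ^ 2 / B) := fun i => by
      refine integral_indicator_le_of_le (K := n * η ^ 2 / B) (by positivity) (h i).integrable_envelope measurable_envelope
        envelope_nonneg (fun _ => sq_nonneg _) (fun e => hζ2 i e) (fun e he => ?_) ((h i).tail _ (by positivity))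
      have h2 : η ^ 2 < ζ i e ^ 2 := by
        rw [← sq_abs (ζ i e)]
        exact pow_lt_pow_left₀ he hη.le (by norm_num)
      have h3 := lt_of_lt_of_le h2 (hζ2 i e)
      rw [div_lt_iff₀ hB]
      rw [div_mul_eq_mul_div, lt_div_iff₀ hn'] at h3
      linarith
    refine (Finset.sum_le_sum fun i _ => h1 i).trans (le_of_eq ?_)
    simp only [Finset.sum_const, Finset.card_univ, Fintype.card_fin, nsmul_eq_mul]
    field_simp
  have hmain := norm_charFun_sum_sub_le P hζm hζL hζ0 hη hη1 hσ hs hτ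
  have e3 : ∀ w : Fin n → Vec k × ℝ, (√n)⁻¹ * ∑ i, (∑ a, θ a * devn P z a i (w i)) * (w i).2 = ∑ i, ζ i (w i) := by
    intro w; rw [Finset.mul_sum]
  simp_rw [e3]
  exact hmain

theorem memLp_u_eval (i : Fin n) : MemLp (fun w : Fin n → Vec k × ℝ => (w i).2) 4 (Measure.pi P) :=
  memLp_pi_eval P i (h i).memLp_u

theorem memLp_devn_eval (a : Fin k) (i : Fin n) :
    MemLp (fun w : Fin n → Vec k × ℝ => devn P z a i (w i)) 4 (Measure.pi P) :=
  memLp_pi_eval P i (memLp_devn P z h a i)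

theorem memLp_meanErr (a : Fin k) (i : Fin n) :
    MemLp (fun w : Fin n → Vec k × ℝ => meanErr P z w a i) 4 (Measure.pi P) :=
  memLp_sMean P z (memLp_centred P h a) i

theorem memLp_sMean_u (i : Fin n) :
    MemLp (fun w : Fin n → Vec k × ℝ => sMean z (fun j => (w j).2) i) 4 (Measure.pi P) :=
  memLp_sMean P z (f := fun _ e => e.2) (fun j => (h j).memLp_u) i

theorem integrable_sq_sum_meanErr_mul (a : Fin k) : Integrable
    (fun w => (∑ i, meanErr P z w a i * sMean z (fun j => (w j).2) i) ^ 2) (Measure.pi P) :=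
  (memLp_finsetSum _ fun i _ => memLp_two_mul (memLp_meanErr P z h a i) (memLp_sMean_u P z h i)).integrable_sq

theorem integrable_sum_sq_devn_mul (a : Fin k) : Integrable
    (fun w => ∑ i, (devn P z a i (w i) * sMean z (fun j => (w j).2) i) ^ 2) (Measure.pi P) :=
  integrable_finsetSum _ fun i _ => integrable_sq_mul (memLp_devn_eval P z h a i) (memLp_sMean_u P z h i)

theorem integrable_sum_sq_u_mul_meanErr (a : Fin k) : Integrable
    (fun w => ∑ i, ((w i).2 * meanErr P z w a i) ^ 2) (Measure.pi P) :=
  integrable_finsetSum _ fun i _ => integrable_sq_mul (memLp_u_eval P h i) (memLp_meanErr P z h a i)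

theorem integrable_sum_sq_meanErr_mul (a : Fin k) : Integrable
    (fun w => ∑ i, (meanErr P z w a i * sMean z (fun j => (w j).2) i) ^ 2) (Measure.pi P) :=
  integrable_finsetSum _ fun i _ => integrable_sq_mul (memLp_meanErr P z h a i) (memLp_sMean_u P z h i)

theorem integrable_abs_sum_devn_sub (a b : Fin k) (c : ℝ) : Integrable
    (fun w => |∑ i, devn P z a i (w i) * devn P z b i (w i) * (w i).2 ^ 2 - c|) (Measure.pi P) :=
  ((integrable_finsetSum _ fun i _ => integrable_pi_eval P i (integrable_devn_mul_devn_mul P z h a b i)).sub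
    (integrable_const c)).abs

theorem integrable_sq_sum_devn_mul (a : Fin k) : Integrable
    (fun w => (∑ i, devn P z a i (w i) * (w i).2) ^ 2) (Measure.pi P) :=
  (memLp_finsetSum _ fun i _ => memLp_two_mul (memLp_devn_eval P z h a i) (memLp_u_eval P h i)).integrable_sq

end fixed

/-! ### Conditional independence of the units given the strata -/

section kernel
variable {A B : Type*} [MeasurableSpace A] [MeasurableSpace B] {n : ℕ}

/-- The kernel under which, given `z`, the coordinates are independent, coordinate `i` with law `κ i (z i)`. -/
noncomputable def piKernel (κ : Fin n → Kernel A B) [∀ i, IsMarkovKernel (κ i)] : Kernel (Fin n → A) (Fin n → B) where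
  toFun z := Measure.pi fun i => κ i (z i)
  measurable' := by
    refine Measurable.measure_of_isPiSystem_of_isProbabilityMeasure generateFrom_pi.symm isPiSystem_pi ?_
    rintro _ ⟨s, hs, rfl⟩
    simp only [Measure.pi_pi]
    exact Finset.measurable_prod _ fun i _ =>
      ((κ i).measurable_coe (hs i (Set.mem_univ i))).comp (measurable_pi_apply i)

variable (κ : Fin n → Kernel A B) [∀ i, IsMarkovKernel (κ i)]

theorem piKernel_apply (z : Fin n → A) : piKernel κ z = Measure.pi fun i => κ i (z i) := rfl

instance : IsMarkovKernel (piKernel κ) := ⟨fun z => by rw [piKernel_apply]; infer_instance⟩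

/-- Independent pairs, each drawn by a marginal law and a kernel, have independent second coordinates given all the first
ones. -/
theorem map_pi_compProd (ν : Fin n → Measure A) [∀ i, IsProbabilityMeasure (ν i)] :
    (Measure.pi fun i => ν i ⊗ₘ κ i).map (fun w => (fun i => (w i).1, fun i => (w i).2)) =
      Measure.pi ν ⊗ₘ piKernel κ := by
  have hm : Measurable fun w : (Fin n → A) × (Fin n → B) => fun i => (w.1 i, w.2 i) := by fun_prop
  have hm' : Measurable fun w : Fin n → A × B => ((fun i => (w i).1, fun i => (w i).2) : (Fin n → A) × (Fin n → B)) := by fun_prop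
  have key : Measure.pi (fun i => ν i ⊗ₘ κ i) =
      (Measure.pi ν ⊗ₘ piKernel κ).map (fun w => fun i => (w.1 i, w.2 i)) := by
    refine Measure.pi_eq fun s hs => ?_
    rw [Measure.map_apply hm (MeasurableSet.univ_pi hs), Measure.compProd_apply (hm (MeasurableSet.univ_pi hs))]
    have e : ∀ z : Fin n → A, piKernel κ z (Prod.mk z ⁻¹' ((fun w : (Fin n → A) × (Fin n → B) => fun i => (w.1 i, w.2 i)) ⁻¹'
        Set.univ.pi s)) = ∏ i, κ i (z i) (Prod.mk (z i) ⁻¹' s i) := by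
      intro z
      rw [piKernel_apply, ← Measure.pi_pi]
      rfl
    simp_rw [e]
    have hg : ∀ i, Measurable fun a => κ i a (Prod.mk a ⁻¹' s i) := fun i =>
      Kernel.measurable_kernel_prodMk_left (hs i)
    have hind : iIndepFun (fun i (z : Fin n → A) => κ i (z i) (Prod.mk (z i) ⁻¹' s i)) (Measure.pi ν) :=
      iIndepFun_pi (X := fun i a => κ i a (Prod.mk a ⁻¹' s i)) fun i => (hg i).aemeasurable
    rw [lintegral_prod_eq_prod_lintegral_of_indepFun Finset.univ _ hind fun i => (hg i).comp (measurable_pi_apply i)]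
    refine Finset.prod_congr rfl fun i _ => ?_
    rw [Measure.compProd_apply (hs i)]
    exact (measurePreserving_eval ν i).lintegral_comp (hg i)
  rw [key, Measure.map_map hm' hm]
  exact Measure.map_id

end kernel

section model
variable {Ω : Type*} [MeasurableSpace Ω] {μ : Measure Ω} [IsProbabilityMeasure μ] {n k p : ℕ}
  {X : Fin n → Ω → Vec k} {Z : Fin n → Ω → Vec p} {u : Fin n → Ω → ℝ}

variable (μ X Z u) in
/-- The conditional law of `(X_i, u_i)` given `Z_i`. -/
noncomputable def unitKernel (i : Fin n) : Kernel (Vec p) (Vec k × ℝ) :=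
  condDistrib (fun ω => (X i ω, u i ω)) (Z i) μ

instance (i : Fin n) : IsMarkovKernel (unitKernel μ X Z u i) := by unfold unitKernel; infer_instance

variable (hX : ∀ i, Measurable (X i)) (hZ : ∀ i, Measurable (Z i)) (hu : ∀ i, Measurable (u i))
  (hind : iIndepFun (fun i ω => (X i ω, Z i ω, u i ω)) μ)
include hX hZ hu hind

/-- Given `Z_1, …, Z_n`, the pairs `(X_i, u_i)` are independent, and each follows its conditional law given its own
`Z_i`. -/
theorem map_data_eq_compProd :
    μ.map (fun ω => ((fun i => Z i ω, fun i => (X i ω, u i ω)) : (Fin n → Vec p) × (Fin n → Vec k × ℝ))) =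
      μ.map (fun ω i => Z i ω) ⊗ₘ piKernel (unitKernel μ X Z u) := by
  have hWm : ∀ i, Measurable fun ω => (X i ω, u i ω) := fun i => (hX i).prodMk (hu i)
  have h1 : iIndepFun (fun i ω => (Z i ω, (X i ω, u i ω))) μ :=
    hind.comp (fun _ (t : Vec k × Vec p × ℝ) => (t.2.1, (t.1, t.2.2))) fun _ => by fun_prop
  have h2 : iIndepFun (fun i ω => Z i ω) μ :=
    hind.comp (fun _ (t : Vec k × Vec p × ℝ) => t.2.1) fun _ => by fun_prop
  rw [(iIndepFun_iff_map_fun_eq_pi_map fun i => (hZ i).aemeasurable).1 h2]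
  have : ∀ i, IsProbabilityMeasure (μ.map (Z i)) := fun i => Measure.isProbabilityMeasure_map (hZ i).aemeasurable
  rw [← map_pi_compProd]
  have e : (fun i => μ.map (Z i) ⊗ₘ unitKernel μ X Z u i) = fun i => μ.map fun ω => (Z i ω, (X i ω, u i ω)) := by
    funext i
    exact compProd_map_condDistrib (hWm i).aemeasurable
  rw [e, ← (iIndepFun_iff_map_fun_eq_pi_map fun i => ((hZ i).prodMk (hWm i)).aemeasurable).1 h1,
    Measure.map_map (by fun_prop) (measurable_pi_lambda _ fun i => (hZ i).prodMk (hWm i))]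
  rfl

theorem lintegral_data {F : (Fin n → Vec p) × (Fin n → Vec k × ℝ) → ENNReal} (hF : Measurable F) :
    ∫⁻ ω, F (fun i => Z i ω, fun i => (X i ω, u i ω)) ∂μ =
      ∫⁻ ω, ∫⁻ w, F (fun i => Z i ω, w) ∂(Measure.pi fun i => unitKernel μ X Z u i (Z i ω)) ∂μ := by
  have hWm : Measurable fun ω => ((fun i => Z i ω, fun i => (X i ω, u i ω)) : (Fin n → Vec p) × (Fin n → Vec k × ℝ)) :=
    (measurable_pi_lambda _ hZ).prodMk (measurable_pi_lambda _ fun i => (hX i).prodMk (hu i))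
  rw [← lintegral_map hF hWm, map_data_eq_compProd hX hZ hu hind, Measure.lintegral_compProd hF,
    lintegral_map hF.lintegral_kernel_prod_right' (measurable_pi_lambda _ hZ)]
  rfl

theorem integral_data {G : Type*} [NormedAddCommGroup G] [NormedSpace ℝ G]
    {F : (Fin n → Vec p) × (Fin n → Vec k × ℝ) → G} (hF : StronglyMeasurable F)
    (hI : Integrable (fun ω => F (fun i => Z i ω, fun i => (X i ω, u i ω))) μ) :
    ∫ ω, F (fun i => Z i ω, fun i => (X i ω, u i ω)) ∂μ =
      ∫ ω, ∫ w, F (fun i => Z i ω, w) ∂(Measure.pi fun i => unitKernel μ X Z u i (Z i ω)) ∂μ := by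
  have hZm : Measurable fun ω i => Z i ω := measurable_pi_lambda _ hZ
  have hWm : Measurable fun ω => ((fun i => Z i ω, fun i => (X i ω, u i ω)) : (Fin n → Vec p) × (Fin n → Vec k × ℝ)) :=
    hZm.prodMk (measurable_pi_lambda _ fun i => (hX i).prodMk (hu i))
  have hI' : Integrable F (μ.map (fun ω i => Z i ω) ⊗ₘ piKernel (unitKernel μ X Z u)) := by
    rw [← map_data_eq_compProd hX hZ hu hind]
    exact (integrable_map_measure hF.aestronglyMeasurable hWm.aemeasurable).2 hI
  rw [← integral_map hWm.aemeasurable hF.aestronglyMeasurable, map_data_eq_compProd hX hZ hu hind,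
    Measure.integral_compProd hI', integral_map hZm.aemeasurable
      (hF.integral_kernel_prod_right' (κ := piKernel (unitKernel μ X Z u))).aestronglyMeasurable]
  rfl

/-- By independence of the units, conditioning on all `Z_j` amounts to integrating against the conditional law of the unit
`i` given `Z_i`, with the strata held fixed. -/
theorem condExp_sigmaAllZ_ae_eq {f : (Fin n → Vec p) × (Vec k × ℝ) → ℝ} (hf : Measurable f) (i : Fin n)
    (hI : Integrable (fun ω => f (fun j => Z j ω, (X i ω, u i ω))) μ) :
    μ[fun ω => f (fun j => Z j ω, (X i ω, u i ω)) | sigmaAllZ Z] =ᵐ[μ]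
      fun ω => ∫ e, f (fun j => Z j ω, e) ∂(unitKernel μ X Z u i (Z i ω)) := by
  have hZm : Measurable fun ω i => Z i ω := measurable_pi_lambda _ hZ
  have hWm : Measurable fun ω (i : Fin n) => (X i ω, u i ω) := measurable_pi_lambda _ fun i => (hX i).prodMk (hu i)
  have h1 := condExp_prod_ae_eq_integral_condDistrib (μ := μ) hZm hWm.aemeasurable
    (f := fun q : (Fin n → Vec p) × (Fin n → Vec k × ℝ) => f (q.1, q.2 i))
    (hf.comp (by fun_prop)).stronglyMeasurable hI
  have h2 := condDistrib_ae_eq_of_measure_eq_compProd (μ := μ) (fun ω i => Z i ω) hWm.aemeasurable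
    (map_data_eq_compProd hX hZ hu hind)
  refine h1.trans ?_
  filter_upwards [ae_of_ae_map hZm.aemeasurable h2] with ω hω
  rw [hω, piKernel_apply]
  exact integral_pi_eval (fun i => unitKernel μ X Z u i (Z i ω)) i (G := fun e => f (fun j => Z j ω, e))
    (hf.comp (by fun_prop))

end model

/-! ### Uniform bounds for the conditional laws -/

section unit
variable {Ω : Type*} [MeasurableSpace Ω] {μ : Measure Ω} [IsProbabilityMeasure μ] {k p : ℕ}

/-- On `{K < envelope}` the envelope is at most `K ^ (1 - m / 2)` times its power `m / 2`, which the moments of order `2 m`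
dominate. -/
theorem envelope_indicator_le {m : ℝ} (hm : 2 < m) {K : ℝ} (hK : 0 < K) (e : Vec k × ℝ) :
    {e | K < envelope e}.indicator envelope e ≤
      (2 ^ m * (1 + ‖e.1‖ ^ (2 * m)) + |e.2| ^ (2 * m)) * K ^ (1 - m / 2) := by
  have hx : 0 ≤ ‖e.1‖ := norm_nonneg _
  have hR : 0 ≤ (2 ^ m * (1 + ‖e.1‖ ^ (2 * m)) + |e.2| ^ (2 * m)) * K ^ (1 - m / 2) := by positivity
  by_cases he : K < envelope e
  · rw [Set.indicator_of_mem (by exact he)]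
    have hHpos : 0 < envelope e := hK.trans he
    have h1 : envelope e ≤ envelope e ^ (m / 2) * K ^ (1 - m / 2) := by
      have h2 : envelope e ^ (1 - m / 2) ≤ K ^ (1 - m / 2) :=
        Real.rpow_le_rpow_of_nonpos hK he.le (by linarith)
      calc envelope e = envelope e ^ (m / 2) * envelope e ^ (1 - m / 2) := by
            rw [← Real.rpow_add hHpos]; simp
        _ ≤ _ := by gcongr
    refine h1.trans ?_
    gcongr
    have e2 : envelope e ^ (m / 2) = (1 + ‖e.1‖ ^ 2) ^ (m / 2) * |e.2| ^ m := by
      rw [envelope, Real.mul_rpow (by positivity) (by positivity), ← sq_abs e.2, ← Real.rpow_natCast,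
        ← Real.rpow_natCast, ← Real.rpow_mul (abs_nonneg _)]
      congr 2; push_cast; ring
    have e3 : |e.2| ^ (2 * m) = (|e.2| ^ m) ^ 2 := by
      rw [← Real.rpow_natCast, ← Real.rpow_mul (abs_nonneg _)]; congr 1; push_cast; ring
    have e4 : ((1 + ‖e.1‖ ^ 2) ^ (m / 2)) ^ 2 = (1 + ‖e.1‖ ^ 2) ^ m := by
      rw [← Real.rpow_natCast, ← Real.rpow_mul (by positivity)]; congr 1; push_cast; ring
    have e5 : (1 + ‖e.1‖ ^ 2) ^ m ≤ 2 ^ m * (1 + ‖e.1‖ ^ (2 * m)) := by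
      have hp : ‖e.1‖ ^ (2 * m) = (‖e.1‖ ^ 2) ^ m := by
        rw [Real.rpow_mul hx, Real.rpow_two]
      rw [hp]
      have hm0 : 0 ≤ m := by linarith
      rcases le_total 1 (‖e.1‖ ^ 2) with h1 | h1
      · calc (1 + ‖e.1‖ ^ 2) ^ m ≤ (2 * ‖e.1‖ ^ 2) ^ m := by gcongr; linarith
          _ = 2 ^ m * (‖e.1‖ ^ 2) ^ m := Real.mul_rpow (by norm_num) (by positivity)
          _ ≤ _ := by gcongr; linarith
      · calc (1 + ‖e.1‖ ^ 2) ^ m ≤ 2 ^ m := by gcongr; linarith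
          _ = 2 ^ m * 1 := by ring
          _ ≤ _ := by
            gcongr
            have : (0:ℝ) ≤ (‖e.1‖ ^ 2) ^ m := by positivity
            linarith
    rw [e2]
    set A := (1 + ‖e.1‖ ^ 2) ^ (m / 2)
    set B := |e.2| ^ m
    rw [e3]
    nlinarith [sq_nonneg (A - B), sq_nonneg A, sq_nonneg B]
  · rw [Set.indicator_of_notMem (by exact he)]
    exact hR

theorem pow_four_le_one_add_rpow {m : ℝ} (hm : 2 < m) {t : ℝ} (ht : 0 ≤ t) : t ^ 4 ≤ 1 + t ^ (2 * m) := by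
  have h0 : 0 ≤ t ^ (2 * m) := by positivity
  rcases le_total 1 t with h1 | h1
  · have : t ^ (4 : ℝ) ≤ t ^ (2 * m) := Real.rpow_le_rpow_of_exponent_le h1 (by linarith)
    rw [show (4:ℝ) = ((4:ℕ):ℝ) by norm_num, Real.rpow_natCast] at this
    linarith
  · have : t ^ 4 ≤ 1 := pow_le_one₀ ht h1
    linarith

/-- A bound on the tail of the envelope beyond `K` in terms of moments of order `2 m`; it vanishes as `K → ∞` since
`m > 2`. -/
noncomputable def tailBound (m M₀ K : ℝ) : ℝ := (2 ^ m * (1 + M₀) + M₀) * K ^ (1 - m / 2)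

theorem unitBounds_of_moments {P : Measure (Vec k × ℝ)} [IsProbabilityMeasure P] {m M₀ : ℝ} (hm : 2 < m)
    (hx : Integrable (fun e => ‖e.1‖ ^ (2 * m)) P) (hxM : ∫ e, ‖e.1‖ ^ (2 * m) ∂P ≤ M₀)
    (hu : Integrable (fun e => |e.2| ^ (2 * m)) P) (huM : ∫ e, |e.2| ^ (2 * m) ∂P ≤ M₀)
    (h0 : ∫ e, e.2 ∂P = 0) (h1 : ∀ a, ∫ e, e.1 a * e.2 ∂P = 0) :
    UnitBounds P (1 + M₀) (tailBound m M₀) := by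
  have ix4 : Integrable (fun e : Vec k × ℝ => ‖e.1‖ ^ 4) P := by
    refine ((integrable_const (1:ℝ)).fun_add hx).mono' (by fun_prop) (ae_of_all _ fun e => ?_)
    rw [Real.norm_of_nonneg (by positivity)]
    exact pow_four_le_one_add_rpow hm (norm_nonneg _)
  have hu4 : ∀ e : Vec k × ℝ, e.2 ^ 4 ≤ 1 + |e.2| ^ (2 * m) := fun e => by
    rw [← (by decide : Even 4).pow_abs]
    exact pow_four_le_one_add_rpow hm (abs_nonneg _)
  have iu4 : Integrable (fun e : Vec k × ℝ => e.2 ^ 4) P := by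
    refine ((integrable_const (1:ℝ)).fun_add hu).mono' (by fun_prop) (ae_of_all _ fun e => ?_)
    rw [Real.norm_of_nonneg (by positivity)]
    exact hu4 e
  refine ⟨ix4, ?_, iu4, ?_, h0, h1, fun K hK => ?_⟩
  · refine (integral_mono ix4 ((integrable_const (1:ℝ)).fun_add hx)
      fun e => pow_four_le_one_add_rpow hm (norm_nonneg _)).trans ?_
    rw [integral_add (integrable_const _) hx]
    simpa using hxM
  · refine (integral_mono iu4 ((integrable_const (1:ℝ)).fun_add hu) hu4).trans ?_
    rw [integral_add (integrable_const _) hu]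
    simpa using huM
  · have i1 := ((integrable_const (1:ℝ)).fun_add hx).const_mul (2 ^ m)
    refine (integral_mono_of_nonneg (ae_of_all _ fun e => Set.indicator_nonneg (fun e _ => envelope_nonneg e) e)
      ((i1.fun_add hu).mul_const _) (ae_of_all _ fun e => envelope_indicator_le hm hK e)).trans ?_
    rw [integral_mul_const, integral_add i1 hu, integral_const_mul, integral_add (integrable_const _) hx, tailBound]
    simp only [integral_const, probReal_univ, one_smul]
    gcongr

theorem tendsto_tailBound {m M₀ : ℝ} (hm : 2 < m) : Tendsto (tailBound m M₀) atTop (𝓝 0) := by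
  have : Tendsto (fun K : ℝ => K ^ (-(m / 2 - 1))) atTop (𝓝 0) := tendsto_rpow_neg_atTop (by linarith)
  have h2 := this.const_mul (2 ^ m * (1 + M₀) + M₀)
  rw [mul_zero] at h2
  refine h2.congr fun K => ?_
  rw [tailBound]; congr 2; ring

/-- Conditional moment and exogeneity conditions, stated through conditional expectations, are moment conditions on almost
every conditional law. -/
theorem ae_unitBounds {X : Ω → Vec k} {Z : Ω → Vec p} {u : Ω → ℝ} (hX : Measurable X) (hZ : Measurable Z)
    (hu : Measurable u) {m M₀ : ℝ} (hm : 2 < m)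
    (hxi : Integrable (fun ω => ‖X ω‖ ^ (2 * m)) μ) (hui : Integrable (fun ω => |u ω| ^ (2 * m)) μ)
    (hxM : ∀ᵐ ω ∂μ, (μ[fun ω' => ‖X ω'‖ ^ (2 * m) | MeasurableSpace.comap Z inferInstance]) ω < M₀)
    (huM : ∀ᵐ ω ∂μ, (μ[fun ω' => |u ω'| ^ (2 * m) | MeasurableSpace.comap Z inferInstance]) ω < M₀)
    (hex : μ[fun ω => u ω • X ω | MeasurableSpace.comap Z inferInstance] =ᵐ[μ] 0)
    (heu : μ[u | MeasurableSpace.comap Z inferInstance] =ᵐ[μ] 0) :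
    ∀ᵐ ω ∂μ, UnitBounds (condDistrib (fun ω => (X ω, u ω)) Z μ (Z ω)) (1 + M₀) (tailBound m M₀) := by
  have hW : Measurable fun ω => (X ω, u ω) := hX.prodMk hu
  have tr : ∀ f : Vec k × ℝ → ℝ, Measurable f → Integrable (fun ω => f (X ω, u ω)) μ →
      ∀ᵐ ω ∂μ, Integrable f (condDistrib (fun ω => (X ω, u ω)) Z μ (Z ω)) := fun f hf hi => by
    refine Integrable.condDistrib_ae (f := fun q : Vec p × (Vec k × ℝ) => f q.2) hZ.aemeasurable hW.aemeasurable ?_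
    exact (integrable_map_measure (hf.comp measurable_snd).aestronglyMeasurable (hZ.prodMk hW).aemeasurable).2 hi
  have hX4 : Integrable (fun ω => ‖X ω‖ ^ 4) μ := by
    refine ((integrable_const (1:ℝ)).fun_add hxi).mono' (by fun_prop) (ae_of_all _ fun e => ?_)
    rw [Real.norm_of_nonneg (by positivity)]
    exact pow_four_le_one_add_rpow hm (norm_nonneg _)
  have hu4 : Integrable (fun ω => u ω ^ 4) μ := by
    refine ((integrable_const (1:ℝ)).fun_add hui).mono' (by fun_prop) (ae_of_all _ fun e => ?_)
    rw [Real.norm_of_nonneg (by positivity), ← (by decide : Even 4).pow_abs]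
    exact pow_four_le_one_add_rpow hm (abs_nonneg _)
  have hu1 : Integrable u μ := (memLp_four_of_integrable hu hu4).integrable (by norm_num)
  have hux : Integrable (fun ω => u ω • X ω) μ := by
    refine ((hX4.fun_add hu4).fun_add (integrable_const (1:ℝ))).mono' (by fun_prop) (ae_of_all _ fun ω => ?_)
    rw [norm_smul, Real.norm_eq_abs]
    have h1 : |u ω| ^ 4 = u ω ^ 4 := (by decide : Even 4).pow_abs _
    nlinarith [sq_nonneg (|u ω| - ‖X ω‖), sq_nonneg (|u ω| ^ 2 - 1), sq_nonneg (‖X ω‖ ^ 2 - 1), sq_nonneg (|u ω| ^ 2 - ‖X ω‖ ^ 2)]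
  have c1 := condExp_ae_eq_integral_condDistrib (μ := μ) hZ hW.aemeasurable (f := fun e : Vec k × ℝ => ‖e.1‖ ^ (2 * m))
    (by fun_prop : Measurable _).stronglyMeasurable hxi
  have c2 := condExp_ae_eq_integral_condDistrib (μ := μ) hZ hW.aemeasurable (f := fun e : Vec k × ℝ => |e.2| ^ (2 * m))
    (by fun_prop : Measurable _).stronglyMeasurable hui
  have c3 := condExp_ae_eq_integral_condDistrib (μ := μ) hZ hW.aemeasurable (f := fun e : Vec k × ℝ => e.2)
    measurable_snd.stronglyMeasurable hu1
  have c4 := condExp_ae_eq_integral_condDistrib (μ := μ) hZ hW.aemeasurable (f := fun e : Vec k × ℝ => e.2 • e.1)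
    (by fun_prop : Measurable _).stronglyMeasurable hux
  have c5 : ∀ᵐ ω ∂μ, Integrable (fun e : Vec k × ℝ => e.2 • e.1) (condDistrib (fun ω => (X ω, u ω)) Z μ (Z ω)) := by
    refine Integrable.condDistrib_ae (f := fun q : Vec p × (Vec k × ℝ) => q.2.2 • q.2.1) hZ.aemeasurable hW.aemeasurable ?_
    have hq : Measurable fun q : Vec p × (Vec k × ℝ) => q.2.2 • q.2.1 := by fun_prop
    exact (integrable_map_measure hq.aestronglyMeasurable (hZ.prodMk hW).aemeasurable).2 hux
  filter_upwards [hxM, huM, hex, heu, c1, c2, c3, c4, c5, tr (fun e => ‖e.1‖ ^ (2 * m)) (by fun_prop) hxi, tr (fun e => |e.2| ^ (2 * m)) (by fun_prop) hui]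
    with ω a1 a2 a3 a4 b1 b2 b3 b4 b5 d1 d2
  refine unitBounds_of_moments hm d1 (by rw [← b1]; exact a1.le) d2 (by rw [← b2]; exact a2.le) ?_ fun a => ?_
  · rw [← b3]; exact a4
  · have h5 := (EuclideanSpace.proj a : Vec k →L[ℝ] ℝ).integral_comp_comm b5
    rw [← b4, a3] at h5
    simp only [PiLp.proj_apply, PiLp.smul_apply, smul_eq_mul, Pi.zero_apply, map_zero] at h5
    rw [← h5]
    congr 1; ext e; ring

end unit

/-! ### Measurability -/

section measurability
variable {α : Type*} [MeasurableSpace α] {n k p : ℕ}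

theorem measurable_inv_card_stratum {z : α → Fin n → Vec p} (hz : ∀ i, Measurable fun a => z a i) (i : Fin n) :
    Measurable fun a => ((stratum (z a) (z a i)).card : ℝ)⁻¹ := by
  classical
  have e : (fun a => ((stratum (z a) (z a i)).card : ℝ)) = fun a => ∑ j, if z a j = z a i then (1 : ℝ) else 0 := by
    funext a
    rw [Finset.sum_boole]
    congr 2
  have h : Measurable fun a => ((stratum (z a) (z a i)).card : ℝ) := by
    rw [e]
    exact Finset.measurable_fun_sum _ fun j _ =>
      Measurable.ite (measurableSet_eq_fun (hz j) (hz i)) measurable_const measurable_const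
  exact h.inv

theorem measurable_sMean {z : α → Fin n → Vec p} {f : α → Fin n → ℝ} (hz : ∀ i, Measurable fun a => z a i)
    (hf : ∀ j, Measurable fun a => f a j) (i : Fin n) : Measurable fun a => sMean (z a) (f a) i := by
  simp_rw [sMean_eq_sum]
  exact Finset.measurable_fun_sum _ fun j _ => Measurable.ite (measurableSet_eq_fun (hz j) (hz i))
    ((measurable_inv_card_stratum hz i).mul (hf j)) measurable_const

theorem measurable_card_strata {z : α → Fin n → Vec p} (hz : ∀ i, Measurable fun a => z a i) :
    Measurable fun a => ((strata (z a)).card : ℝ) := by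
  simp_rw [← sum_inv_card_stratum]
  exact Finset.measurable_fun_sum _ fun i _ => measurable_inv_card_stratum hz i

variable {κ : Fin n → Kernel (Vec p) (Vec k × ℝ)} [∀ i, IsMarkovKernel (κ i)]

theorem measurable_unitMean {z : α → Fin n → Vec p} (hz : ∀ i, Measurable fun a => z a i) (a : Fin k) (j : Fin n) :
    Measurable fun x => unitMean (fun i => κ i (z x i)) a j := by
  have h : Measurable fun c => ∫ e, e.1 a ∂(κ j c) :=
    ((measurable_coord a).comp measurable_snd).stronglyMeasurable.integral_kernel_prod_right'.measurable
  exact h.comp (hz j)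

theorem measurable_devn_kernel {z : α → Fin n → Vec p} (hz : ∀ i, Measurable fun a => z a i)
    {e : α → Vec k × ℝ} (he : Measurable e) (a : Fin k) (i : Fin n) :
    Measurable fun x => devn (fun i => κ i (z x i)) (z x) a i (e x) :=
  ((measurable_coord a).comp he).sub (measurable_sMean hz (fun j => measurable_unitMean hz a j) i)

theorem measurable_meanErr_kernel {z : α → Fin n → Vec p} (hz : ∀ i, Measurable fun a => z a i)
    {w : α → Fin n → Vec k × ℝ} (hw : ∀ i, Measurable fun x => w x i) (a : Fin k) (i : Fin n) :
    Measurable fun x => meanErr (fun i => κ i (z x i)) (z x) (w x) a i :=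
  measurable_sMean hz (fun j => ((measurable_coord a).comp (hw j)).sub (measurable_unitMean hz a j)) i

theorem measurable_omegaOf_kernel {z : α → Fin n → Vec p} (hz : ∀ i, Measurable fun a => z a i) (a b : Fin k) :
    Measurable fun x => omegaOf (fun i => κ i (z x i)) (z x) a b := by
  have h : ∀ i, Measurable fun c : Fin n → Vec p => ∫ e, devn (fun i => κ i (c i)) c a i e * devn (fun i => κ i (c i)) c b i e * e.2 ^ 2 ∂(κ i (c i)) := by
    intro i
    have hm : Measurable fun q : (Fin n → Vec p) × (Vec k × ℝ) => devn (fun i => κ i (q.1 i)) q.1 a i q.2 * devn (fun i => κ i (q.1 i)) q.1 b i q.2 * q.2.2 ^ 2 :=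
      ((measurable_devn_kernel (by fun_prop) measurable_snd a i).mul
        (measurable_devn_kernel (by fun_prop) measurable_snd b i)).mul (by fun_prop)
    exact (hm.stronglyMeasurable.integral_kernel_prod_right' (κ := (κ i).comap (fun c : Fin n → Vec p => c i) (measurable_pi_apply i))).measurable
  simp only [omegaOf, Matrix.of_apply]
  exact (Finset.measurable_fun_sum _ fun i _ => (h i).comp (measurable_pi_lambda _ hz)).const_mul _

end measurability

theorem omegaOf_isHermitian {n k p : ℕ} (P : Fin n → Measure (Vec k × ℝ)) (z : Fin n → Vec p) :
    (omegaOf P z).IsHermitian := by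
  ext a b
  simp only [omegaOf, Matrix.conjTranspose_apply, Matrix.of_apply, star_trivial, mul_comm (devn P z a _ _)]

/-! ### Conditional means and the matrix `Ω_n` in terms of the conditional laws -/

section model
variable {Ω : Type*} [MeasurableSpace Ω] {μ : Measure Ω} [IsProbabilityMeasure μ] {n k p : ℕ}
  {X : Fin n → Ω → Vec k} {Z : Fin n → Ω → Vec p} {u : Fin n → Ω → ℝ}

/-- The stratum averages of `E[X_j | Z_j]` are stratum means of the means of the conditional laws. -/
theorem ae_stratumMean_eq (hX : ∀ i, Measurable (X i)) (hZ : ∀ i, Measurable (Z i)) (hu : ∀ i, Measurable (u i))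
    (hint : ∀ i, Integrable (X i) μ) :
    ∀ᵐ ω ∂μ, ∀ i a, stratumMean μ X Z (Z i ω) ω a =
      sMean (fun j => Z j ω) (unitMean (fun j => unitKernel μ X Z u j (Z j ω)) a) i := by
  have h : ∀ j, ∀ᵐ ω ∂μ, ∀ a, (μ[X j | sigmaZ Z j]) ω a = unitMean (fun j => unitKernel μ X Z u j (Z j ω)) a j := by
    intro j
    have hW : Measurable fun ω => (X j ω, u j ω) := (hX j).prodMk (hu j)
    have c1 := condExp_ae_eq_integral_condDistrib (μ := μ) (hZ j) hW.aemeasurable (f := fun e : Vec k × ℝ => e.1)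
      measurable_fst.stronglyMeasurable (hint j)
    have c2 : ∀ᵐ ω ∂μ, Integrable (fun e : Vec k × ℝ => e.1) (unitKernel μ X Z u j (Z j ω)) := by
      refine Integrable.condDistrib_ae (f := fun q : Vec p × (Vec k × ℝ) => q.2.1) (hZ j).aemeasurable hW.aemeasurable ?_
      have hq : Measurable fun q : Vec p × (Vec k × ℝ) => q.2.1 := by fun_prop
      exact (integrable_map_measure hq.aestronglyMeasurable ((hZ j).prodMk hW).aemeasurable).2 (hint j)
    filter_upwards [c1, c2] with ω h1 h2 a
    have h5 := (EuclideanSpace.proj a : Vec k →L[ℝ] ℝ).integral_comp_comm h2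
    simp only [PiLp.proj_apply] at h5
    exact (congrArg (fun v : Vec k => v a) h1).trans h5.symm
  filter_upwards [ae_all_iff.2 h] with ω hω i a
  simp only [stratumMean, PiLp.smul_apply, smul_eq_mul, WithLp.ofLp_sum, Finset.sum_apply, sMean]
  congr 1
  exact Finset.sum_congr rfl fun j _ => hω j a

/-- The matrix `Ω_n` is that of the conditional laws of the units. -/
theorem ae_omegaMat_eq (hX : ∀ i, Measurable (X i)) (hZ : ∀ i, Measurable (Z i)) (hu : ∀ i, Measurable (u i))
    (hind : iIndepFun (fun i ω => (X i ω, Z i ω, u i ω)) μ)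
    (hX4 : ∀ i, Integrable (fun ω => ‖X i ω‖ ^ 4) μ) (hu4 : ∀ i, Integrable (fun ω => u i ω ^ 4) μ)
    {M : ℝ} {ρ : ℝ → ℝ} (hB : ∀ᵐ ω ∂μ, ∀ i, UnitBounds (unitKernel μ X Z u i (Z i ω)) M ρ) :
    ∀ᵐ ω ∂μ, omegaMat μ X Z u ω = omegaOf (fun i => unitKernel μ X Z u i (Z i ω)) (fun i => Z i ω) := by
  have hint : ∀ i, Integrable (X i) μ := fun i => by
    refine ((hX4 i).fun_add (integrable_const (1:ℝ))).mono' (hX i).aestronglyMeasurable (ae_of_all _ fun ω => ?_)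
    nlinarith [sq_nonneg (‖X i ω‖ - 1), sq_nonneg (‖X i ω‖ ^ 2 - 1)]
  have hm := ae_stratumMean_eq hX hZ hu hint
  have key : ∀ a b i, ∀ᵐ ω ∂μ, (μ[fun ω' => (X i ω' a - stratumMean μ X Z (Z i ω') ω' a) *
        (X i ω' b - stratumMean μ X Z (Z i ω') ω' b) * u i ω' ^ 2 | sigmaAllZ Z]) ω =
      ∫ e, devn (fun i => unitKernel μ X Z u i (Z i ω)) (fun i => Z i ω) a i e *
        devn (fun i => unitKernel μ X Z u i (Z i ω)) (fun i => Z i ω) b i e * e.2 ^ 2 ∂(unitKernel μ X Z u i (Z i ω)) := by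
    intro a b i
    set f : (Fin n → Vec p) × (Vec k × ℝ) → ℝ := fun q => devn (fun i => unitKernel μ X Z u i (q.1 i)) q.1 a i q.2 *
      devn (fun i => unitKernel μ X Z u i (q.1 i)) q.1 b i q.2 * q.2.2 ^ 2 with hf
    have hfm : Measurable f := ((measurable_devn_kernel (by fun_prop) measurable_snd a i).mul
        (measurable_devn_kernel (by fun_prop) measurable_snd b i)).mul (by fun_prop)
    have hZm : Measurable fun ω (i : Fin n) => Z i ω := measurable_pi_lambda _ hZ
    have hI : Integrable (fun ω => f (fun j => Z j ω, (X i ω, u i ω))) μ := by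
      refine ((((integrable_const (1:ℝ)).fun_add (hX4 i)).fun_add (hu4 i)).const_mul (2 + 2 * k * (1 + M))).mono'
        (hfm.comp (hZm.prodMk ((hX i).prodMk (hu i)))).aestronglyMeasurable ?_
      filter_upwards [hB] with ω hω
      have hM := (hω i).nonneg
      exact (abs_devn_mul_devn_mul_le _ _ hω a b i _).trans (by gcongr; exact envelope_le _)
    refine EventuallyEq.trans (condExp_congr_ae ?_) (condExp_sigmaAllZ_ae_eq hX hZ hu hind hfm i hI)
    filter_upwards [hm] with ω hω
    rw [hω, hω]; rfl
  filter_upwards [ae_all_iff.2 fun a => ae_all_iff.2 fun b => ae_all_iff.2 fun i => key a b i] with ω hω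
  ext a b
  simp only [omegaMat, omegaOf, Matrix.of_apply]
  congr 1
  exact Finset.sum_congr rfl fun i _ => hω a b i

/-- A bound on the conditional mean given `Z_1, …, Z_n` carries over to the mean. -/
theorem lintegral_data_le (hX : ∀ i, Measurable (X i)) (hZ : ∀ i, Measurable (Z i)) (hu : ∀ i, Measurable (u i))
    (hind : iIndepFun (fun i ω => (X i ω, Z i ω, u i ω)) μ)
    {F : (Fin n → Vec p) × (Fin n → Vec k × ℝ) → ℝ} (hF : Measurable F) (hF0 : ∀ q, 0 ≤ F q)
    {G : (Fin n → Vec p) → ℝ}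
    (h : ∀ᵐ ω ∂μ, Integrable (fun w => F (fun i => Z i ω, w)) (Measure.pi fun i => unitKernel μ X Z u i (Z i ω)) ∧
      ∫ w, F (fun i => Z i ω, w) ∂(Measure.pi fun i => unitKernel μ X Z u i (Z i ω)) ≤ G fun i => Z i ω) :
    ∫⁻ ω, ENNReal.ofReal (F (fun i => Z i ω, fun i => (X i ω, u i ω))) ∂μ ≤
      ∫⁻ ω, ENNReal.ofReal (G fun i => Z i ω) ∂μ := by
  rw [lintegral_data hX hZ hu hind hF.ennreal_ofReal]
  refine lintegral_mono_ae ?_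
  filter_upwards [h] with ω hω
  rw [← ofReal_integral_eq_lintegral_ofReal hω.1 (ae_of_all _ fun w => hF0 _)]
  exact ENNReal.ofReal_le_ofReal hω.2

end model

/-! ### Concentration of within-strata sums of squares -/

section leaveOneOut
variable {n p : ℕ}

/-- The mean of `f` over the units with `z j = c`; zero if there are none. -/
noncomputable def stratumAvg (z : Fin n → Vec p) (f : Fin n → ℝ) (c : Vec p) : ℝ :=
  ((stratum z c).card : ℝ)⁻¹ * ∑ j ∈ stratum z c, f j

theorem stratumAvg_pow_four_le (z : Fin n → Vec p) (f : Fin n → ℝ) (c : Vec p) :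
    stratumAvg z f c ^ 4 ≤ stratumAvg z (fun j => f j ^ 4) c := by
  by_cases h : ∃ i, z i = c
  · obtain ⟨i, rfl⟩ := h
    exact sMean_pow_le z f i (by norm_num)
  · have : stratum z c = ∅ := Finset.eq_empty_of_forall_notMem fun j hj => h ⟨j, mem_stratum.1 hj⟩
    simp [stratumAvg, this]

/-- The within-strata sum of squares. -/
noncomputable def withinSq (z : Fin n → Vec p) (g : Fin n → ℝ) : ℝ := ∑ j, (g j - sMean z g j) ^ 2

theorem withinSq_nonneg (z : Fin n → Vec p) (g : Fin n → ℝ) : 0 ≤ withinSq z g :=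
  Finset.sum_nonneg fun _ _ => sq_nonneg _

/-- Stratum means minimize the sum of squares among functions of the stratum. -/
theorem withinSq_le (z : Fin n → Vec p) (g : Fin n → ℝ) (d : Vec p → ℝ) :
    withinSq z g ≤ ∑ j, (g j - d (z j)) ^ 2 := by
  have h0 : ∑ j, (g j - sMean z g j) * (sMean z g j - d (z j)) = 0 := by
    have e : ∀ j, sMean z g j - d (z j) = sMean z (fun l => sMean z g l - d (z l)) j := fun j =>
      (sMean_of_stratum_const z (fun l => sMean z g l - d (z l)) j fun l hl => by
        simp only [sMean_eq_of_eq g hl, hl]).symm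
    have h1 := sum_sMean_mul z (fun l => sMean z g l - d (z l)) g
    have h2 := sum_sMean_mul z (fun l => sMean z g l - d (z l)) (sMean z g)
    simp_rw [← e] at h1 h2
    simp_rw [sMean_sMean] at h2
    have : ∑ j, (g j - sMean z g j) * (sMean z g j - d (z j)) = ∑ j, (sMean z g j - d (z j)) * g j -
        ∑ j, (sMean z g j - d (z j)) * sMean z g j := by
      rw [← Finset.sum_sub_distrib]; exact Finset.sum_congr rfl fun j _ => by ring
    linarith
  have h3 : ∑ j, (g j - d (z j)) ^ 2 = withinSq z g + 2 * ∑ j, (g j - sMean z g j) * (sMean z g j - d (z j)) +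
      ∑ j, (sMean z g j - d (z j)) ^ 2 := by
    rw [withinSq, Finset.mul_sum, ← Finset.sum_add_distrib, ← Finset.sum_add_distrib]
    exact Finset.sum_congr rfl fun j _ => by ring
  have : 0 ≤ ∑ j, (sMean z g j - d (z j)) ^ 2 := Finset.sum_nonneg fun _ _ => sq_nonneg _
  linarith

theorem withinSq_le_sum_sq (z : Fin n → Vec p) (g : Fin n → ℝ) : withinSq z g ≤ ∑ j, g j ^ 2 := by
  simpa using withinSq_le z g fun _ => 0

theorem withinSq_removeNth_le (z : Fin (n + 1) → Vec p) (g : Fin (n + 1) → ℝ) (i : Fin (n + 1)) :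
    withinSq (i.removeNth z) (i.removeNth g) ≤ withinSq z g := by
  refine (withinSq_le _ _ (stratumAvg z g)).trans ?_
  rw [withinSq, Fin.sum_univ_succAbove _ i]
  exact le_add_of_nonneg_left (sq_nonneg _)

theorem withinSq_le_removeNth_add (z : Fin (n + 1) → Vec p) (g : Fin (n + 1) → ℝ) (i : Fin (n + 1)) :
    withinSq z g ≤ withinSq (i.removeNth z) (i.removeNth g) +
      (g i - stratumAvg (i.removeNth z) (i.removeNth g) (z i)) ^ 2 := by
  refine (withinSq_le _ _ (stratumAvg (i.removeNth z) (i.removeNth g))).trans ?_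
  rw [Fin.sum_univ_succAbove _ i, add_comm]
  rfl

theorem card_stratum_removeNth (z : Fin (n + 1) → Vec p) (i : Fin (n + 1)) :
    ((stratum (i.removeNth z) (z i)).card : ℝ) = (stratum z (z i)).card - 1 := by
  classical
  have h1 : ∀ {m : ℕ} (y : Fin m → Vec p) (c : Vec p), ((stratum y c).card : ℝ) = ∑ j, if y j = c then (1 : ℝ) else 0 := by
    intro m y c
    rw [Finset.sum_boole]; congr 2
  rw [h1, h1, Fin.sum_univ_succAbove _ i]
  simp only [Fin.removeNth, if_true, add_sub_cancel_left]
  exact Finset.sum_congr rfl fun j _ => by congr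

/-- A unit enters the average over the other units for each of the other units of its stratum, with total weight one; for
a singleton stratum the weight is zero. -/
theorem sum_stratumAvg_removeNth_le (z : Fin (n + 1) → Vec p) {f : Fin (n + 1) → ℝ} (hf : ∀ j, 0 ≤ f j) :
    ∑ i, stratumAvg (i.removeNth z) (i.removeNth f) (z i) ≤ ∑ j, f j := by
  classical
  have e : ∀ i, stratumAvg (i.removeNth z) (i.removeNth f) (z i) =
      ∑ j, if z j = z i ∧ j ≠ i then ((stratum z (z i)).card - 1 : ℝ)⁻¹ * f j else 0 := by
    intro i
    rw [stratumAvg, card_stratum_removeNth, Fin.sum_univ_succAbove _ i]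
    simp only [ne_eq, not_true_eq_false, and_false, if_false, zero_add, Fin.succAbove_ne, not_false_eq_true, and_true]
    rw [Finset.mul_sum, ← Finset.sum_filter]
    rfl
  simp_rw [e]
  rw [Finset.sum_comm]
  refine Finset.sum_le_sum fun j _ => ?_
  have e2 : ∀ i, (if z j = z i ∧ j ≠ i then ((stratum z (z i)).card - 1 : ℝ)⁻¹ * f j else 0) =
      if z i = z j ∧ i ≠ j then ((stratum z (z j)).card - 1 : ℝ)⁻¹ * f j else 0 := by
    intro i
    by_cases h : z j = z i
    · simp only [h, ne_comm]
    · rw [if_neg (by tauto), if_neg (fun h' => h h'.1.symm)]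
  simp_rw [e2]
  rw [← Finset.sum_filter, Finset.sum_const]
  have hc : ((Finset.univ.filter fun i => z i = z j ∧ i ≠ j).card : ℝ) = (stratum z (z j)).card - 1 := by
    have : (Finset.univ.filter fun i => z i = z j ∧ i ≠ j) = (stratum z (z j)).erase j := by
      ext i; simp [mem_stratum, and_comm]
    rw [this, Finset.card_erase_of_mem (mem_stratum.2 rfl), Nat.cast_sub (Finset.card_pos.2 ⟨j, mem_stratum.2 rfl⟩)]
    simp
  rw [nsmul_eq_mul, hc, ← mul_assoc]
  exact mul_le_of_le_one_left (hf j) mul_inv_le_one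

/-- Removing a unit lowers the within-strata sum of squares by at most the square of its distance to the mean of the
remaining units of its stratum. -/
theorem sum_sq_withinSq_sub_le (z : Fin (n + 1) → Vec p) (g : Fin (n + 1) → ℝ) :
    ∑ i : Fin (n + 1), (withinSq z g - withinSq (i.removeNth z) (i.removeNth g)) ^ 2 ≤ 16 * ∑ i, g i ^ 4 := by
  have h1 : ∀ i : Fin (n + 1), (withinSq z g - withinSq (i.removeNth z) (i.removeNth g)) ^ 2 ≤
      8 * (g i ^ 4 + stratumAvg (i.removeNth z) (i.removeNth fun j => g j ^ 4) (z i)) := by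
    intro i
    have a := withinSq_removeNth_le z g i
    have b := withinSq_le_removeNth_add z g i
    have c := stratumAvg_pow_four_le (i.removeNth z) (i.removeNth g) (z i)
    calc _ ≤ ((g i - stratumAvg (i.removeNth z) (i.removeNth g) (z i)) ^ 2) ^ 2 :=
          pow_le_pow_left₀ (by linarith) (by linarith) 2
      _ = (g i - stratumAvg (i.removeNth z) (i.removeNth g) (z i)) ^ 4 := by ring
      _ ≤ 8 * (g i ^ 4 + stratumAvg (i.removeNth z) (i.removeNth g) (z i) ^ 4) := sub_pow_four_le _ _
      _ ≤ _ := by gcongr; exact c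
  have h2 := sum_stratumAvg_removeNth_le z (f := fun j => g j ^ 4) fun j => by positivity
  have h3 := Finset.sum_le_sum fun i (_ : i ∈ Finset.univ) => h1 i
  rw [← Finset.mul_sum, Finset.sum_add_distrib] at h3
  linarith

theorem measurable_withinSq {α : Type*} [MeasurableSpace α] {z : α → Fin n → Vec p} {g : α → Fin n → ℝ}
    (hz : ∀ i, Measurable fun a => z a i) (hg : ∀ i, Measurable fun a => g a i) :
    Measurable fun a => withinSq (z a) (g a) :=
  Finset.measurable_fun_sum _ fun i _ => ((hg i).sub (measurable_sMean hz hg i)).pow_const 2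

/-- The variance of the within-strata sum of squares of independent pairs is of the order of the number of pairs, by the
Efron–Stein inequality with one unit removed. -/
theorem integral_sq_withinSq_sub_le {Ω : Type*} [MeasurableSpace Ω] {μ : Measure Ω} [IsProbabilityMeasure μ]
    {Z : Fin n → Ω → Vec p} {g : Fin n → Ω → ℝ} (hZ : ∀ i, Measurable (Z i)) (hg : ∀ i, Measurable (g i))
    (hind : iIndepFun (fun i ω => (g i ω, Z i ω)) μ) {M : ℝ} (hg4 : ∀ i, Integrable (fun ω => g i ω ^ 4) μ)
    (hM : ∀ i, ∫ ω, g i ω ^ 4 ∂μ ≤ M) :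
    MemLp (fun ω => withinSq (fun i => Z i ω) (fun i => g i ω)) 2 μ ∧
    ∫ ω, (withinSq (fun i => Z i ω) (fun i => g i ω) -
      ∫ ω', withinSq (fun i => Z i ω') (fun i => g i ω') ∂μ) ^ 2 ∂μ ≤ 16 * M * n := by
  have hL : MemLp (fun ω => withinSq (fun i => Z i ω) (fun i => g i ω)) 2 μ := by
    have : MemLp (fun ω => ∑ i, g i ω ^ 2) 2 μ := memLp_finsetSum _ fun i _ => by
      simpa [sq] using memLp_two_mul (memLp_four_of_integrable (hg i) (hg4 i)) (memLp_four_of_integrable (hg i) (hg4 i))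
    refine this.mono (measurable_withinSq hZ hg).aestronglyMeasurable (ae_of_all _ fun ω => ?_)
    rw [Real.norm_of_nonneg (withinSq_nonneg _ _), Real.norm_of_nonneg (Finset.sum_nonneg fun _ _ => sq_nonneg _)]
    exact withinSq_le_sum_sq _ _
  refine ⟨hL, ?_⟩
  rcases n with _ | n
  · simp [withinSq]
  have hm : ∀ i, Measurable fun ω => (g i ω, Z i ω) := fun i => (hg i).prodMk (hZ i)
  have hmm : Measurable fun ω i => (g i ω, Z i ω) := measurable_pi_lambda _ hm
  have hlaw := (iIndepFun_iff_map_fun_eq_pi_map fun i => (hm i).aemeasurable).1 hind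
  set P : Fin (n + 1) → Measure (ℝ × Vec p) := fun i => μ.map fun ω => (g i ω, Z i ω)
  have hP : ∀ i, IsProbabilityMeasure (P i) := fun i => Measure.isProbabilityMeasure_map (hm i).aemeasurable
  set q : (Fin (n + 1) → ℝ × Vec p) → ℝ := fun w => withinSq (fun i => (w i).2) (fun i => (w i).1)
  set q' : Fin (n + 1) → (Fin (n + 1) → ℝ × Vec p) → ℝ := fun i w =>
    withinSq (i.removeNth fun i => (w i).2) (i.removeNth fun i => (w i).1)
  have hq : Measurable q := measurable_withinSq (fun i => by fun_prop) (fun i => by fun_prop)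
  have hq' : ∀ i, Measurable (q' i) := fun i => measurable_withinSq
    (fun j => by simp only [Fin.removeNth]; fun_prop) (fun j => by simp only [Fin.removeNth]; fun_prop)
  have hqL : MemLp q 2 (Measure.pi P) := by
    rw [← hlaw]; exact (memLp_map_measure_iff hq.aestronglyMeasurable hmm.aemeasurable).2 hL
  have hqL' : ∀ i, MemLp (q' i) 2 (Measure.pi P) := fun i =>
    hqL.mono (hq' i).aestronglyMeasurable (ae_of_all _ fun w => by
      rw [Real.norm_of_nonneg (withinSq_nonneg _ _), Real.norm_of_nonneg (withinSq_nonneg _ _)]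
      exact withinSq_removeNth_le _ _ i)
  have hES := efron_stein P hq hqL hq' hqL' fun i w x => by
    have : ∀ j : Fin n, Function.update w i x (i.succAbove j) = w (i.succAbove j) := fun j =>
      Function.update_of_ne (Fin.succAbove_ne i j) _ _
    change withinSq (fun j => (Function.update w i x (i.succAbove j)).2)
      (fun j => (Function.update w i x (i.succAbove j)).1) = _
    simp only [this]
    rfl
  have e1 : ∫ w, q w ∂(Measure.pi P) = ∫ ω', withinSq (fun i => Z i ω') (fun i => g i ω') ∂μ := by
    rw [← hlaw, integral_map hmm.aemeasurable hq.aestronglyMeasurable]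
  have e2 : ∫ w, (q w - ∫ w', q w' ∂(Measure.pi P)) ^ 2 ∂(Measure.pi P) =
      ∫ ω, (withinSq (fun i => Z i ω) (fun i => g i ω) -
      ∫ ω', withinSq (fun i => Z i ω') (fun i => g i ω') ∂μ) ^ 2 ∂μ := by
    rw [e1, ← hlaw, integral_map hmm.aemeasurable ((hq.sub_const _).pow_const 2).aestronglyMeasurable]
  rw [← e2]
  refine hES.trans ?_
  have hd : ∀ i, Integrable (fun w => (q w - q' i w) ^ 2) (Measure.pi P) := fun i => (hqL.sub (hqL' i)).integrable_sq
  rw [← integral_finsetSum _ fun i _ => hd i]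
  have hm4 : ∀ i, Measurable (fun w : Fin (n + 1) → ℝ × Vec p => (w i).1 ^ 4) := fun i => by fun_prop
  have hi4 : ∀ i, Integrable (fun w : Fin (n + 1) → ℝ × Vec p => (w i).1 ^ 4) (Measure.pi P) := fun i => by
    rw [← hlaw]
    exact (integrable_map_measure (hm4 i).aestronglyMeasurable hmm.aemeasurable).2 (hg4 i)
  refine (integral_mono (integrable_finsetSum _ fun i _ => hd i)
    ((integrable_finsetSum _ fun i _ => hi4 i).const_mul 16) fun w =>
      sum_sq_withinSq_sub_le (fun i => (w i).2) (fun i => (w i).1)).trans ?_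
  rw [integral_const_mul, integral_finsetSum _ fun i _ => hi4 i]
  have : ∀ i, ∫ w, (w i).1 ^ 4 ∂(Measure.pi P) ≤ M := fun i => by
    rw [← hlaw, integral_map hmm.aemeasurable (hm4 i).aestronglyMeasurable]
    exact hM i
  have := Finset.sum_le_sum fun i (_ : i ∈ Finset.univ) => this i
  simp only [Finset.sum_const, Finset.card_univ, Fintype.card_fin, nsmul_eq_mul] at this
  linarith

end leaveOneOut

section gram
variable {n k p : ℕ}

/-- Polarization: the entries of `X̃' X̃` are combinations of within-strata sums of squares. -/
theorem sum_Xtilde_mul_Xtilde (x : Fin n → Vec k) (z : Fin n → Vec p) (a b : Fin k) :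
    ∑ i, Xtilde x z i a * Xtilde x z i b = 2⁻¹ * (withinSq z (fun i => x i a + x i b) -
      withinSq z (fun i => x i a) - withinSq z (fun i => x i b)) := by
  simp only [withinSq, Xtilde_apply, sMean_add]
  rw [← Finset.sum_sub_distrib, ← Finset.sum_sub_distrib, Finset.mul_sum]
  exact Finset.sum_congr rfl fun i _ => by ring

/-- The sample Gram matrix of the demeaned regressors is close to its mean. -/
theorem integral_abs_gram_sub_le {Ω : Type*} [MeasurableSpace Ω] {μ : Measure Ω} [IsProbabilityMeasure μ]
    {X : Fin n → Ω → Vec k} {Z : Fin n → Ω → Vec p} (hX : ∀ i, Measurable (X i)) (hZ : ∀ i, Measurable (Z i))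
    (hind : iIndepFun (fun i ω => (X i ω, Z i ω)) μ) {M : ℝ} (hX4 : ∀ i, Integrable (fun ω => ‖X i ω‖ ^ 4) μ)
    (hM : ∀ i, ∫ ω, ‖X i ω‖ ^ 4 ∂μ ≤ M) (a b : Fin k) :
    Integrable (fun ω => ∑ i, Xtilde (fun i => X i ω) (fun i => Z i ω) i a * Xtilde (fun i => X i ω) (fun i => Z i ω) i b) μ ∧
    ∫ ω, |∑ i, Xtilde (fun i => X i ω) (fun i => Z i ω) i a * Xtilde (fun i => X i ω) (fun i => Z i ω) i b -
      ∫ ω', ∑ i, Xtilde (fun i => X i ω') (fun i => Z i ω') i a * Xtilde (fun i => X i ω') (fun i => Z i ω') i b ∂μ| ∂μ ≤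
      24 * √(M * n) := by
  have main : ∀ L : Vec k → ℝ, Measurable L → (∀ x, L x ^ 4 ≤ 16 * ‖x‖ ^ 4) →
      Integrable (fun ω => withinSq (fun i => Z i ω) fun i => L (X i ω)) μ ∧
      ∫ ω, |withinSq (fun i => Z i ω) (fun i => L (X i ω)) - ∫ ω', withinSq (fun i => Z i ω') (fun i => L (X i ω')) ∂μ| ∂μ ≤
        16 * √(M * n) := by
    intro L hL hL4
    have hi : ∀ i, Integrable (fun ω => L (X i ω) ^ 4) μ := fun i =>
      ((hX4 i).const_mul 16).mono' ((hL.comp (hX i)).pow_const 4).aestronglyMeasurable (ae_of_all _ fun ω => by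
        rw [Real.norm_of_nonneg (by positivity)]; exact hL4 _)
    have h := integral_sq_withinSq_sub_le (μ := μ) (M := 16 * M) hZ (fun i => hL.comp (hX i))
      (hind.comp (fun _ q => (L q.1, q.2)) fun _ => by fun_prop) hi fun i =>
        (integral_mono (hi i) ((hX4 i).const_mul 16) fun ω => hL4 _).trans (by
          rw [integral_const_mul]; linarith [hM i])
    refine ⟨h.1.integrable (by norm_num), (integral_abs_le_sqrt μ (h.1.sub (memLp_const _))).trans ?_⟩
    refine Real.sqrt_le_iff.2 ⟨by positivity, h.2.trans ?_⟩
    rw [mul_pow]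
    rcases Nat.eq_zero_or_pos n with h0 | h0
    · subst h0; simp
    have hM0 : 0 ≤ M := (integral_nonneg fun ω => by positivity).trans (hM ⟨0, h0⟩)
    rw [Real.sq_sqrt (by positivity)]
    linarith
  have hab : ∀ x : Vec k, (x a + x b) ^ 4 ≤ 16 * ‖x‖ ^ 4 := fun x =>
    (add_pow_four_le (x a) (x b)).trans (by linarith [coord_pow_four_le x a, coord_pow_four_le x b])
  have ha : ∀ (a : Fin k) (x : Vec k), (x a) ^ 4 ≤ 16 * ‖x‖ ^ 4 := fun a x =>
    (coord_pow_four_le x a).trans (by nlinarith [sq_nonneg (‖x‖ ^ 2)])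
  obtain ⟨i1, h1⟩ := main (fun x => x a + x b) (by fun_prop) hab
  obtain ⟨i2, h2⟩ := main (fun x => x a) (by fun_prop) (ha a)
  obtain ⟨i3, h3⟩ := main (fun x => x b) (by fun_prop) (ha b)
  simp_rw [sum_Xtilde_mul_Xtilde]
  refine ⟨((i1.sub i2).sub i3).const_mul _, ?_⟩
  have i12 : Integrable (fun ω => withinSq (fun i => Z i ω) (fun i => X i ω a + X i ω b) -
      withinSq (fun i => Z i ω) fun i => X i ω a) μ := i1.sub i2
  rw [integral_const_mul, integral_sub i12 i3, integral_sub i1 i2]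
  set c1 := ∫ ω', withinSq (fun i => Z i ω') (fun i => X i ω' a + X i ω' b) ∂μ
  set c2 := ∫ ω', withinSq (fun i => Z i ω') (fun i => X i ω' a) ∂μ
  set c3 := ∫ ω', withinSq (fun i => Z i ω') (fun i => X i ω' b) ∂μ
  have j1 := (i1.sub (integrable_const c1)).abs
  have j2 := (i2.sub (integrable_const c2)).abs
  have j3 := (i3.sub (integrable_const c3)).abs
  refine (integral_mono_of_nonneg (ae_of_all _ fun ω => abs_nonneg _) (((j1.add j2).add j3).const_mul 2⁻¹)
    (ae_of_all _ fun ω => ?_)).trans ?_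
  · simp only [Pi.add_apply, Pi.sub_apply]
    rw [← mul_sub, abs_mul, abs_of_pos (by norm_num : (0:ℝ) < 2⁻¹)]
    refine mul_le_mul_of_nonneg_left ?_ (by norm_num)
    set q1 := withinSq (fun i => Z i ω) (fun i => X i ω a + X i ω b)
    set q2 := withinSq (fun i => Z i ω) (fun i => X i ω a)
    set q3 := withinSq (fun i => Z i ω) (fun i => X i ω b)
    rw [show q1 - q2 - q3 - (c1 - c2 - c3) = (q1 - c1) - (q2 - c2) - (q3 - c3) by ring]
    exact (abs_sub _ _).trans (by gcongr; exact abs_sub _ _)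
  · rw [integral_const_mul, integral_add' (j1.add j2) j3, integral_add' j1 j2]
    simp only [Pi.sub_apply]
    linarith

end gram

/-! ### Convergence and boundedness in probability -/

section whp
variable {Ω : Type*} [MeasurableSpace Ω]

/-- The filter of the sets `s` for which `(n, ω) ∈ s` has probability tending to one as `n → ∞`. A family
`f n` converges in probability to `a` exactly if `f` tends to `a` along this filter. -/
def whp (μ : Measure Ω) : Filter (ℕ × Ω) where
  sets := {s | Tendsto (fun n => μ {ω | (n, ω) ∉ s}) atTop (𝓝 0)}
  univ_sets := by simp
  sets_of_superset := fun {s t} hs hst => tendsto_of_tendsto_of_tendsto_of_le_of_le tendsto_const_nhds hs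
    (fun _ => zero_le) fun n => measure_mono fun ω hω h => hω (hst h)
  inter_sets := fun {s t} hs ht => by
    have h := Tendsto.add hs ht
    rw [add_zero] at h
    refine tendsto_of_tendsto_of_tendsto_of_le_of_le tendsto_const_nhds h (fun _ => zero_le) fun n => ?_
    refine (measure_mono fun ω hω => ?_).trans (measure_union_le _ _)
    by_contra hc
    simp only [Set.mem_union, Set.mem_ofPred_eq, not_or, not_not] at hc
    exact hω hc

variable {μ : Measure Ω}

theorem eventually_whp {P : ℕ × Ω → Prop} :
    (∀ᶠ q in whp μ, P q) ↔ Tendsto (fun n => μ {ω | ¬ P (n, ω)}) atTop (𝓝 0) := Iff.rfl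

theorem tendsto_fst_whp : Tendsto Prod.fst (whp μ) atTop := by
  refine tendsto_atTop.2 fun N => eventually_whp.2 ?_
  refine tendsto_const_nhds.congr' ?_
  filter_upwards [eventually_ge_atTop N] with n hn
  simp [hn]

theorem eventually_whp_of_ae {P : ℕ × Ω → Prop} (h : ∀ n, ∀ᵐ ω ∂μ, P (n, ω)) : ∀ᶠ q in whp μ, P q :=
  eventually_whp.2 (tendsto_const_nhds.congr fun n => (ae_iff.1 (h n)).symm)

/-- Events that hold eventually with probability one have probability tending to one. -/
theorem eventually_whp_of_ae_eventually [IsFiniteMeasure μ] {P : ℕ × Ω → Prop}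
    (hm : ∀ n, MeasurableSet {ω | P (n, ω)}) (h : ∀ᵐ ω ∂μ, ∀ᶠ n in atTop, P (n, ω)) : ∀ᶠ q in whp μ, P q := by
  rw [eventually_whp]
  have := tendsto_measure_of_ae_tendsto_indicator_of_isFiniteMeasure (μ := μ) atTop MeasurableSet.empty
    (As := fun n => {ω | ¬ P (n, ω)}) (fun n => (hm n).compl) (by
      filter_upwards [h] with ω hω
      filter_upwards [hω] with n hn
      simp [hn])
  simpa using this

theorem tendsto_whp_zero_of_lintegral {f : ℕ × Ω → ℝ} (h0 : ∀ q, 0 ≤ f q)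
    (hm : ∀ n, Measurable fun ω => f (n, ω))
    (h : Tendsto (fun n => ∫⁻ ω, ENNReal.ofReal (f (n, ω)) ∂μ) atTop (𝓝 0)) : Tendsto f (whp μ) (𝓝 0) := by
  refine Metric.tendsto_nhds.2 fun ε hε => eventually_whp.2 ?_
  have h1 : Tendsto (fun n => (∫⁻ ω, ENNReal.ofReal (f (n, ω)) ∂μ) / ENNReal.ofReal ε) atTop (𝓝 0) := by
    have := ENNReal.Tendsto.div_const h (b := ENNReal.ofReal ε) (Or.inr (by simpa using hε))
    simpa using this
  refine tendsto_of_tendsto_of_tendsto_of_le_of_le tendsto_const_nhds h1 (fun _ => zero_le) fun n => ?_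
  refine (measure_mono fun ω hω => ?_).trans (meas_ge_le_lintegral_div (hm n).ennreal_ofReal.aemeasurable
    (by simpa using hε) ENNReal.ofReal_ne_top)
  simp only [Set.mem_ofPred_eq, Real.dist_eq, sub_zero, not_lt, abs_of_nonneg (h0 _)] at hω
  exact ENNReal.ofReal_le_ofReal hω

theorem tendstoInMeasure_iff_tendsto_whp {f : ℕ → Ω → ℝ} {a : ℝ} :
    TendstoInMeasure μ f atTop (fun _ => a) ↔ Tendsto (fun q : ℕ × Ω => f q.1 q.2) (whp μ) (𝓝 a) := by
  rw [tendstoInMeasure_iff_dist, Metric.tendsto_nhds]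
  refine forall_congr' fun ε => forall_congr' fun hε => ?_
  rw [eventually_whp]
  simp only [not_lt]

/-- Boundedness in probability: for every `ε` there is a bound that is exceeded with probability at most `ε` for all
large sample sizes. -/
def BddP (μ : Measure Ω) (f : ℕ × Ω → ℝ) : Prop :=
  ∀ ε : ENNReal, 0 < ε → ∃ K : ℝ, ∀ᶠ n in atTop, μ {ω | K < |f (n, ω)|} ≤ ε

theorem BddP.mono {f g : ℕ × Ω → ℝ} (hf : BddP μ f) (h : ∀ᶠ q in whp μ, |g q| ≤ |f q|) : BddP μ g := by
  intro ε hε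
  obtain ⟨K, hK⟩ := hf (ε / 2) (ENNReal.half_pos hε.ne')
  refine ⟨K, ?_⟩
  filter_upwards [hK, (eventually_whp.1 h).eventually_le_const (ENNReal.half_pos hε.ne')] with n h1 h2
  refine (measure_mono fun ω (hω : K < |g (n, ω)|) => ?_).trans ((measure_union_le {ω | K < |f (n, ω)|} {ω | ¬ |g (n, ω)| ≤ |f (n, ω)|}).trans
    ((add_le_add h1 h2).trans (ENNReal.add_halves ε).le))
  by_cases hc : |g (n, ω)| ≤ |f (n, ω)|
  · exact Or.inl (hω.trans_le hc)
  · exact Or.inr hc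

theorem BddP.add {f g : ℕ × Ω → ℝ} (hf : BddP μ f) (hg : BddP μ g) : BddP μ fun q => f q + g q := by
  intro ε hε
  obtain ⟨K, hK⟩ := hf (ε / 2) (ENNReal.half_pos hε.ne')
  obtain ⟨K', hK'⟩ := hg (ε / 2) (ENNReal.half_pos hε.ne')
  refine ⟨K + K', ?_⟩
  filter_upwards [hK, hK'] with n h1 h2
  refine (measure_mono fun ω (hω : _ < |f (n, ω) + g (n, ω)|) => ?_).trans ((measure_union_le {ω | K < |f (n, ω)|} {ω | K' < |g (n, ω)|}).trans
    ((add_le_add h1 h2).trans (ENNReal.add_halves ε).le))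
  by_contra hc
  simp only [Set.mem_union, Set.mem_ofPred_eq, not_or, not_lt] at hc
  linarith [abs_add_le (f (n, ω)) (g (n, ω))]

theorem BddP.mul {f g : ℕ × Ω → ℝ} (hf : BddP μ f) (hg : BddP μ g) : BddP μ fun q => f q * g q := by
  intro ε hε
  obtain ⟨K, hK⟩ := hf (ε / 2) (ENNReal.half_pos hε.ne')
  obtain ⟨K', hK'⟩ := hg (ε / 2) (ENNReal.half_pos hε.ne')
  refine ⟨|K| * |K'|, ?_⟩
  filter_upwards [hK, hK'] with n h1 h2
  refine (measure_mono fun ω (hω : _ < |f (n, ω) * g (n, ω)|) => ?_).trans ((measure_union_le {ω | K < |f (n, ω)|} {ω | K' < |g (n, ω)|}).trans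
    ((add_le_add h1 h2).trans (ENNReal.add_halves ε).le))
  by_contra hc
  simp only [Set.mem_union, Set.mem_ofPred_eq, not_or, not_lt] at hc
  rw [abs_mul] at hω
  have := mul_le_mul (hc.1.trans (le_abs_self K)) (hc.2.trans (le_abs_self K')) (abs_nonneg _) (abs_nonneg _)
  linarith

theorem BddP.of_tendsto {f : ℕ × Ω → ℝ} {a : ℝ} (hf : Tendsto f (whp μ) (𝓝 a)) : BddP μ f := by
  intro ε hε
  refine ⟨|a| + 1, ?_⟩
  have h := Metric.tendsto_nhds.1 hf 1 one_pos
  filter_upwards [(eventually_whp.1 h).eventually_le_const hε] with n h1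
  refine (measure_mono fun ω hω => ?_).trans h1
  simp only [Set.mem_ofPred_eq, Real.dist_eq, not_lt] at hω ⊢
  have := abs_add_le (f (n, ω) - a) a
  rw [sub_add_cancel] at this
  linarith

theorem BddP.const (a : ℝ) : BddP μ fun _ => a := BddP.of_tendsto tendsto_const_nhds

theorem BddP.sum {ι : Type*} (s : Finset ι) {f : ι → ℕ × Ω → ℝ} (h : ∀ i ∈ s, BddP μ (f i)) :
    BddP μ fun q => ∑ i ∈ s, f i q := by
  classical
  induction s using Finset.induction_on with
  | empty => simpa using BddP.const 0
  | insert i s hi ih =>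
    simp_rw [Finset.sum_insert hi]
    exact (h i (Finset.mem_insert_self i s)).add (ih fun j hj => h j (Finset.mem_insert_of_mem hj))

theorem BddP.mul_tendsto_zero {f g : ℕ × Ω → ℝ} (hf : BddP μ f) (hg : Tendsto g (whp μ) (𝓝 0)) :
    Tendsto (fun q => f q * g q) (whp μ) (𝓝 0) := by
  refine Metric.tendsto_nhds.2 fun η hη => eventually_whp.2 (ENNReal.tendsto_nhds_zero.2 fun ε hε => ?_)
  obtain ⟨K, hK⟩ := hf (ε / 2) (ENNReal.half_pos hε.ne')
  have h := Metric.tendsto_nhds.1 hg (η / (|K| + 1)) (by positivity)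
  filter_upwards [hK, (eventually_whp.1 h).eventually_le_const (ENNReal.half_pos hε.ne')] with n h1 h2
  refine (measure_mono fun ω hω => ?_).trans ((measure_union_le {ω | K < |f (n, ω)|} {ω | ¬ dist (g (n, ω)) 0 < η / (|K| + 1)}).trans
    ((add_le_add h1 h2).trans (ENNReal.add_halves ε).le))
  by_contra hc
  simp only [Set.mem_union, Set.mem_ofPred_eq, not_or, not_lt, not_le, Real.dist_eq, sub_zero] at hc hω
  have h3 : |f (n, ω)| ≤ |K| + 1 := hc.1.trans (by linarith [le_abs_self K])
  have h4 : |f (n, ω)| * |g (n, ω)| < η := by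
    calc |f (n, ω)| * |g (n, ω)| ≤ (|K| + 1) * |g (n, ω)| := by gcongr
      _ < (|K| + 1) * (η / (|K| + 1)) := by gcongr; exact hc.2
      _ = η := by field_simp
  rw [abs_mul] at hω
  linarith

/-- Bounded means give boundedness in probability. -/
theorem BddP.of_lintegral_le {f : ℕ × Ω → ℝ} (h0 : ∀ q, 0 ≤ f q) (hm : ∀ n, Measurable fun ω => f (n, ω)) {C : ℝ}
    (h : ∀ n, ∫⁻ ω, ENNReal.ofReal (f (n, ω)) ∂μ ≤ ENNReal.ofReal C) : BddP μ f := by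
  intro ε hε
  rcases eq_or_ne ε ⊤ with rfl | hε'
  · exact ⟨0, by simp⟩
  have hpos := ENNReal.toReal_pos hε.ne' hε'
  refine ⟨(|C| + 1) / ε.toReal, Eventually.of_forall fun n => ?_⟩
  have hK : 0 < (|C| + 1) / ε.toReal := by positivity
  refine (measure_mono fun ω hω => ?_).trans ((meas_ge_le_lintegral_div (hm n).ennreal_ofReal.aemeasurable
    (ε := ENNReal.ofReal ((|C| + 1) / ε.toReal)) (by simpa using hK) ENNReal.ofReal_ne_top).trans
    ((ENNReal.div_le_div_right (h n) _).trans ?_))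
  · simp only [Set.mem_ofPred_eq, abs_of_nonneg (h0 _)] at hω
    exact ENNReal.ofReal_le_ofReal hω.le
  · rw [← ENNReal.ofReal_div_of_pos hK]
    refine (ENNReal.ofReal_le_ofReal (?_ : _ ≤ ε.toReal)).trans (ENNReal.ofReal_toReal hε').le
    rw [div_le_iff₀ hK, mul_div_cancel₀ _ hpos.ne']
    linarith [le_abs_self C]

theorem tendsto_zero_of_sq {ι : Type*} {l : Filter ι} {f : ι → ℝ} (h : Tendsto (fun i => f i ^ 2) l (𝓝 0)) : Tendsto f l (𝓝 0) := by
  have h1 := h.sqrt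
  simp only [Real.sqrt_sq_eq_abs, Real.sqrt_zero] at h1
  exact (tendsto_zero_iff_abs_tendsto_zero f).2 h1

/-- An event of probability bounded away from zero meets an event of probability tending to one. -/
theorem exists_of_eventually_whp {P : ℕ × Ω → Prop} (h : ∀ᶠ q in whp μ, P q) {A : ℕ → Set Ω} {ε : ENNReal} (hε : 0 < ε)
    (hA : ∀ n, ε ≤ μ (A n)) : ∀ᶠ n in atTop, ∃ ω ∈ A n, P (n, ω) := by
  filter_upwards [(eventually_whp.1 h).eventually_lt_const hε] with n hn
  by_contra! hc
  exact absurd (measure_mono fun ω hω => hc ω hω) (not_le.2 (hn.trans_le (hA n)))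

end whp

/-! ### Noncentral chi-squared limits -/

section chiSq
variable {k : ℕ}

/-- By the rotation invariance of the standard Gaussian law, the law of `‖x + g‖ ^ 2` depends on `g` only
through its norm. -/
theorem map_stdGaussian_norm_add_sq (g : Vec k) :
    (stdGaussian (Vec k)).map (fun x => ‖x + g‖ ^ 2) = noncentralChiSq k (‖g‖ ^ 2) := by
  set d : Vec k := WithLp.toLp 2 fun _ => √(‖g‖ ^ 2 / k) with hd
  have hnorm : ‖g‖ = ‖d‖ := by
    rcases Nat.eq_zero_or_pos k with h0 | h0
    · subst h0; rw [Subsingleton.elim g d]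
    · have hk : (0 : ℝ) < k := by exact_mod_cast h0
      rw [← sq_eq_sq₀ (norm_nonneg _) (norm_nonneg _), EuclideanSpace.real_norm_sq_eq d]
      simp only [hd, Real.sq_sqrt (show 0 ≤ ‖g‖ ^ 2 / k by positivity), Finset.sum_const, Finset.card_univ,
        Fintype.card_fin, nsmul_eq_mul]
      field_simp
  set f : Vec k ≃ₗᵢ[ℝ] Vec k := (ℝ ∙ (g - d))ᗮ.reflection with hf
  have hfg : f g = d := Submodule.reflection_sub hnorm
  -- the reflection that exchanges `g` and `d` preserves the standard Gaussian law
  have h1 : (fun x : Vec k => ‖x + g‖ ^ 2) = (fun y : Vec k => ‖y + d‖ ^ 2) ∘ f := by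
    funext x
    simp only [Function.comp_apply]
    rw [← hfg, ← map_add, f.norm_map]
  have hm : Measurable fun y : Vec k => ‖y + d‖ ^ 2 := by fun_prop
  rw [h1, ← Measure.map_map hm f.continuous.measurable, stdGaussian_map f, ← map_pi_eq_stdGaussian,
    Measure.map_map hm (by fun_prop), noncentralChiSq]
  have h2 : (Measure.pi fun _ : Fin k => gaussianReal √(‖g‖ ^ 2 / k) 1) =
      (Measure.pi fun _ : Fin k => gaussianReal 0 1).map fun x i => x i + √(‖g‖ ^ 2 / k) := by
    rw [Measure.pi_map_pi (f := fun (_ : Fin k) (t : ℝ) => t + √(‖g‖ ^ 2 / k)) fun _ => by fun_prop]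
    simp_rw [gaussianReal_map_add_const, zero_add]
  rw [h2, Measure.map_map (by fun_prop) (by fun_prop)]
  congr 1
  funext x
  simp [EuclideanSpace.real_norm_sq_eq, hd]

/-- If `Y - T` tends to `g` and `W - ‖Y‖ ^ 2` to zero in probability, and `T` is asymptotically standard Gaussian, then
`W` is asymptotically noncentral chi-squared. This is Slutsky's theorem with the continuous mapping theorem. -/
theorem tendstoInDistribution_norm_sq {Ω : Type*} [MeasurableSpace Ω] {μ : Measure Ω} [IsProbabilityMeasure μ]
    {T : ℕ → Ω → Vec k} (hT : TendstoInDistribution T atTop id (fun _ => μ) (stdGaussian (Vec k)))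
    {Y : ℕ → Ω → Vec k} (hYm : ∀ n, AEMeasurable (Y n) μ) {g : Vec k}
    (hY : ∀ a, Tendsto (fun q : ℕ × Ω => Y q.1 q.2 a - T q.1 q.2 a) (whp μ) (𝓝 (g a)))
    {W : ℕ → Ω → ℝ} (hWm : ∀ n, AEMeasurable (W n) μ)
    (hW : Tendsto (fun q : ℕ × Ω => W q.1 q.2 - ‖Y q.1 q.2‖ ^ 2) (whp μ) (𝓝 0)) :
    TendstoInDistribution W atTop id (fun _ => μ) (noncentralChiSq k (‖g‖ ^ 2)) := by
  have hYT : TendstoInMeasure μ (fun n => Y n - T n) atTop (fun _ => g) := by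
    have h1 : Tendsto (fun q : ℕ × Ω => ‖(Y q.1 q.2 - T q.1 q.2) - g‖ ^ 2) (whp μ) (𝓝 0) := by
      simp_rw [EuclideanSpace.real_norm_sq_eq]
      have : Tendsto (fun q : ℕ × Ω => ∑ a, ((Y q.1 q.2 a - T q.1 q.2 a) - g a) ^ 2) (whp μ) (𝓝 (∑ a : Fin k, (g a - g a) ^ 2)) :=
        tendsto_finsetSum _ fun a _ => ((hY a).sub_const _).pow 2
      simpa using this
    have h2 := tendsto_zero_of_sq h1
    have h3 := tendstoInMeasure_iff_tendsto_whp (μ := μ) (f := fun n ω => ‖(Y n ω - T n ω) - g‖) (a := 0) |>.2 h2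
    rw [tendstoInMeasure_iff_norm] at h3 ⊢
    simpa using h3
  have h1 := hT.add_of_tendstoInMeasure_const hYT fun n => (hYm n).sub (hT.forall_aemeasurable n)
  have h2 : TendstoInDistribution Y atTop (fun x => id x + g) (fun _ => μ) (stdGaussian (Vec k)) :=
    h1.congr (fun n => ae_of_all _ fun ω => by simp) (EventuallyEq.refl _ _)
  have h3 := h2.continuous_comp (g := fun x : Vec k => ‖x‖ ^ 2) (by fun_prop)
  have h4 := tendstoInDistribution_of_tendstoInMeasure_sub W _ h3 (by
    exact tendstoInMeasure_iff_tendsto_whp.2 hW) hWm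
  refine ⟨hWm, aemeasurable_id, ?_⟩
  have h5 := h4.tendsto
  have e : (⟨(stdGaussian (Vec k)).map ((fun x : Vec k => ‖x‖ ^ 2) ∘ fun x => id x + g),
      Measure.isProbabilityMeasure_map h4.aemeasurable_limit⟩ : ProbabilityMeasure ℝ) =
      ⟨(noncentralChiSq k (‖g‖ ^ 2)).map id, Measure.isProbabilityMeasure_map aemeasurable_id⟩ := by
    refine Subtype.ext ?_
    change (stdGaussian (Vec k)).map (fun x => ‖x + g‖ ^ 2) = (noncentralChiSq k (‖g‖ ^ 2)).map id
    rw [Measure.map_id, map_stdGaussian_norm_add_sq]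
  rw [e] at h5
  exact h5

end chiSq

/-! ### The Wald statistic as a quadratic form in the score -/

section waldForm
variable {n k p : ℕ}

/-- The Wald statistic as a function of the demeaned regressors `Y` and the demeaned residuals `d`. -/
noncomputable def waldForm (Y : Matrix (Fin n) (Fin k) ℝ) (d : Fin n → ℝ) : ℝ :=
  (Yᵀ *ᵥ d) ⬝ᵥ (symmInv (Matrix.of fun a b => ∑ i, (Y i a * d i) * (Y i b * d i)) *ᵥ (Yᵀ *ᵥ d))

theorem gForm_eq_waldForm (x : Fin n → Vec k) (z : Fin n → Vec p) (v : Fin n → ℝ) :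
    gForm x z v = waldForm (Xtilde x z) (demean z *ᵥ v) := by
  have h1 : (Xtilde x z)ᵀ *ᵥ v = (Xtilde x z)ᵀ *ᵥ (demean z *ᵥ v) := by
    ext a
    rw [transpose_Xtilde_mulVec]
    simp only [Matrix.mulVec, dotProduct, Matrix.transpose_apply]
  have h2 : (Xtilde x z)ᵀ * sigmaMat z v * Xtilde x z = Matrix.of fun a b =>
      ∑ i, (Xtilde x z i a * (demean z *ᵥ v) i) * (Xtilde x z i b * (demean z *ᵥ v) i) := by
    ext a b; rw [middle_apply]; rfl
  rw [gForm, waldForm, h1, h2]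

/-- The Wald statistic depends on the data through the demeaned regressors and the demeaned residuals only. -/
theorem wald_eq_waldForm (x : Fin n → Vec k) (z : Fin n → Vec p) (u y : Fin n → ℝ) (β β₀ : Vec k) (γ : Vec p)
    (hy : ∀ i, y i = inner ℝ (x i) β + inner ℝ (z i) γ + u i) :
    wald x z y β₀ = waldForm (Xtilde x z) fun i => ∑ b, Xtilde x z i b * (β - β₀) b + (u i - sMean z u i) := by
  rw [wald, gForm_eq_waldForm]
  congr 1
  funext i
  rw [← demean_model x z u (β - β₀) γ i]
  congr 2
  funext i
  rw [hy, inner_sub_right]; ring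

/-- The moment matrix of the score contributions, scaled by the sample size. -/
noncomputable def scoreGram (Y : Matrix (Fin n) (Fin k) ℝ) (d : Fin n → ℝ) : Matrix (Fin k) (Fin k) ℝ :=
  Matrix.of fun a b => (n : ℝ)⁻¹ * ∑ i, (Y i a * d i) * (Y i b * d i)

theorem isHermitian_scoreGram (Y : Matrix (Fin n) (Fin k) ℝ) (d : Fin n → ℝ) : (scoreGram Y d).IsHermitian := by
  ext a b
  simp only [scoreGram, Matrix.conjTranspose_apply, Matrix.of_apply, star_trivial, mul_comm (Y _ a * d _)]

/-- The score `n ^ (-1 / 2) Y' d`. -/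
noncomputable def score (Y : Matrix (Fin n) (Fin k) ℝ) (d : Fin n → ℝ) (a : Fin k) : ℝ := (√(n : ℝ))⁻¹ * ∑ i, Y i a * d i

theorem waldForm_eq (hn : 0 < n) (Y : Matrix (Fin n) (Fin k) ℝ) (d : Fin n → ℝ) :
    waldForm Y d = score Y d ⬝ᵥ (symmInv (scoreGram Y d) *ᵥ score Y d) := by
  have hn' : (0 : ℝ) < n := by exact_mod_cast hn
  have h1 : score Y d = (√(n : ℝ))⁻¹ • (Yᵀ *ᵥ d) := by
    ext a; simp [score, Matrix.mulVec, dotProduct]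
  have h2 : (Matrix.of fun a b => ∑ i, (Y i a * d i) * (Y i b * d i)) = (n : ℝ) • scoreGram Y d := by
    ext a b
    simp only [scoreGram, Matrix.of_apply, Matrix.smul_apply, smul_eq_mul, mul_inv_cancel_left₀ hn'.ne']
  rw [waldForm, h2, symmInv_smul (isHermitian_scoreGram Y d), h1]
  simp only [Matrix.smul_mulVec, Matrix.mulVec_smul, dotProduct_smul, smul_dotProduct, smul_eq_mul]
  rw [← mul_assoc, ← mul_inv, Real.mul_self_sqrt hn'.le]

/-- A lower bound for the Wald statistic by the length of the score, valid also if the estimated variance is singular. -/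
theorem waldForm_nonneg_and_le (Y : Matrix (Fin n) (Fin k) ℝ) (d : Fin n → ℝ) :
    0 ≤ waldForm Y d ∧ score Y d ⬝ᵥ score Y d ≤ (scoreGram Y d).trace * waldForm Y d := by
  have h := form_symmInv_gram (Matrix.of fun i a => Y i a * d i) fun _ => (1 : ℝ)
  have e1 : (Matrix.of fun i a => Y i a * d i)ᵀ *ᵥ (fun _ => (1 : ℝ)) = Yᵀ *ᵥ d := by
    ext a; simp [Matrix.mulVec, dotProduct]
  have e2 : (Matrix.of fun i a => Y i a * d i)ᵀ * (Matrix.of fun i a => Y i a * d i) =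
      Matrix.of fun a b => ∑ i, (Y i a * d i) * (Y i b * d i) := by
    ext a b; simp [Matrix.mul_apply]
  rw [e1, e2] at h
  refine ⟨h.1, ?_⟩
  rcases Nat.eq_zero_or_pos n with h0 | h0
  · subst h0; simp [score, scoreGram, dotProduct, Matrix.trace]
  have hn' : (0 : ℝ) < n := by exact_mod_cast h0
  have h1 : score Y d = (√(n : ℝ))⁻¹ • (Yᵀ *ᵥ d) := by
    ext a; simp [score, Matrix.mulVec, dotProduct]
  have h2 : scoreGram Y d = (n : ℝ)⁻¹ • (Matrix.of fun a b => ∑ i, (Y i a * d i) * (Y i b * d i)) := by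
    ext a b
    simp only [scoreGram, Matrix.of_apply, Matrix.smul_apply, smul_eq_mul]
  rw [h1, h2, Matrix.trace_smul]
  simp only [dotProduct_smul, smul_dotProduct, smul_eq_mul]
  rw [← mul_assoc, ← mul_inv, Real.mul_self_sqrt hn'.le, mul_assoc]
  exact mul_le_mul_of_nonneg_left h.2 (by positivity)

end waldForm

/-! ### Sample averages -/

section averages

/-- The average over the sample. -/
noncomputable def avg {n : ℕ} (f : Fin n → ℝ) : ℝ := (n : ℝ)⁻¹ * ∑ i, f i

variable {n : ℕ}

theorem avg_nonneg {f : Fin n → ℝ} (h : ∀ i, 0 ≤ f i) : 0 ≤ avg f :=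
  mul_nonneg (by positivity) (Finset.sum_nonneg fun i _ => h i)

theorem avg_mono {f g : Fin n → ℝ} (h : ∀ i, f i ≤ g i) : avg f ≤ avg g :=
  mul_le_mul_of_nonneg_left (Finset.sum_le_sum fun i _ => h i) (by positivity)

theorem avg_add (f g : Fin n → ℝ) : avg (fun i => f i + g i) = avg f + avg g := by
  simp only [avg, Finset.sum_add_distrib, mul_add]

theorem avg_neg (f : Fin n → ℝ) : avg (fun i => -f i) = -avg f := by
  simp only [avg, Finset.sum_neg_distrib, mul_neg]

theorem avg_const_mul (c : ℝ) (f : Fin n → ℝ) : avg (fun i => c * f i) = c * avg f := by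
  simp only [avg, ← Finset.mul_sum]; ring

theorem avg_sum {ι : Type*} (s : Finset ι) (f : ι → Fin n → ℝ) : avg (fun i => ∑ b ∈ s, f b i) = ∑ b ∈ s, avg (f b) := by
  simp only [avg, ← Finset.mul_sum]
  rw [Finset.sum_comm]

theorem avg_mul_sq_le (f g : Fin n → ℝ) : avg (fun i => f i * g i) ^ 2 ≤ avg (fun i => f i ^ 2) * avg (fun i => g i ^ 2) := by
  have h := Finset.sum_mul_sq_le_sq_mul_sq Finset.univ f g
  have h2 : (0 : ℝ) ≤ ((n : ℝ)⁻¹) ^ 2 := by positivity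
  simp only [avg]
  nlinarith [mul_le_mul_of_nonneg_left h h2]

theorem sum_mul_sq_le_sq {k n : ℕ} (y : Matrix (Fin n) (Fin k) ℝ) (δ : Fin k → ℝ) (a : Fin k) (i : Fin n) :
    (y i a * ∑ b, y i b * δ b) ^ 2 ≤ (δ ⬝ᵥ δ) * (k * ∑ b, y i b ^ 4 + y i a ^ 4) := by
  have h1 : (∑ b, y i b * δ b) ^ 2 ≤ (∑ b, y i b ^ 2) * (δ ⬝ᵥ δ) := by
    have := Finset.sum_mul_sq_le_sq_mul_sq Finset.univ (fun b => y i b) δ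
    simpa [dotProduct, sq] using this
  have h2 : (∑ b, y i b ^ 2) ^ 2 ≤ k * ∑ b, y i b ^ 4 := by
    have := sq_sum_le_card_mul_sum_sq (s := (Finset.univ : Finset (Fin k))) (f := fun b => y i b ^ 2)
    simpa [← pow_mul] using this
  have h0 : 0 ≤ δ ⬝ᵥ δ := dotProduct_self_nonneg' δ
  have hs : 0 ≤ ∑ b, y i b ^ 2 := Finset.sum_nonneg fun _ _ => sq_nonneg _
  calc (y i a * ∑ b, y i b * δ b) ^ 2 = y i a ^ 2 * (∑ b, y i b * δ b) ^ 2 := by ring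
    _ ≤ y i a ^ 2 * ((∑ b, y i b ^ 2) * (δ ⬝ᵥ δ)) := by gcongr
    _ = (δ ⬝ᵥ δ) * (y i a ^ 2 * ∑ b, y i b ^ 2) := by ring
    _ ≤ (δ ⬝ᵥ δ) * ((∑ b, y i b ^ 2) ^ 2 + y i a ^ 4) := by
        gcongr
        nlinarith [sq_nonneg (y i a ^ 2 - ∑ b, y i b ^ 2), sq_nonneg (y i a ^ 2), sq_nonneg (∑ b, y i b ^ 2)]
    _ ≤ _ := by gcongr

theorem avg_sum_mul_sq_le {k n : ℕ} (y : Matrix (Fin n) (Fin k) ℝ) (δ : Fin k → ℝ) (a : Fin k) :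
    avg (fun i => (y i a * ∑ b, y i b * δ b) ^ 2) ≤ (δ ⬝ᵥ δ) * ((k + 1) * ∑ b, avg fun i => y i b ^ 4) := by
  have h1 : ∀ i, (y i a * ∑ b, y i b * δ b) ^ 2 ≤ ((δ ⬝ᵥ δ) * (k + 1)) * ∑ b, y i b ^ 4 := fun i => by
    refine (sum_mul_sq_le_sq y δ a i).trans ?_
    rw [mul_assoc]
    refine mul_le_mul_of_nonneg_left ?_ (dotProduct_self_nonneg' δ)
    have := Finset.single_le_sum (f := fun b => y i b ^ 4) (fun b _ => by positivity) (Finset.mem_univ a)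
    linarith
  refine (avg_mono h1).trans (le_of_eq ?_)
  rw [avg_const_mul, avg_sum, mul_assoc]

end averages

section stable
variable {Ω : Type*} [MeasurableSpace Ω] {μ : Measure Ω}

/-- If averages of `(p - q) ^ 2` vanish in probability, averages of products of the `p` and of the `q` have the
same limit. -/
theorem tendsto_avg_mul_sub {p₁ p₂ q₁ q₂ : (n : ℕ) → Fin n → Ω → ℝ}
    (h₁ : Tendsto (fun x : ℕ × Ω => avg fun i => (p₁ x.1 i x.2 - q₁ x.1 i x.2) ^ 2) (whp μ) (𝓝 0))
    (h₂ : Tendsto (fun x : ℕ × Ω => avg fun i => (p₂ x.1 i x.2 - q₂ x.1 i x.2) ^ 2) (whp μ) (𝓝 0))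
    (b₁ : BddP μ fun x => avg fun i => q₁ x.1 i x.2 ^ 2) (b₂ : BddP μ fun x => avg fun i => q₂ x.1 i x.2 ^ 2) :
    Tendsto (fun x : ℕ × Ω => (avg fun i => p₁ x.1 i x.2 * p₂ x.1 i x.2) - avg fun i => q₁ x.1 i x.2 * q₂ x.1 i x.2)
      (whp μ) (𝓝 0) := by
  have key : ∀ {f g : (n : ℕ) → Fin n → Ω → ℝ}, Tendsto (fun x : ℕ × Ω => avg fun i => f x.1 i x.2 ^ 2) (whp μ) (𝓝 0) →
      (BddP μ fun x => avg fun i => g x.1 i x.2 ^ 2) →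
      Tendsto (fun x : ℕ × Ω => avg fun i => f x.1 i x.2 * g x.1 i x.2) (whp μ) (𝓝 0) := by
    intro f g hf hg
    refine tendsto_zero_of_sq (squeeze_zero (fun _ => sq_nonneg _) (fun x => avg_mul_sq_le _ _) ?_)
    refine (hg.mul_tendsto_zero hf).congr fun x => mul_comm _ _
  have k1 := key (f := fun n i ω => p₁ n i ω - q₁ n i ω) (g := fun n i ω => p₂ n i ω - q₂ n i ω) h₁ (BddP.of_tendsto h₂)
  have k2 := key (f := fun n i ω => p₁ n i ω - q₁ n i ω) (g := q₂) h₁ b₂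
  have k3 := key (f := fun n i ω => p₂ n i ω - q₂ n i ω) (g := q₁) h₂ b₁
  have := (k1.add k2).add k3
  simp only [add_zero] at this
  refine this.congr fun x => ?_
  rw [eq_sub_iff_add_eq, ← avg_add, ← avg_add, ← avg_add]
  congr 1; funext i; ring

end stable

/-! ### Local alternatives -/

theorem measurable_waldForm {Ω : Type*} [MeasurableSpace Ω] {n k : ℕ} {Y : Ω → Matrix (Fin n) (Fin k) ℝ} {d : Ω → Fin n → ℝ}
    (hY : ∀ i a, Measurable fun ω => Y ω i a) (hd : ∀ i, Measurable fun ω => d ω i) :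
    Measurable fun ω => waldForm (Y ω) (d ω) := by
  have h1 : ∀ a, Measurable fun ω => ((Y ω)ᵀ *ᵥ d ω) a := fun a => by
    change Measurable fun ω => ∑ i, Y ω i a * d ω i
    exact Finset.measurable_fun_sum _ fun i _ => (hY i a).mul (hd i)
  have h2 : ∀ a b, Measurable fun ω => symmInv (Matrix.of fun a b => ∑ i, (Y ω i a * d ω i) * (Y ω i b * d ω i)) a b := by
    refine measurable_symmInv_apply (fun ω => ?_) fun a b => ?_
    · ext a b
      simp only [Matrix.conjTranspose_apply, Matrix.of_apply, star_trivial, mul_comm (Y ω _ a * d ω _)]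
    · change Measurable fun ω => ∑ i, (Y ω i a * d ω i) * (Y ω i b * d ω i)
      exact Finset.measurable_fun_sum _ fun i _ => ((hY i a).mul (hd i)).mul ((hY i b).mul (hd i))
  change Measurable fun ω => ∑ a, ((Y ω)ᵀ *ᵥ d ω) a * ∑ b, symmInv (Matrix.of fun a b => ∑ i, (Y ω i a * d ω i) *
    (Y ω i b * d ω i)) a b * ((Y ω)ᵀ *ᵥ d ω) b
  exact Finset.measurable_fun_sum _ fun a _ => (h1 a).mul (Finset.measurable_fun_sum _ fun b _ => (h2 a b).mul (h1 b))

/-- The limit facts on which the asymptotics of the Wald statistic rest. `Y` are the demeaned regressors, split into their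
deviations `α` from the stratum averages of the conditional means and the errors `e` of the stratum means; `u` are the
errors and `r` their stratum means; `Om` and `Γ` approximate the variance of the score and the regressor moment matrix. -/
structure WaldLimits {Ω : Type*} [MeasurableSpace Ω] (μ : Measure Ω) [IsProbabilityMeasure μ] {k : ℕ}
    (Y : (n : ℕ) → Ω → Matrix (Fin n) (Fin k) ℝ) (α e : (n : ℕ) → Fin n → Fin k → Ω → ℝ) (u r : (n : ℕ) → Fin n → Ω → ℝ)
    (Om : ℕ → Ω → Matrix (Fin k) (Fin k) ℝ) (Γ : ℕ → Matrix (Fin k) (Fin k) ℝ) (lam : ℝ) : Prop where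
  measurable_Y : ∀ n i a, Measurable fun ω => Y n ω i a
  measurable_u : ∀ n i, Measurable (u n i)
  measurable_r : ∀ n i, Measurable (r n i)
  measurable_Om : ∀ n a b, Measurable fun ω => Om n ω a b
  split : ∀ n i a ω, Y n ω i a = α n i a ω - e n i a ω
  sum_split : ∀ n a ω, ∑ i, Y n ω i a * (u n i ω - r n i ω) = ∑ i, α n i a ω * u n i ω - ∑ i, e n i a ω * r n i ω
  dev_mean : ∀ a, Tendsto (fun x : ℕ × Ω => avg fun i => (α x.1 i a x.2 * r x.1 i x.2) ^ 2) (whp μ) (𝓝 0)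
  err_u : ∀ a, Tendsto (fun x : ℕ × Ω => avg fun i => (u x.1 i x.2 * e x.1 i a x.2) ^ 2) (whp μ) (𝓝 0)
  err_mean : ∀ a, Tendsto (fun x : ℕ × Ω => avg fun i => (e x.1 i a x.2 * r x.1 i x.2) ^ 2) (whp μ) (𝓝 0)
  remainder : ∀ a, Tendsto (fun x : ℕ × Ω => (x.1 : ℝ)⁻¹ * (∑ i, e x.1 i a x.2 * r x.1 i x.2) ^ 2) (whp μ) (𝓝 0)
  score_gram : ∀ a b, Tendsto (fun x : ℕ × Ω => (avg fun i => α x.1 i a x.2 * α x.1 i b x.2 * u x.1 i x.2 ^ 2) -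
    Om x.1 x.2 a b) (whp μ) (𝓝 0)
  gram : ∀ a b, Tendsto (fun x : ℕ × Ω => (avg fun i => Y x.1 x.2 i a * Y x.1 x.2 i b) - Γ x.1 a b) (whp μ) (𝓝 0)
  fourth : ∀ a, BddP μ fun x => avg fun i => Y x.1 x.2 i a ^ 4
  fourth_u : BddP μ fun x => avg fun i => (u x.1 i x.2 - r x.1 i x.2) ^ 4
  score_bdd : ∀ a, BddP μ fun x => (√(x.1 : ℝ))⁻¹ * ∑ i, α x.1 i a x.2 * u x.1 i x.2
  om_bdd : ∀ a, BddP μ fun x => Om x.1 x.2 a a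
  om_herm : ∀ n ω, (Om n ω).IsHermitian
  lam_pos : 0 < lam
  om_ge : ∀ᶠ x in whp μ, ∀ v : Fin k → ℝ, lam * (v ⬝ᵥ v) ≤ v ⬝ᵥ (Om x.1 x.2 *ᵥ v)
  clt : TendstoInDistribution (fun n ω => (WithLp.toLp 2
    (invSqrt (Om n ω) *ᵥ fun a => (√(n : ℝ))⁻¹ * ∑ i, α n i a ω * u n i ω) : Vec k)) atTop id (fun _ => μ) (stdGaussian (Vec k))

section abstract
variable {Ω : Type*} [MeasurableSpace Ω] {μ : Measure Ω} [IsProbabilityMeasure μ] {k : ℕ}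
    {Y : (n : ℕ) → Ω → Matrix (Fin n) (Fin k) ℝ} {α e : (n : ℕ) → Fin n → Fin k → Ω → ℝ} {u r : (n : ℕ) → Fin n → Ω → ℝ}
    {Om : ℕ → Ω → Matrix (Fin k) (Fin k) ℝ} {Γ : ℕ → Matrix (Fin k) (Fin k) ℝ} {lam : ℝ}
    (H : WaldLimits μ Y α e u r Om Γ lam)
include H

theorem WaldLimits.fourth_sum : BddP μ fun x => ∑ a, avg fun i => Y x.1 x.2 i a ^ 4 :=
  BddP.sum _ fun a _ => H.fourth a

theorem WaldLimits.bdd_dev_u (a : Fin k) : BddP μ fun x => avg fun i => (α x.1 i a x.2 * u x.1 i x.2) ^ 2 := by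
  have h := (BddP.of_tendsto (H.score_gram a a)).add (H.om_bdd a)
  refine h.mono (Eventually.of_forall fun x => le_of_eq ?_)
  rw [sub_add_cancel]
  congr 2; funext i; ring

omit H in
theorem avg_le_one (n : ℕ) : avg (fun _ : Fin n => (1 : ℝ)) ≤ 1 := by
  rcases Nat.eq_zero_or_pos n with h | h
  · subst h; simp [avg]
  · have : (0 : ℝ) < n := by exact_mod_cast h
    simp [avg, this.ne']

theorem WaldLimits.bdd_gram (a b : Fin k) : BddP μ fun x => avg fun i => Y x.1 x.2 i a * Y x.1 x.2 i b := by
  refine (((BddP.const 1).add (H.fourth a)).add (H.fourth b)).mono (Eventually.of_forall fun x => ?_)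
  have h4 : ∀ a, 0 ≤ avg fun i => Y x.1 x.2 i a ^ 4 := fun a => avg_nonneg fun i => by positivity
  rw [abs_of_nonneg (a := 1 + _ + _) (by linarith [h4 a, h4 b])]
  have h : avg (fun i => (1 + Y x.1 x.2 i a ^ 4) + Y x.1 x.2 i b ^ 4) ≤ 1 + (avg fun i => Y x.1 x.2 i a ^ 4) + avg fun i => Y x.1 x.2 i b ^ 4 := by
    rw [avg_add, avg_add]; linarith [avg_le_one x.1]
  refine le_trans ?_ h
  have hp : ∀ s t : ℝ, |s * t| ≤ 1 + s ^ 4 + t ^ 4 := fun s t => by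
    rw [abs_le]
    constructor <;> nlinarith [sq_nonneg (s + t), sq_nonneg (s - t), sq_nonneg (s ^ 2 - 1), sq_nonneg (t ^ 2 - 1)]
  rw [abs_le]
  constructor
  · have := avg_mono fun i => (abs_le.1 (hp (Y x.1 x.2 i a) (Y x.1 x.2 i b))).1
    rwa [avg_neg] at this
  · exact avg_mono fun i => (abs_le.1 (hp (Y x.1 x.2 i a) (Y x.1 x.2 i b))).2

/-- The demeaned residuals at the hypothesized value when the true one differs from it by `δ`: `u` are the errors and `r`
their stratum means. -/
noncomputable def resid {n k : ℕ} (y : Matrix (Fin n) (Fin k) ℝ) (δ : Fin k → ℝ) (u r : Fin n → ℝ) (i : Fin n) : ℝ :=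
  ∑ b, y i b * δ b + (u i - r i)

/-- Consistency of the estimated variance of the score along alternatives that approach the null hypothesis. -/
theorem WaldLimits.tendsto_scoreGram {δ : ℕ → Fin k → ℝ} (hδ : Tendsto (fun n => δ n ⬝ᵥ δ n) atTop (𝓝 0)) (a b : Fin k) :
    Tendsto (fun x : ℕ × Ω => scoreGram (Y x.1 x.2) (resid (Y x.1 x.2) (δ x.1) (fun i => u x.1 i x.2) fun i => r x.1 i x.2) a b -
      Om x.1 x.2 a b) (whp μ) (𝓝 0) := by
  set p : Fin k → (n : ℕ) → Fin n → Ω → ℝ := fun a n i ω => Y n ω i a * resid (Y n ω) (δ n) (fun i => u n i ω) (fun i => r n i ω) i with hp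
  set q : Fin k → (n : ℕ) → Fin n → Ω → ℝ := fun a n i ω => α n i a ω * u n i ω with hq
  have hd : ∀ a, Tendsto (fun x : ℕ × Ω => avg fun i => (p a x.1 i x.2 - q a x.1 i x.2) ^ 2) (whp μ) (𝓝 0) := by
    intro a
    have h1 : Tendsto (fun x : ℕ × Ω => avg fun i => (Y x.1 x.2 i a * ∑ b, Y x.1 x.2 i b * δ x.1 b) ^ 2) (whp μ) (𝓝 0) := by
      refine squeeze_zero (fun x => avg_nonneg fun i => sq_nonneg _) (fun x => avg_sum_mul_sq_le _ _ a) ?_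
      refine (((BddP.const ((k : ℝ) + 1)).mul H.fourth_sum).mul_tendsto_zero (hδ.comp tendsto_fst_whp)).congr fun x => ?_
      exact mul_comm _ _
    have h2 := (((h1.add (H.dev_mean a)).add (H.err_u a)).add (H.err_mean a)).const_mul 4
    simp only [add_zero, mul_zero] at h2
    refine squeeze_zero (fun x => avg_nonneg fun i => sq_nonneg _) (fun x => ?_) h2
    rw [← avg_add, ← avg_add, ← avg_add, ← avg_const_mul]
    refine avg_mono fun i => ?_
    -- the square of a sum of four terms is at most four times the sum of their squares
    have e1 : p a x.1 i x.2 - q a x.1 i x.2 = Y x.1 x.2 i a * ∑ b, Y x.1 x.2 i b * δ x.1 b - α x.1 i a x.2 * r x.1 i x.2 -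
        u x.1 i x.2 * e x.1 i a x.2 + e x.1 i a x.2 * r x.1 i x.2 := by
      simp only [hp, hq, resid, H.split x.1 i a x.2]; ring
    rw [e1]
    set A := Y x.1 x.2 i a * ∑ b, Y x.1 x.2 i b * δ x.1 b
    set B := α x.1 i a x.2 * r x.1 i x.2
    set C := u x.1 i x.2 * e x.1 i a x.2
    set D := e x.1 i a x.2 * r x.1 i x.2
    nlinarith [sq_nonneg (A + B), sq_nonneg (A + C), sq_nonneg (A - D), sq_nonneg (B - C), sq_nonneg (B + D), sq_nonneg (C + D)]
  have h := (tendsto_avg_mul_sub (hd a) (hd b) (H.bdd_dev_u a) (H.bdd_dev_u b)).add (H.score_gram a b)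
  simp only [add_zero] at h
  refine h.congr fun x => ?_
  have e1 : (avg fun i => q a x.1 i x.2 * q b x.1 i x.2) = avg fun i => α x.1 i a x.2 * α x.1 i b x.2 * u x.1 i x.2 ^ 2 := by
    congr 1; funext i; simp only [hq]; ring
  rw [e1, sub_add_sub_cancel]
  rfl

/-- The score is the regressor moment matrix applied to `√n δ`, plus the leading sum, minus a remainder. -/
theorem WaldLimits.score_resid (n : ℕ) (ω : Ω) (δ : Fin k → ℝ) (a : Fin k) :
    score (Y n ω) (resid (Y n ω) δ (fun i => u n i ω) fun i => r n i ω) a =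
      ∑ b, (avg fun i => Y n ω i a * Y n ω i b) * (√(n : ℝ) * δ b) + (√(n : ℝ))⁻¹ * ∑ i, α n i a ω * u n i ω -
        (√(n : ℝ))⁻¹ * ∑ i, e n i a ω * r n i ω := by
  have h1 : ∑ b, (avg fun i => Y n ω i a * Y n ω i b) * (√(n : ℝ) * δ b) =
      (√(n : ℝ))⁻¹ * ∑ i, Y n ω i a * ∑ b, Y n ω i b * δ b := by
    simp_rw [avg, Finset.mul_sum, Finset.sum_mul]
    rw [Finset.sum_comm]
    refine Finset.sum_congr rfl fun i _ => Finset.sum_congr rfl fun b _ => ?_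
    rw [← Real.sqrt_div_self]; ring
  rw [h1, add_sub_assoc, ← mul_sub, ← H.sum_split n a ω, ← mul_add, ← Finset.sum_add_distrib, score]
  congr 1
  exact Finset.sum_congr rfl fun i _ => by rw [resid]; ring

theorem WaldLimits.tendsto_remainder (a : Fin k) :
    Tendsto (fun x : ℕ × Ω => (√(x.1 : ℝ))⁻¹ * ∑ i, e x.1 i a x.2 * r x.1 i x.2) (whp μ) (𝓝 0) := by
  refine tendsto_zero_of_sq ((H.remainder a).congr fun x => ?_)
  rw [mul_pow, inv_pow, Real.sq_sqrt (by positivity)]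

/-- Along local alternatives the score is `Γ h` plus its leading term up to a vanishing remainder, and the estimated
variance may be replaced by `Om`, so that the Wald statistic is asymptotically the squared length of a Gaussian vector
with mean `lim Om ^ (-1 / 2) Γ h`. -/
theorem WaldLimits.tendstoInDistribution {δ : ℕ → Fin k → ℝ} {h : Fin k → ℝ} (hδ : ∀ n : ℕ, 1 ≤ n → δ n = (√(n : ℝ))⁻¹ • h)
    {g : Vec k} (hg : ∀ a, Tendsto (fun x : ℕ × Ω => (invSqrt (Om x.1 x.2) *ᵥ (Γ x.1 *ᵥ h)) a) (whp μ) (𝓝 (g a))) :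
    TendstoInDistribution (fun n ω => waldForm (Y n ω) (resid (Y n ω) (δ n) (fun i => u n i ω) fun i => r n i ω)) atTop id
      (fun _ => μ) (noncentralChiSq k (‖g‖ ^ 2)) := by
  have hdm : ∀ n i, Measurable fun ω => resid (Y n ω) (δ n) (fun i => u n i ω) (fun i => r n i ω) i := fun n i =>
    (Finset.measurable_fun_sum _ fun b _ => (H.measurable_Y n i b).mul_const _).add ((H.measurable_u n i).sub (H.measurable_r n i))
  set S : ℕ → Ω → Fin k → ℝ := fun n ω => score (Y n ω) (resid (Y n ω) (δ n) (fun i => u n i ω) fun i => r n i ω) with hS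
  set V : ℕ → Ω → Matrix (Fin k) (Fin k) ℝ := fun n ω => scoreGram (Y n ω) (resid (Y n ω) (δ n) (fun i => u n i ω) fun i => r n i ω) with hV
  set N : ℕ → Ω → Fin k → ℝ := fun n ω a => (√(n : ℝ))⁻¹ * ∑ i, α n i a ω * u n i ω with hN
  set R : ℕ → Ω → Fin k → ℝ := fun n ω a => (√(n : ℝ))⁻¹ * ∑ i, e n i a ω * r n i ω with hR
  have hpos : ∀ᶠ x : ℕ × Ω in whp μ, 1 ≤ x.1 := tendsto_fst_whp.eventually_ge_atTop 1
  have hδ0 : Tendsto (fun n => δ n ⬝ᵥ δ n) atTop (𝓝 0) := by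
    have h1 : Tendsto (fun n : ℕ => ((n : ℝ))⁻¹ * (h ⬝ᵥ h)) atTop (𝓝 0) := by
      simpa using tendsto_inv_atTop_nhds_zero_nat (𝕜 := ℝ) |>.mul_const (h ⬝ᵥ h)
    refine h1.congr' ?_
    filter_upwards [eventually_ge_atTop 1] with n hn
    rw [hδ n hn, smul_dotProduct, dotProduct_smul, smul_eq_mul, smul_eq_mul, ← mul_assoc, ← mul_inv,
      Real.mul_self_sqrt (by positivity)]
  -- the score is the regressor moment matrix times `h`, plus the leading term, up to a remainder
  have hSeq : ∀ x : ℕ × Ω, 1 ≤ x.1 → ∀ a, S x.1 x.2 a = ∑ b, (avg fun i => Y x.1 x.2 i a * Y x.1 x.2 i b) * h b + N x.1 x.2 a - R x.1 x.2 a := by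
    intro x hx a
    simp only [hS]
    rw [H.score_resid, hδ x.1 hx]
    have hs : √(x.1 : ℝ) ≠ 0 := by
      have : (0 : ℝ) < x.1 := by exact_mod_cast hx
      positivity
    simp only [Pi.smul_apply, smul_eq_mul, mul_inv_cancel_left₀ hs, hN, hR]
  have hSb : ∀ a, BddP μ fun x => S x.1 x.2 a := by
    intro a
    have h1 : BddP μ fun x => ∑ b, (avg fun i => Y x.1 x.2 i a * Y x.1 x.2 i b) * h b :=
      BddP.sum _ fun b _ => (H.bdd_gram a b).mul (BddP.const (h b))
    have h2 := (h1.add (H.score_bdd a)).add (BddP.of_tendsto (H.tendsto_remainder a).neg)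
    refine h2.mono ?_
    filter_upwards [hpos] with x hx
    rw [hSeq x hx a, sub_eq_add_neg]
  have hSS : BddP μ fun x => S x.1 x.2 ⬝ᵥ S x.1 x.2 := BddP.sum _ fun a _ => (hSb a).mul (hSb a)
  have hVO : Tendsto (fun x : ℕ × Ω => entrySum (V x.1 x.2 - Om x.1 x.2)) (whp μ) (𝓝 0) := by
    have : Tendsto (fun x : ℕ × Ω => ∑ a, ∑ b, |V x.1 x.2 a b - Om x.1 x.2 a b|) (whp μ) (𝓝 (∑ _a : Fin k, ∑ _b : Fin k, |(0 : ℝ)|)) :=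
      tendsto_finsetSum _ fun a _ => tendsto_finsetSum _ fun b _ => (H.tendsto_scoreGram hδ0 a b).abs
    simpa [entrySum] using this
  have hAm : ∀ n a b, Measurable fun ω => invSqrt (Om n ω) a b := fun n =>
    measurable_invSqrt_apply (H.om_herm n) (H.measurable_Om n)
  refine tendstoInDistribution_norm_sq H.clt (Y := fun n ω => WithLp.toLp 2 (invSqrt (Om n ω) *ᵥ S n ω)) (fun n => ?_) (fun a => ?_)
    (fun n => (measurable_waldForm (H.measurable_Y n) (hdm n)).aemeasurable) ?_
  · refine Measurable.aemeasurable ?_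
    refine (WithLp.measurable_toLp 2 _).comp (measurable_pi_lambda _ fun a => ?_)
    change Measurable fun ω => ∑ b, invSqrt (Om n ω) a b * ((√(n : ℝ))⁻¹ * ∑ i, Y n ω i b *
      resid (Y n ω) (δ n) (fun i => u n i ω) (fun i => r n i ω) i)
    exact Finset.measurable_fun_sum _ fun b _ => (hAm n a b).mul
      ((Finset.measurable_fun_sum _ fun i _ => (H.measurable_Y n i b).mul (hdm n i)).const_mul _)
  · set w : ℕ × Ω → Fin k → ℝ := fun x a => ∑ b, ((avg fun i => Y x.1 x.2 i a * Y x.1 x.2 i b) - Γ x.1 a b) * h b - R x.1 x.2 a with hw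
    have hw0 : Tendsto (fun x => w x ⬝ᵥ w x) (whp μ) (𝓝 0) := by
      have h1 : ∀ a, Tendsto (fun x => w x a) (whp μ) (𝓝 0) := fun a => by
        have h2 : Tendsto (fun x : ℕ × Ω => ∑ b, ((avg fun i => Y x.1 x.2 i a * Y x.1 x.2 i b) - Γ x.1 a b) * h b) (whp μ)
            (𝓝 (∑ b : Fin k, 0 * h b)) := tendsto_finsetSum _ fun b _ => (H.gram a b).mul_const _
        simpa using h2.sub (H.tendsto_remainder a)
      have h3 : Tendsto (fun x => ∑ a, w x a * w x a) (whp μ) (𝓝 (∑ _a : Fin k, (0 : ℝ) * 0)) :=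
        tendsto_finsetSum _ fun a _ => (h1 a).mul (h1 a)
      simpa [dotProduct] using h3
    have hAw : Tendsto (fun x : ℕ × Ω => (invSqrt (Om x.1 x.2) *ᵥ w x) a) (whp μ) (𝓝 0) := by
      refine tendsto_zero_of_sq ?_
      have h1 : Tendsto (fun x => lam⁻¹ * (w x ⬝ᵥ w x)) (whp μ) (𝓝 0) := by simpa using hw0.const_mul lam⁻¹
      refine squeeze_zero' (Eventually.of_forall fun x => sq_nonneg _) ?_ h1
      filter_upwards [H.om_ge] with x hx
      have h2 := invSqrt_mulVec_self_le (H.om_herm x.1 x.2) H.lam_pos hx (w x)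
      have h3 : (invSqrt (Om x.1 x.2) *ᵥ w x) a ^ 2 ≤ (invSqrt (Om x.1 x.2) *ᵥ w x) ⬝ᵥ (invSqrt (Om x.1 x.2) *ᵥ w x) := by
        rw [sq]
        exact Finset.single_le_sum (f := fun i => (invSqrt (Om x.1 x.2) *ᵥ w x) i * (invSqrt (Om x.1 x.2) *ᵥ w x) i)
          (fun i _ => mul_self_nonneg _) (Finset.mem_univ a)
      rw [inv_mul_eq_div, le_div_iff₀ H.lam_pos]
      nlinarith [H.lam_pos]
    have h4 := hAw.add (hg a)
    rw [zero_add] at h4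
    refine h4.congr' ?_
    filter_upwards [hpos] with x hx
    have h5 : S x.1 x.2 = w x + Γ x.1 *ᵥ h + N x.1 x.2 := by
      funext a
      rw [hSeq x hx a]
      simp only [hw, Pi.add_apply, Matrix.mulVec, dotProduct, sub_mul, Finset.sum_sub_distrib]
      ring
    change _ = (invSqrt (Om x.1 x.2) *ᵥ S x.1 x.2) a - (invSqrt (Om x.1 x.2) *ᵥ N x.1 x.2) a
    rw [h5, Matrix.mulVec_add, Matrix.mulVec_add]
    simp only [Pi.add_apply]
    ring
  · have h1 : Tendsto (fun x => 2 / lam ^ 2 * ((S x.1 x.2 ⬝ᵥ S x.1 x.2) * entrySum (V x.1 x.2 - Om x.1 x.2))) (whp μ) (𝓝 0) := by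
      simpa using (hSS.mul_tendsto_zero hVO).const_mul (2 / lam ^ 2)
    refine squeeze_zero_norm' ?_ h1
    filter_upwards [H.om_ge, hpos, hVO.eventually_le_const (half_pos H.lam_pos)] with x hx hn hV2
    have h2 := abs_form_inv_sub_le (H.om_herm x.1 x.2) (isHermitian_scoreGram _ _) H.lam_pos hx hV2 (S x.1 x.2)
    rw [waldForm_eq hn, Real.norm_eq_abs, EuclideanSpace.real_norm_sq_eq]
    have h3 : ∑ a, (WithLp.toLp 2 (invSqrt (Om x.1 x.2) *ᵥ S x.1 x.2) : Vec k) a ^ 2 = S x.1 x.2 ⬝ᵥ (symmInv (Om x.1 x.2) *ᵥ S x.1 x.2) := by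
      rw [← invSqrt_form (H.om_herm x.1 x.2) H.lam_pos hx]
      simp [dotProduct, sq]
    rw [h3]
    refine h2.trans (le_of_eq ?_)
    simp only [hV]
    ring

end abstract

/-! ### Distant alternatives -/

/-- The quadratic form of a weighted moment matrix is an average of squares. -/
theorem form_avg {n k : ℕ} (f : Fin n → Fin k → ℝ) (w : Fin n → ℝ) (v : Fin k → ℝ) :
    v ⬝ᵥ ((Matrix.of fun a b => avg fun i => f i a * f i b * w i) *ᵥ v) = avg fun i => (∑ a, f i a * v a) ^ 2 * w i := by
  have h : ∀ i, (∑ a, f i a * v a) ^ 2 * w i = ∑ a, ∑ b, v a * (f i a * f i b * w i * v b) := fun i => by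
    rw [sq, Finset.sum_mul_sum, Finset.sum_mul]
    refine Finset.sum_congr rfl fun a _ => ?_
    rw [Finset.sum_mul]
    exact Finset.sum_congr rfl fun b _ => by ring
  simp only [h, avg_sum, avg_const_mul, dotProduct, Matrix.mulVec, Matrix.of_apply, Finset.mul_sum]
  refine Finset.sum_congr rfl fun a _ => Finset.sum_congr rfl fun b _ => ?_
  congr 1
  rw [mul_comm, ← avg_const_mul]
  congr 1; funext i; ring

theorem form_sub_abs_le {k : ℕ} (A B : Matrix (Fin k) (Fin k) ℝ) (v : Fin k → ℝ) :
    |v ⬝ᵥ (A *ᵥ v) - v ⬝ᵥ (B *ᵥ v)| ≤ entrySum (A - B) * (v ⬝ᵥ v) := by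
  have h := abs_form_le (A - B) v v
  rwa [Matrix.sub_mulVec, dotProduct_sub, Real.mul_self_sqrt (dotProduct_self_nonneg' v)] at h

/-- The estimated variance grows at most quadratically in the distance `δ` from the null hypothesis. -/
theorem trace_scoreGram_resid_le {n k : ℕ} (y : Matrix (Fin n) (Fin k) ℝ) (δ : Fin k → ℝ) (u r : Fin n → ℝ) :
    (scoreGram y (resid y δ u r)).trace ≤ (1 + δ ⬝ᵥ δ) *
      ((2 * k * (k + 1) + 1) * (∑ a, avg fun i => y i a ^ 4) + k * avg fun i => (u i - r i) ^ 4) := by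
  have h1 : ∀ a, scoreGram y (resid y δ u r) a a ≤ 2 * ((δ ⬝ᵥ δ) * ((k + 1) * ∑ b, avg fun i => y i b ^ 4)) +
      ((avg fun i => y i a ^ 4) + avg fun i => (u i - r i) ^ 4) := by
    intro a
    refine le_trans ?_ (add_le_add_left (mul_le_mul_of_nonneg_left (avg_sum_mul_sq_le y δ a) (by norm_num)) _)
    rw [← avg_const_mul, ← avg_add, ← avg_add]
    refine avg_mono fun i => ?_
    simp only [resid]
    set A := ∑ b, y i b * δ b
    set s := y i a
    set d := u i - r i
    nlinarith [sq_nonneg (s * (A - d)), sq_nonneg (s ^ 2 - d ^ 2)]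
  have h2 := Finset.sum_le_sum fun a (_ : a ∈ Finset.univ) => h1 a
  rw [Finset.sum_add_distrib, Finset.sum_add_distrib] at h2
  simp only [Finset.sum_const, Finset.card_univ, Fintype.card_fin, nsmul_eq_mul] at h2
  have hF : 0 ≤ ∑ a, avg fun i => y i a ^ 4 := Finset.sum_nonneg fun _ _ => avg_nonneg fun i => by positivity
  have hU : 0 ≤ avg fun i => (u i - r i) ^ 4 := avg_nonneg fun i => by positivity
  have hδ0 := dotProduct_self_nonneg' δ
  refine h2.trans ?_
  set F := ∑ a, avg fun i => y i a ^ 4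
  set U := avg fun i => (u i - r i) ^ 4
  have hk : (0 : ℝ) ≤ k := Nat.cast_nonneg k
  have b1 := mul_nonneg hδ0 (add_nonneg hF (mul_nonneg hk hU))
  have b2 := mul_nonneg (mul_nonneg (mul_nonneg zero_le_two hk) (add_nonneg hk zero_le_one)) hF
  clear_value F U
  linarith

theorem fourth_bound_nonneg {n k : ℕ} (y : Matrix (Fin n) (Fin k) ℝ) (u r : Fin n → ℝ) :
    0 ≤ (2 * k * (k + 1) + 1) * (∑ a, avg fun i => y i a ^ 4) + k * avg fun i => (u i - r i) ^ 4 := by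
  have hF : 0 ≤ ∑ a, avg fun i => y i a ^ 4 := Finset.sum_nonneg fun _ _ => avg_nonneg fun i => by positivity
  have hU : 0 ≤ avg fun i => (u i - r i) ^ 4 := avg_nonneg fun i => by positivity
  exact add_nonneg (mul_nonneg (by positivity) hF) (mul_nonneg (Nat.cast_nonneg k) hU)

section abstract
variable {Ω : Type*} [MeasurableSpace Ω] {μ : Measure Ω} [IsProbabilityMeasure μ] {k : ℕ}
    {Y : (n : ℕ) → Ω → Matrix (Fin n) (Fin k) ℝ} {α e : (n : ℕ) → Fin n → Fin k → Ω → ℝ} {u r : (n : ℕ) → Fin n → Ω → ℝ}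
    {Om : ℕ → Ω → Matrix (Fin k) (Fin k) ℝ} {Γ : ℕ → Matrix (Fin k) (Fin k) ℝ} {lam : ℝ}
    (H : WaldLimits μ Y α e u r Om Γ lam)
include H

/-- Nondegeneracy of the variance of the score forces nondegeneracy of the regressor moment matrix, because
the errors can be truncated. -/
theorem WaldLimits.exists_gram_ge {env : (n : ℕ) → Fin n → Ω → ℝ} {B : ℝ}
    (hu : ∀ n i ω, u n i ω ^ 2 ≤ env n i ω)
    (hα : ∀ᶠ x : ℕ × Ω in whp μ, ∀ i, (∑ a, α x.1 i a x.2 ^ 2) * u x.1 i x.2 ^ 2 ≤ B * env x.1 i x.2) (hB : 0 < B)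
    (htail : ∀ ε > 0, ∃ K > 0, ∀ n, 1 / 2 ≤ μ {ω | (avg fun i => if K < env n i ω then env n i ω else 0) < ε}) :
    ∃ c > 0, ∀ᶠ n in atTop, ∀ v : Fin k → ℝ, c * (v ⬝ᵥ v) ≤ v ⬝ᵥ (Γ n *ᵥ v) := by
  have hlam := H.lam_pos
  -- units with large envelope and the approximation errors each take at most `lam / 4` of the lower bound `lam`; the
  -- other units satisfy `u ^ 2 ≤ K`, and `2 K` times the form of `Γ` has to make up for the remaining `lam / 2`
  obtain ⟨K, hK, hKt⟩ := htail (lam / (4 * B)) (by positivity)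
  refine ⟨lam / (4 * K), by positivity, ?_⟩
  set A : ℕ × Ω → Matrix (Fin k) (Fin k) ℝ := fun x => Matrix.of fun a b => avg fun i => α x.1 i a x.2 * α x.1 i b x.2 * u x.1 i x.2 ^ 2
  set C : ℕ × Ω → Matrix (Fin k) (Fin k) ℝ := fun x => Matrix.of fun a b => avg fun i => Y x.1 x.2 i a * Y x.1 x.2 i b * 1
  have hA : Tendsto (fun x : ℕ × Ω => entrySum (A x - Om x.1 x.2)) (whp μ) (𝓝 0) := by
    have : Tendsto (fun x : ℕ × Ω => ∑ a, ∑ b, |A x a b - Om x.1 x.2 a b|) (whp μ) (𝓝 (∑ _a : Fin k, ∑ _b : Fin k, |(0 : ℝ)|)) :=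
      tendsto_finsetSum _ fun a _ => tendsto_finsetSum _ fun b _ => (H.score_gram a b).abs
    simpa [entrySum] using this
  have hC : Tendsto (fun x : ℕ × Ω => entrySum (C x - Γ x.1)) (whp μ) (𝓝 0) := by
    have : Tendsto (fun x : ℕ × Ω => ∑ a, ∑ b, |C x a b - Γ x.1 a b|) (whp μ) (𝓝 (∑ _a : Fin k, ∑ _b : Fin k, |(0 : ℝ)|)) :=
      tendsto_finsetSum _ fun a _ => tendsto_finsetSum _ fun b _ => by simpa [C] using (H.gram a b).abs
    simpa [entrySum] using this
  have hE : Tendsto (fun x : ℕ × Ω => ∑ a, avg fun i => (u x.1 i x.2 * e x.1 i a x.2) ^ 2) (whp μ) (𝓝 0) := by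
    simpa using tendsto_finsetSum Finset.univ fun a _ => H.err_u a
  have hall : Tendsto (fun x : ℕ × Ω => entrySum (A x - Om x.1 x.2) + 2 * (∑ a, avg fun i => (u x.1 i x.2 * e x.1 i a x.2) ^ 2) +
      2 * K * entrySum (C x - Γ x.1)) (whp μ) (𝓝 0) := by
    simpa using (hA.add (hE.const_mul 2)).add (hC.const_mul (2 * K))
  have hev := ((hall.eventually_le_const (show 0 < lam / 4 by positivity)).and hα).and H.om_ge
  -- `Γ n` is not random, so that a single outcome with all approximations is enough
  filter_upwards [exists_of_eventually_whp hev (by norm_num) hKt] with n ⟨ω, hω, ⟨h1, h2⟩, h3⟩ v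
  set τ := avg fun i => if K < env n i ω then env n i ω else 0 with hτd
  have hω' : τ < lam / (4 * B) := hω
  have hv := dotProduct_self_nonneg' v
  have key : ∀ i, (∑ a, α n i a ω * v a) ^ 2 * u n i ω ^ 2 ≤ 2 * K * ((∑ a, Y n ω i a * v a) ^ 2 * 1) +
      (v ⬝ᵥ v) * (2 * ∑ a, (u n i ω * e n i a ω) ^ 2 + B * if K < env n i ω then env n i ω else 0) := by
    intro i
    have cs : ∀ f : Fin k → ℝ, (∑ a, f a * v a) ^ 2 ≤ (∑ a, f a ^ 2) * (v ⬝ᵥ v) := fun f => by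
      have := Finset.sum_mul_sq_le_sq_mul_sq Finset.univ f v
      simpa [dotProduct, sq] using this
    have he0 : 0 ≤ ∑ a, (u n i ω * e n i a ω) ^ 2 := Finset.sum_nonneg fun _ _ => sq_nonneg _
    by_cases hc : K < env n i ω
    · rw [if_pos hc]
      have h4 := h2 i
      have h5 := cs fun a => α n i a ω
      have h6 : 0 ≤ 2 * K * ((∑ a, Y n ω i a * v a) ^ 2 * 1) := by positivity
      have h7 : (∑ a, α n i a ω * v a) ^ 2 * u n i ω ^ 2 ≤ (v ⬝ᵥ v) * (B * env n i ω) := by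
        calc _ ≤ ((∑ a, α n i a ω ^ 2) * (v ⬝ᵥ v)) * u n i ω ^ 2 := by gcongr
          _ = (v ⬝ᵥ v) * ((∑ a, α n i a ω ^ 2) * u n i ω ^ 2) := by ring
          _ ≤ _ := by gcongr
      nlinarith [mul_nonneg hv he0]
    · rw [if_neg hc]
      have hu2 : u n i ω ^ 2 ≤ K := (hu n i ω).trans (not_lt.1 hc)
      have h5 := cs fun a => u n i ω * e n i a ω
      have e1 : (∑ a, α n i a ω * v a) = (∑ a, Y n ω i a * v a) + ∑ a, e n i a ω * v a := by
        rw [← Finset.sum_add_distrib]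
        exact Finset.sum_congr rfl fun a _ => by rw [H.split]; ring
      have e2 : ∑ a, (u n i ω * e n i a ω) * v a = u n i ω * ∑ a, e n i a ω * v a := by
        rw [Finset.mul_sum]; exact Finset.sum_congr rfl fun a _ => by ring
      rw [e2] at h5
      rw [e1]
      set s := ∑ a, Y n ω i a * v a
      set t := ∑ a, e n i a ω * v a
      have h8 : s ^ 2 * u n i ω ^ 2 ≤ s ^ 2 * K := by gcongr
      nlinarith [sq_nonneg (u n i ω * (s - t))]
  have h9 := avg_mono key
  rw [← form_avg, avg_add, avg_const_mul, ← form_avg (fun i a => Y n ω i a) (fun _ => 1) v, avg_const_mul, avg_add, avg_const_mul, avg_const_mul, avg_sum] at h9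
  have h10 := (abs_le.1 (form_sub_abs_le (A (n, ω)) (Om n ω) v)).1
  have h11 := (abs_le.1 (form_sub_abs_le (C (n, ω)) (Γ n) v)).2
  have h12 := h3 v
  change v ⬝ᵥ (A (n, ω) *ᵥ v) ≤ 2 * K * (v ⬝ᵥ (C (n, ω) *ᵥ v)) + _ at h9
  set E1 := entrySum (A (n, ω) - Om n ω)
  set E2 := entrySum (C (n, ω) - Γ n)
  set E3 := ∑ a, avg fun i => (u n i ω * e n i a ω) ^ 2
  have hτ : B * τ ≤ lam / 4 := by
    have := mul_le_mul_of_nonneg_left hω'.le hB.le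
    calc B * τ ≤ B * (lam / (4 * B)) := this
      _ = lam / 4 := by field_simp
  rw [div_mul_eq_mul_div, div_le_iff₀ (by positivity)]
  have f1 := mul_le_mul_of_nonneg_right h1 hv
  have f2 := mul_le_mul_of_nonneg_left hτ hv
  have f3 := mul_le_mul_of_nonneg_left h11 (show 0 ≤ 2 * K by positivity)
  nlinarith

/-- Along alternatives away from the null hypothesis the score is at least half as long as its deterministic part. -/
theorem WaldLimits.le_score {c : ℝ} (hc : 0 < c)
    (hΓ : ∀ᶠ n in atTop, ∀ v : Fin k → ℝ, c * (v ⬝ᵥ v) ≤ v ⬝ᵥ (Γ n *ᵥ v)) {δ D : ℕ → Fin k → ℝ} {t : ℕ → ℝ}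
    (hD : ∀ n, D n = √(n : ℝ) • δ n) (ht : ∀ n, t n = √((Γ n *ᵥ D n) ⬝ᵥ (Γ n *ᵥ D n))) (htt : Tendsto t atTop atTop) :
    ∀ᶠ x : ℕ × Ω in whp μ, t x.1 ^ 2 ≤ 4 *
      (score (Y x.1 x.2) (resid (Y x.1 x.2) (δ x.1) (fun i => u x.1 i x.2) fun i => r x.1 i x.2) ⬝ᵥ
        score (Y x.1 x.2) (resid (Y x.1 x.2) (δ x.1) (fun i => u x.1 i x.2) fun i => r x.1 i x.2)) := by
  set S : ℕ → Ω → Fin k → ℝ := fun n ω => score (Y n ω) (resid (Y n ω) (δ n) (fun i => u n i ω) fun i => r n i ω) with hS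
  set w : ℕ × Ω → Fin k → ℝ := fun x a => (√(x.1 : ℝ))⁻¹ * ∑ i, α x.1 i a x.2 * u x.1 i x.2 - (√(x.1 : ℝ))⁻¹ * ∑ i, e x.1 i a x.2 * r x.1 i x.2 with hw
  have ht2 : ∀ n, (Γ n *ᵥ D n) ⬝ᵥ (Γ n *ᵥ D n) = t n ^ 2 := fun n => by rw [ht, Real.sq_sqrt (dotProduct_self_nonneg' _)]
  set C : ℕ × Ω → Matrix (Fin k) (Fin k) ℝ := fun x => Matrix.of fun a b => avg fun i => Y x.1 x.2 i a * Y x.1 x.2 i b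
  have hC : Tendsto (fun x : ℕ × Ω => entrySum (C x - Γ x.1)) (whp μ) (𝓝 0) := by
    have : Tendsto (fun x : ℕ × Ω => ∑ a, ∑ b, |C x a b - Γ x.1 a b|) (whp μ) (𝓝 (∑ _a : Fin k, ∑ _b : Fin k, |(0 : ℝ)|)) :=
      tendsto_finsetSum _ fun a _ => tendsto_finsetSum _ fun b _ => (H.gram a b).abs
    simpa [entrySum] using this
  have hwb : BddP μ fun x => 1 + w x ⬝ᵥ w x := by
    have h1 : ∀ a, BddP μ fun x => w x a := fun a =>
      ((H.score_bdd a).add (BddP.of_tendsto (H.tendsto_remainder a).neg)).mono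
        (Eventually.of_forall fun x => le_of_eq (by simp only [hw, sub_eq_add_neg]))
    exact (BddP.const 1).add (BddP.sum _ fun a _ => (h1 a).mul (h1 a))
  have hinv : Tendsto (fun x : ℕ × Ω => (t x.1)⁻¹) (whp μ) (𝓝 0) := (tendsto_inv_atTop_zero.comp htt).comp tendsto_fst_whp
  have h1 : Tendsto (fun x : ℕ × Ω => c⁻¹ * entrySum (C x - Γ x.1) + (1 + w x ⬝ᵥ w x) * (t x.1)⁻¹) (whp μ) (𝓝 0) := by
    simpa using (hC.const_mul c⁻¹).add (hwb.mul_tendsto_zero hinv)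
  filter_upwards [h1.eventually_le_const (show (0 : ℝ) < 1 / 2 by norm_num), tendsto_fst_whp.eventually hΓ,
    (htt.comp tendsto_fst_whp).eventually_gt_atTop 0] with x h2 h3 h4
  simp only [Function.comp_apply] at h4
  have hSd : S x.1 x.2 = Γ x.1 *ᵥ D x.1 + (C x - Γ x.1) *ᵥ D x.1 + w x := by
    funext a
    rw [hD]
    simp only [hS]
    rw [H.score_resid, Matrix.sub_mulVec, add_sub_cancel, Pi.add_apply, add_sub_assoc]
    rfl
  -- `D` is controlled by the length `t` of `Γ D` because `Γ` is bounded below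
  have hDt : √(D x.1 ⬝ᵥ D x.1) ≤ c⁻¹ * t x.1 := by
    have h5 := h3 (D x.1)
    have h6 := Real.abs_le_sqrt (dotProduct_sq_le (D x.1) (Γ x.1 *ᵥ D x.1))
    rw [Real.sqrt_mul (dotProduct_self_nonneg' _), ← ht] at h6
    have h7 := Real.mul_self_sqrt (dotProduct_self_nonneg' (D x.1))
    set s := √(D x.1 ⬝ᵥ D x.1) with hs
    rw [inv_mul_eq_div, le_div_iff₀ hc]
    rcases (Real.sqrt_nonneg (D x.1 ⬝ᵥ D x.1)).eq_or_lt with h8 | h8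
    · rw [← hs] at h8; rw [← h8]; simpa using h4.le
    · rw [← hs] at h8
      have h9 : s * (s * c) ≤ s * t x.1 := by
        calc s * (s * c) = c * (D x.1 ⬝ᵥ D x.1) := by rw [← h7]; ring
          _ ≤ _ := (h5.trans (le_abs_self _)).trans h6
      exact le_of_mul_le_mul_left h9 h8
  have h5 := (abs_le.1 (abs_form_le (C x - Γ x.1) (Γ x.1 *ᵥ D x.1) (D x.1))).1
  have h6 := (abs_le.1 (Real.abs_le_sqrt (dotProduct_sq_le (Γ x.1 *ᵥ D x.1) (w x)))).1
  rw [Real.sqrt_mul (dotProduct_self_nonneg' _)] at h6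
  rw [← ht] at h5 h6
  have h7 : √(w x ⬝ᵥ w x) ≤ 1 + w x ⬝ᵥ w x := by
    refine Real.sqrt_le_iff.2 ⟨by linarith [dotProduct_self_nonneg' (w x)], ?_⟩
    nlinarith [dotProduct_self_nonneg' (w x)]
  have he : 0 ≤ entrySum (C x - Γ x.1) := Finset.sum_nonneg fun _ _ => Finset.sum_nonneg fun _ _ => abs_nonneg _
  -- the component of the score in the direction of `Γ D`
  have h8 : t x.1 ^ 2 / 2 ≤ (Γ x.1 *ᵥ D x.1) ⬝ᵥ S x.1 x.2 := by
    rw [hSd, dotProduct_add, dotProduct_add, ht2]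
    have a1 : entrySum (C x - Γ x.1) * (t x.1 * √(D x.1 ⬝ᵥ D x.1)) ≤ entrySum (C x - Γ x.1) * (t x.1 * (c⁻¹ * t x.1)) := by gcongr
    have a2 : t x.1 * √(w x ⬝ᵥ w x) ≤ t x.1 * (1 + w x ⬝ᵥ w x) := by gcongr
    have a3 := mul_le_mul_of_nonneg_left h2 (sq_nonneg (t x.1))
    have a4 : t x.1 ^ 2 * (c⁻¹ * entrySum (C x - Γ x.1) + (1 + w x ⬝ᵥ w x) * (t x.1)⁻¹) =
        entrySum (C x - Γ x.1) * (t x.1 * (c⁻¹ * t x.1)) + t x.1 * (1 + w x ⬝ᵥ w x) := by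
      field_simp
    linarith
  have h9 := dotProduct_sq_le (Γ x.1 *ᵥ D x.1) (S x.1 x.2)
  rw [ht2] at h9
  have h10 : (t x.1 ^ 2 / 2) ^ 2 ≤ t x.1 ^ 2 * (S x.1 x.2 ⬝ᵥ S x.1 x.2) :=
    (pow_le_pow_left₀ (by positivity) h8 2).trans h9
  have h11 : t x.1 ^ 2 * t x.1 ^ 2 ≤ t x.1 ^ 2 * (4 * (S x.1 x.2 ⬝ᵥ S x.1 x.2)) := by linarith [h10]
  exact le_of_mul_le_mul_left h11 (by positivity)

/-- Along distant alternatives the Wald statistic, bounded below by the squared length of the score over the trace of the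
estimated variance, tends to infinity in probability: the former is of the order `n |δ|²` at least, and the latter of
the order `1 + |δ|²` at most. -/
theorem WaldLimits.tendsto_wald_atTop {c : ℝ} (hc : 0 < c)
    (hΓ : ∀ᶠ n in atTop, ∀ v : Fin k → ℝ, c * (v ⬝ᵥ v) ≤ v ⬝ᵥ (Γ n *ᵥ v)) {δ : ℕ → Fin k → ℝ}
    (hδ : Tendsto (fun n : ℕ => √(n : ℝ) * √((Γ n *ᵥ δ n) ⬝ᵥ (Γ n *ᵥ δ n))) atTop atTop) (M : ℝ) :
    ∀ᶠ x : ℕ × Ω in whp μ, M < waldForm (Y x.1 x.2) (resid (Y x.1 x.2) (δ x.1) (fun i => u x.1 i x.2) fun i => r x.1 i x.2) := by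
  set S : ℕ → Ω → Fin k → ℝ := fun n ω => score (Y n ω) (resid (Y n ω) (δ n) (fun i => u n i ω) fun i => r n i ω) with hS
  set V : ℕ → Ω → Matrix (Fin k) (Fin k) ℝ := fun n ω => scoreGram (Y n ω) (resid (Y n ω) (δ n) (fun i => u n i ω) fun i => r n i ω) with hV
  set D : ℕ → Fin k → ℝ := fun n => √(n : ℝ) • δ n with hD
  obtain ⟨t, ht⟩ : ∃ t : ℕ → ℝ, ∀ n, t n = √((Γ n *ᵥ D n) ⬝ᵥ (Γ n *ᵥ D n)) := ⟨_, fun _ => rfl⟩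
  have htt : Tendsto t atTop atTop := by
    refine hδ.congr fun n => ?_
    simp only [ht, hD, Matrix.mulVec_smul, smul_dotProduct, dotProduct_smul, smul_eq_mul]
    rw [← mul_assoc, Real.sqrt_mul (by positivity), Real.sqrt_mul_self (by positivity)]
  have ht2 : ∀ n, (Γ n *ᵥ D n) ⬝ᵥ (Γ n *ᵥ D n) = t n ^ 2 := fun n => by
    rw [ht, Real.sq_sqrt (dotProduct_self_nonneg' _)]
  have hinv : Tendsto (fun x : ℕ × Ω => (t x.1)⁻¹) (whp μ) (𝓝 0) := (tendsto_inv_atTop_zero.comp htt).comp tendsto_fst_whp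
  have hlow := H.le_score hc hΓ (D := D) (t := t) (fun _ => rfl) ht htt
  obtain ⟨Q, hQb, hQ0, htr⟩ : ∃ Q : ℕ × Ω → ℝ, BddP μ Q ∧ (∀ x, 0 ≤ Q x) ∧
      ∀ x, (V x.1 x.2).trace ≤ (1 + δ x.1 ⬝ᵥ δ x.1) * Q x :=
    ⟨_, ((BddP.const _).mul H.fourth_sum).add ((BddP.const _).mul H.fourth_u),
      fun x => fourth_bound_nonneg _ _ _, fun x => trace_scoreGram_resid_le _ _ _ _⟩
  have hsmall : Tendsto (fun x : ℕ × Ω => (|M| + 1) * (Q x * ((t x.1)⁻¹ ^ 2 + (c⁻¹) ^ 2 * (x.1 : ℝ)⁻¹))) (whp μ) (𝓝 0) := by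
    have h1 : Tendsto (fun x : ℕ × Ω => (x.1 : ℝ)⁻¹) (whp μ) (𝓝 0) := (tendsto_inv_atTop_nhds_zero_nat (𝕜 := ℝ)).comp tendsto_fst_whp
    have h2 : Tendsto (fun x : ℕ × Ω => (t x.1)⁻¹ ^ 2 + (c⁻¹) ^ 2 * (x.1 : ℝ)⁻¹) (whp μ) (𝓝 (0 ^ 2 + (c⁻¹) ^ 2 * 0)) :=
      (hinv.pow 2).add (h1.const_mul ((c⁻¹) ^ 2))
    rw [mul_zero, add_zero, zero_pow two_ne_zero] at h2
    have h3 := (hQb.mul_tendsto_zero h2).const_mul (|M| + 1)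
    rwa [mul_zero] at h3
  filter_upwards [hlow, hsmall.eventually_lt_const (show (0 : ℝ) < 1 / 4 by norm_num), tendsto_fst_whp.eventually hΓ,
      (htt.comp tendsto_fst_whp).eventually_gt_atTop 0, tendsto_fst_whp.eventually_ge_atTop 1] with x h1 h2 h3 h4 hn
  simp only [Function.comp_apply] at h4
  have hn' : (0 : ℝ) < x.1 := by exact_mod_cast hn
  by_contra hM
  rw [not_lt] at hM
  obtain ⟨hW0, hWS⟩ := waldForm_nonneg_and_le (Y x.1 x.2) (resid (Y x.1 x.2) (δ x.1) (fun i => u x.1 i x.2) fun i => r x.1 i x.2)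
  set W := waldForm (Y x.1 x.2) (resid (Y x.1 x.2) (δ x.1) (fun i => u x.1 i x.2) fun i => r x.1 i x.2)
  have hδt : δ x.1 ⬝ᵥ δ x.1 ≤ (c⁻¹) ^ 2 * (x.1 : ℝ)⁻¹ * t x.1 ^ 2 := by
    have h5 := h3 (D x.1)
    have h6 := dotProduct_sq_le (D x.1) (Γ x.1 *ᵥ D x.1)
    rw [ht2] at h6
    have h7 : D x.1 ⬝ᵥ D x.1 = x.1 * (δ x.1 ⬝ᵥ δ x.1) := by
      simp only [hD, smul_dotProduct, dotProduct_smul, smul_eq_mul]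
      rw [← mul_assoc, Real.mul_self_sqrt hn'.le]
    have h8 := dotProduct_self_nonneg' (D x.1)
    have h9 : c ^ 2 * (D x.1 ⬝ᵥ D x.1) ≤ t x.1 ^ 2 := by
      rcases h8.eq_or_lt with h10 | h10
      · rw [← h10]; simpa using sq_nonneg (t x.1)
      · have := pow_le_pow_left₀ (by positivity) h5 2
        have h11 : (D x.1 ⬝ᵥ D x.1) * (c ^ 2 * (D x.1 ⬝ᵥ D x.1)) ≤ (D x.1 ⬝ᵥ D x.1) * t x.1 ^ 2 := by nlinarith
        exact le_of_mul_le_mul_left h11 h10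
    rw [h7] at h9
    have : (c⁻¹) ^ 2 * (x.1 : ℝ)⁻¹ * t x.1 ^ 2 = t x.1 ^ 2 / (c ^ 2 * x.1) := by field_simp
    rw [this, le_div_iff₀ (by positivity)]
    linarith
  have h5 : t x.1 ^ 2 / 4 ≤ (1 + (c⁻¹) ^ 2 * (x.1 : ℝ)⁻¹ * t x.1 ^ 2) * Q x * (|M| + 1) := by
    have hWM : W ≤ |M| + 1 := hM.trans ((le_abs_self M).trans (by linarith))
    have hδ0 := dotProduct_self_nonneg' (δ x.1)
    have hq := hQ0 x
    calc t x.1 ^ 2 / 4 ≤ S x.1 x.2 ⬝ᵥ S x.1 x.2 := by linarith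
      _ ≤ (V x.1 x.2).trace * W := hWS
      _ ≤ ((1 + δ x.1 ⬝ᵥ δ x.1) * Q x) * W := by gcongr; exact htr x
      _ ≤ ((1 + δ x.1 ⬝ᵥ δ x.1) * Q x) * (|M| + 1) := by gcongr
      _ ≤ _ := by gcongr
  have h6 : (1 + (c⁻¹) ^ 2 * (x.1 : ℝ)⁻¹ * t x.1 ^ 2) * Q x * (|M| + 1) =
      t x.1 ^ 2 * ((|M| + 1) * (Q x * ((t x.1)⁻¹ ^ 2 + (c⁻¹) ^ 2 * (x.1 : ℝ)⁻¹))) := by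
    field_simp
  rw [h6] at h5
  have h7 : 0 < t x.1 ^ 2 := by positivity
  nlinarith

end abstract

/-! ### Arrays with uniformly bounded conditional moments -/

/-- A triangular array of independent units whose conditional laws given `Z_i` satisfy uniform moment bounds, with a
negligible number of strata. -/
structure UnitArray {Ω : Type*} [MeasurableSpace Ω] (μ : Measure Ω) [IsProbabilityMeasure μ] {k p : ℕ}
    (X : (n : ℕ) → Fin n → Ω → Vec k) (Z : (n : ℕ) → Fin n → Ω → Vec p) (u : (n : ℕ) → Fin n → Ω → ℝ)
    (M : ℝ) (ρ : ℝ → ℝ) : Prop where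
  measurable_X : ∀ n i, Measurable (X n i)
  measurable_Z : ∀ n i, Measurable (Z n i)
  measurable_u : ∀ n i, Measurable (u n i)
  indep : ∀ n, iIndepFun (fun i ω => (X n i ω, Z n i ω, u n i ω)) μ
  bounds : ∀ n, ∀ᵐ ω ∂μ, ∀ i, UnitBounds (unitKernel μ (X n) (Z n) (u n) i (Z n i ω)) M ρ
  tail : Tendsto ρ atTop (𝓝 0)
  x4_int : ∀ n i, Integrable (fun ω => ‖X n i ω‖ ^ 4) μ
  x4_le : ∀ n i, ∫ ω, ‖X n i ω‖ ^ 4 ∂μ ≤ M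
  u4_int : ∀ n i, Integrable (fun ω => u n i ω ^ 4) μ
  u4_le : ∀ n i, ∫ ω, u n i ω ^ 4 ∂μ ≤ M
  few_strata : ∀ᵐ ω ∂μ, Tendsto (fun n : ℕ => ((strata (fun i => Z n i ω)).card : ℝ) / (n : ℝ)) atTop (𝓝 0)
  nonneg : 0 ≤ M

section defs
variable {Ω : Type*} [MeasurableSpace Ω] (μ : Measure Ω) [IsProbabilityMeasure μ] {k p : ℕ}
    (X : (n : ℕ) → Fin n → Ω → Vec k) (Z : (n : ℕ) → Fin n → Ω → Vec p) (u : (n : ℕ) → Fin n → Ω → ℝ)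

/-- The conditional laws of the units given the observed strata. -/
noncomputable def condLaw (n : ℕ) (ω : Ω) (i : Fin n) : Measure (Vec k × ℝ) := unitKernel μ (X n) (Z n) (u n) i (Z n i ω)

instance (n : ℕ) (ω : Ω) (i : Fin n) : IsProbabilityMeasure (condLaw μ X Z u n ω i) := by
  unfold condLaw; infer_instance

/-- The deviation of the regressors from the stratum average of the conditional means. -/
noncomputable def dev (n : ℕ) (i : Fin n) (a : Fin k) (ω : Ω) : ℝ :=
  devn (condLaw μ X Z u n ω) (fun j => Z n j ω) a i (X n i ω, u n i ω)

/-- The error of the stratum mean of the regressors. -/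
noncomputable def err (n : ℕ) (i : Fin n) (a : Fin k) (ω : Ω) : ℝ :=
  meanErr (condLaw μ X Z u n ω) (fun j => Z n j ω) (fun j => (X n j ω, u n j ω)) a i

/-- The stratum means of the errors. -/
noncomputable def errMean (n : ℕ) (i : Fin n) (ω : Ω) : ℝ := sMean (fun j => Z n j ω) (fun j => u n j ω) i

/-- The matrix `Ω_n`, computed from the conditional laws of the units. -/
noncomputable def condOmega (n : ℕ) (ω : Ω) : Matrix (Fin k) (Fin k) ℝ := omegaOf (condLaw μ X Z u n ω) fun j => Z n j ω

/-- The demeaned regressors. -/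
noncomputable def demeaned (n : ℕ) (ω : Ω) : Matrix (Fin n) (Fin k) ℝ := Xtilde (fun i => X n i ω) fun i => Z n i ω

end defs

section array
variable {Ω : Type*} [MeasurableSpace Ω] {μ : Measure Ω} [IsProbabilityMeasure μ] {k p : ℕ}
    {X : (n : ℕ) → Fin n → Ω → Vec k} {Z : (n : ℕ) → Fin n → Ω → Vec p} {u : (n : ℕ) → Fin n → Ω → ℝ}
    {M : ℝ} {ρ : ℝ → ℝ} (H : UnitArray μ X Z u M ρ)
include H

/-- Convergence in probability from a bound on the conditional mean given the strata. -/
theorem UnitArray.tendsto_of_integral_le {F : (n : ℕ) → (Fin n → Vec p) × (Fin n → Vec k × ℝ) → ℝ}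
    (hF : ∀ n, Measurable (F n)) (hF0 : ∀ n q, 0 ≤ F n q) {G : (n : ℕ) → (Fin n → Vec p) → ℝ}
    (hG : Tendsto (fun n => ∫⁻ ω, ENNReal.ofReal (G n fun i => Z n i ω) ∂μ) atTop (𝓝 0))
    (h : ∀ n ω, (∀ i, UnitBounds (condLaw μ X Z u n ω i) M ρ) →
      Integrable (fun w => F n (fun i => Z n i ω, w)) (Measure.pi (condLaw μ X Z u n ω)) ∧
      ∫ w, F n (fun i => Z n i ω, w) ∂(Measure.pi (condLaw μ X Z u n ω)) ≤ G n fun i => Z n i ω) :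
    Tendsto (fun x : ℕ × Ω => F x.1 (fun i => Z x.1 i x.2, fun i => (X x.1 i x.2, u x.1 i x.2))) (whp μ) (𝓝 0) := by
  refine tendsto_whp_zero_of_lintegral (fun x => hF0 _ _) (fun n => (hF n).comp ?_) ?_
  · exact (measurable_pi_lambda _ (H.measurable_Z n)).prodMk
      (measurable_pi_lambda _ fun i => (H.measurable_X n i).prodMk (H.measurable_u n i))
  · refine tendsto_of_tendsto_of_tendsto_of_le_of_le tendsto_const_nhds hG (fun _ => zero_le) fun n => ?_
    refine lintegral_data_le (H.measurable_X n) (H.measurable_Z n) (H.measurable_u n) (H.indep n) (hF n) (hF0 n) ?_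
    filter_upwards [H.bounds n] with ω hω
    exact h n ω hω

/-- Boundedness in probability from a bound on the conditional mean given the strata. -/
theorem UnitArray.bddP_of_integral_le {F : (n : ℕ) → (Fin n → Vec p) × (Fin n → Vec k × ℝ) → ℝ}
    (hF : ∀ n, Measurable (F n)) (hF0 : ∀ n q, 0 ≤ F n q) {C : ℝ}
    (h : ∀ n ω, (∀ i, UnitBounds (condLaw μ X Z u n ω i) M ρ) →
      Integrable (fun w => F n (fun i => Z n i ω, w)) (Measure.pi (condLaw μ X Z u n ω)) ∧
      ∫ w, F n (fun i => Z n i ω, w) ∂(Measure.pi (condLaw μ X Z u n ω)) ≤ C) :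
    BddP μ fun x => F x.1 (fun i => Z x.1 i x.2, fun i => (X x.1 i x.2, u x.1 i x.2)) := by
  refine BddP.of_lintegral_le (C := C) (fun x => hF0 _ _) (fun n => (hF n).comp ?_) fun n => ?_
  · exact (measurable_pi_lambda _ (H.measurable_Z n)).prodMk
      (measurable_pi_lambda _ fun i => (H.measurable_X n i).prodMk (H.measurable_u n i))
  · refine (lintegral_data_le (H.measurable_X n) (H.measurable_Z n) (H.measurable_u n) (H.indep n) (hF n) (hF0 n)
      (G := fun _ => C) ?_).trans (by simp)
    filter_upwards [H.bounds n] with ω hω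
    exact h n ω hω

/-- The mean share of strata vanishes, by dominated convergence, since there are at most `n` strata. -/
theorem UnitArray.tendsto_lintegral_strata (C : ℝ) :
    Tendsto (fun n : ℕ => ∫⁻ ω, ENNReal.ofReal ((n : ℝ)⁻¹ * (C * (strata fun i => Z n i ω).card)) ∂μ) atTop (𝓝 0) := by
  have h1 : Tendsto (fun n : ℕ => ∫⁻ ω, ENNReal.ofReal ((n : ℝ)⁻¹ * (C * (strata fun i => Z n i ω).card)) ∂μ) atTop (𝓝 (∫⁻ _, 0 ∂μ)) := by
    refine tendsto_lintegral_of_dominated_convergence (μ := μ) (fun _ => ENNReal.ofReal |C|) (fun n => ?_) (fun n => ae_of_all _ fun ω => ?_)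
      (by simp) ?_
    · exact (((measurable_card_strata (H.measurable_Z n)).const_mul C).const_mul _).ennreal_ofReal
    · refine ENNReal.ofReal_le_ofReal ?_
      have h2 := card_strata_le fun i => Z n i ω
      have h3 : (0 : ℝ) ≤ (strata fun i => Z n i ω).card := Nat.cast_nonneg _
      rw [inv_mul_eq_div]
      refine div_le_of_le_mul₀ (Nat.cast_nonneg n) (abs_nonneg C) ?_
      calc C * (strata fun i => Z n i ω).card ≤ |C| * (strata fun i => Z n i ω).card := by gcongr; exact le_abs_self C
        _ ≤ |C| * n := by gcongr
    · filter_upwards [H.few_strata] with ω hω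
      have h2 := ENNReal.tendsto_ofReal (hω.const_mul C)
      rw [mul_zero, ENNReal.ofReal_zero] at h2
      refine h2.congr fun n => ?_
      congr 1; ring
  simpa using h1

theorem UnitArray.tendsto_dev_mean (a : Fin k) :
    Tendsto (fun x : ℕ × Ω => avg fun i => (dev μ X Z u x.1 i a x.2 * errMean Z u x.1 i x.2) ^ 2) (whp μ) (𝓝 0) := by
  refine H.tendsto_of_integral_le (F := fun n q => avg fun i =>
    (devn (fun i => unitKernel μ (X n) (Z n) (u n) i (q.1 i)) q.1 a i (q.2 i) * sMean q.1 (fun j => (q.2 j).2) i) ^ 2)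
    (fun n => ?_) (fun n q => avg_nonneg fun i => sq_nonneg _) (G := fun n z => (n : ℝ)⁻¹ * (48 * M * (strata z).card))
    (H.tendsto_lintegral_strata (48 * M)) fun n ω hω => ⟨?_, ?_⟩
  · exact (Finset.measurable_fun_sum _ fun i _ => ((measurable_devn_kernel (by fun_prop) (by fun_prop) a i).mul
      (measurable_sMean (by fun_prop) (by fun_prop) i)).pow_const 2).const_mul _
  · exact (integrable_sum_sq_devn_mul _ _ hω a).const_mul _
  · simp only [avg, integral_const_mul]
    exact mul_le_mul_of_nonneg_left (integral_sum_sq_devn_mul_le _ _ hω a) (by positivity)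

theorem UnitArray.tendsto_err_u (a : Fin k) :
    Tendsto (fun x : ℕ × Ω => avg fun i => (u x.1 i x.2 * err μ X Z u x.1 i a x.2) ^ 2) (whp μ) (𝓝 0) := by
  refine H.tendsto_of_integral_le (F := fun n q => avg fun i =>
    ((q.2 i).2 * meanErr (fun i => unitKernel μ (X n) (Z n) (u n) i (q.1 i)) q.1 q.2 a i) ^ 2)
    (fun n => ?_) (fun n q => avg_nonneg fun i => sq_nonneg _) (G := fun n z => (n : ℝ)⁻¹ * (48 * M * (strata z).card))
    (H.tendsto_lintegral_strata (48 * M)) fun n ω hω => ⟨?_, ?_⟩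
  · refine (Finset.measurable_fun_sum _ fun i _ => (Measurable.mul ?_
      (measurable_meanErr_kernel (by fun_prop) (by fun_prop) a i)).pow_const 2).const_mul _
    fun_prop
  · exact (integrable_sum_sq_u_mul_meanErr _ _ hω a).const_mul _
  · simp only [avg, integral_const_mul]
    exact mul_le_mul_of_nonneg_left (integral_sum_sq_u_mul_meanErr_le _ _ hω a) (by positivity)

theorem UnitArray.tendsto_err_mean (a : Fin k) :
    Tendsto (fun x : ℕ × Ω => avg fun i => (err μ X Z u x.1 i a x.2 * errMean Z u x.1 i x.2) ^ 2) (whp μ) (𝓝 0) := by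
  refine H.tendsto_of_integral_le (F := fun n q => avg fun i =>
    (meanErr (fun i => unitKernel μ (X n) (Z n) (u n) i (q.1 i)) q.1 q.2 a i * sMean q.1 (fun j => (q.2 j).2) i) ^ 2)
    (fun n => ?_) (fun n q => avg_nonneg fun i => sq_nonneg _) (G := fun n z => (n : ℝ)⁻¹ * (48 * M * (strata z).card))
    (H.tendsto_lintegral_strata (48 * M)) fun n ω hω => ⟨?_, ?_⟩
  · exact (Finset.measurable_fun_sum _ fun i _ => ((measurable_meanErr_kernel (by fun_prop) (by fun_prop) a i).mul
      (measurable_sMean (by fun_prop) (by fun_prop) i)).pow_const 2).const_mul _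
  · exact (integrable_sum_sq_meanErr_mul _ _ hω a).const_mul _
  · simp only [avg, integral_const_mul]
    exact mul_le_mul_of_nonneg_left (integral_sum_sq_meanErr_mul_le _ _ hω a) (by positivity)

theorem UnitArray.tendsto_remainder (a : Fin k) :
    Tendsto (fun x : ℕ × Ω => (x.1 : ℝ)⁻¹ * (∑ i, err μ X Z u x.1 i a x.2 * errMean Z u x.1 i x.2) ^ 2) (whp μ) (𝓝 0) := by
  refine H.tendsto_of_integral_le (F := fun n q => (n : ℝ)⁻¹ * (∑ i,
    meanErr (fun i => unitKernel μ (X n) (Z n) (u n) i (q.1 i)) q.1 q.2 a i * sMean q.1 (fun j => (q.2 j).2) i) ^ 2)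
    (fun n => ?_) (fun n q => by positivity) (G := fun n z => (n : ℝ)⁻¹ * (240 * M * (strata z).card))
    (H.tendsto_lintegral_strata (240 * M)) fun n ω hω => ⟨?_, ?_⟩
  · exact ((Finset.measurable_fun_sum _ fun i _ => (measurable_meanErr_kernel (by fun_prop) (by fun_prop) a i).mul
      (measurable_sMean (by fun_prop) (by fun_prop) i)).pow_const 2).const_mul _
  · exact (integrable_sq_sum_meanErr_mul _ _ hω a).const_mul _
  · rw [integral_const_mul]
    exact mul_le_mul_of_nonneg_left (integral_sq_sum_meanErr_mul_le _ _ hω a) (by positivity)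

omit H in
theorem avg_sub_omegaOf_eq {n : ℕ} (P : Fin n → Measure (Vec k × ℝ)) (z : Fin n → Vec p) (a b : Fin k) (f : Fin n → ℝ) :
    |avg f - omegaOf P z a b| = (n : ℝ)⁻¹ * |∑ i, f i - n * omegaOf P z a b| := by
  rcases Nat.eq_zero_or_pos n with h | h
  · subst h; simp [avg, omegaOf]
  · have : (n : ℝ) ≠ 0 := by positivity
    have e : avg f - omegaOf P z a b = (n : ℝ)⁻¹ * (∑ i, f i - n * omegaOf P z a b) := by
      rw [avg, mul_sub, inv_mul_cancel_left₀ this]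
    rw [e, abs_mul, abs_of_nonneg (show (0 : ℝ) ≤ (n : ℝ)⁻¹ by positivity)]

/-- The average of `(X_i - m_i) (X_i - m_i)' u_i ^ 2` approaches `Ω_n`. -/
theorem UnitArray.tendsto_score_gram (a b : Fin k) :
    Tendsto (fun x : ℕ × Ω => (avg fun i => dev μ X Z u x.1 i a x.2 * dev μ X Z u x.1 i b x.2 * u x.1 i x.2 ^ 2) -
      condOmega μ X Z u x.1 x.2 a b) (whp μ) (𝓝 0) := by
  refine (tendsto_zero_iff_abs_tendsto_zero _).2 ?_
  set C := 2 + 2 * (k : ℝ) * (1 + M) with hC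
  -- truncation of the envelope at the level `n ^ (1/4)`
  set b' : ℕ → ℝ := fun n => (n : ℝ)⁻¹ * (√n * (C * √√n) + n * (2 * (C * ρ (√√n)))) with hb
  have hb0 : Tendsto b' atTop (𝓝 0) := by
    have s1 : Tendsto (fun n : ℕ => √√(n : ℝ)) atTop atTop :=
      Real.tendsto_sqrt_atTop.comp (Real.tendsto_sqrt_atTop.comp tendsto_natCast_atTop_atTop)
    have h1 : Tendsto (fun n : ℕ => C * (√√(n : ℝ))⁻¹ + 2 * (C * ρ (√√n))) atTop (𝓝 (C * 0 + 2 * (C * 0))) :=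
      ((tendsto_inv_atTop_zero.comp s1).const_mul C).add (((H.tail.comp s1).const_mul C).const_mul 2)
    simp only [mul_zero, add_zero] at h1
    refine h1.congr' ?_
    filter_upwards [eventually_ge_atTop 1] with n hn
    have hn' : (0 : ℝ) < n := by exact_mod_cast hn
    have hs : (0 : ℝ) < √√(n : ℝ) := by positivity
    have e1 : √(n : ℝ) = √√(n : ℝ) ^ 2 := (Real.sq_sqrt (Real.sqrt_nonneg _)).symm
    have e2 : (n : ℝ) = √√(n : ℝ) ^ 4 := by
      rw [show (4 : ℕ) = 2 * 2 by norm_num, pow_mul, ← e1, Real.sq_sqrt hn'.le]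
    simp only [hb]
    set s := √√(n : ℝ)
    rw [e1, e2]
    field_simp
  refine H.tendsto_of_integral_le (F := fun n q => |(avg fun i => devn (fun i => unitKernel μ (X n) (Z n) (u n) i (q.1 i)) q.1 a i (q.2 i) *
      devn (fun i => unitKernel μ (X n) (Z n) (u n) i (q.1 i)) q.1 b i (q.2 i) * (q.2 i).2 ^ 2) -
      omegaOf (fun i => unitKernel μ (X n) (Z n) (u n) i (q.1 i)) q.1 a b|)
    (fun n => ?_) (fun n q => abs_nonneg _) (G := fun n _ => if n = 0 then 0 else b' n) ?_ fun n ω hω => ⟨?_, ?_⟩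
  · have hm : Measurable fun q : (Fin n → Vec p) × (Fin n → Vec k × ℝ) => (avg fun i => devn (fun i => unitKernel μ (X n) (Z n) (u n) i (q.1 i)) q.1 a i (q.2 i) *
      devn (fun i => unitKernel μ (X n) (Z n) (u n) i (q.1 i)) q.1 b i (q.2 i) * (q.2 i).2 ^ 2) -
      omegaOf (fun i => unitKernel μ (X n) (Z n) (u n) i (q.1 i)) q.1 a b := by
      refine Measurable.sub (Measurable.const_mul (Finset.measurable_fun_sum _ fun i _ => ?_) _) (measurable_omegaOf_kernel (by fun_prop) a b)
      exact ((measurable_devn_kernel (by fun_prop) (by fun_prop) a i).mul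
        (measurable_devn_kernel (by fun_prop) (by fun_prop) b i)).mul (by fun_prop)
    exact hm.norm
  · simp only [lintegral_const, measure_univ, mul_one]
    rw [← ENNReal.ofReal_zero]
    refine ENNReal.tendsto_ofReal (hb0.congr' ?_)
    filter_upwards [eventually_ge_atTop 1] with n hn
    rw [if_neg (by omega)]
  · simp_rw [avg_sub_omegaOf_eq]
    exact (integrable_abs_sum_devn_sub _ _ hω a b _).const_mul _
  · simp_rw [avg_sub_omegaOf_eq]
    rw [integral_const_mul]
    split_ifs with h0
    · subst h0; simp
    · have hn' : (0 : ℝ) < n := by positivity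
      exact mul_le_mul_of_nonneg_left (integral_abs_sum_devn_sub_le _ _ hω a b (by positivity)) (by positivity)

theorem UnitArray.bddP_score (a : Fin k) :
    BddP μ fun x => (√(x.1 : ℝ))⁻¹ * ∑ i, dev μ X Z u x.1 i a x.2 * u x.1 i x.2 := by
  have h := H.bddP_of_integral_le (F := fun n q => (n : ℝ)⁻¹ * (∑ i,
    devn (fun i => unitKernel μ (X n) (Z n) (u n) i (q.1 i)) q.1 a i (q.2 i) * (q.2 i).2) ^ 2) (C := 16 * M)
    (fun n => ?_) (fun n q => by positivity) fun n ω hω => ⟨?_, ?_⟩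
  · refine ((BddP.const 1).add h).mono (Eventually.of_forall fun x => ?_)
    have e1 : ((√(x.1 : ℝ))⁻¹ * ∑ i, dev μ X Z u x.1 i a x.2 * u x.1 i x.2) ^ 2 =
        (x.1 : ℝ)⁻¹ * (∑ i, dev μ X Z u x.1 i a x.2 * u x.1 i x.2) ^ 2 := by
      rw [mul_pow, inv_pow, Real.sq_sqrt (by positivity)]
    change _ ≤ |1 + (x.1 : ℝ)⁻¹ * (∑ i, dev μ X Z u x.1 i a x.2 * u x.1 i x.2) ^ 2|
    rw [← e1]
    set t := (√(x.1 : ℝ))⁻¹ * ∑ i, dev μ X Z u x.1 i a x.2 * u x.1 i x.2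
    rw [abs_of_nonneg (a := 1 + _) (by positivity), ← sq_abs t]
    nlinarith [sq_nonneg (|t| - 1), abs_nonneg t]
  · refine ((Finset.measurable_fun_sum _ fun i _ => (measurable_devn_kernel (by fun_prop) (by fun_prop) a i).mul
      ?_).pow_const 2).const_mul _
    fun_prop
  · exact (integrable_sq_sum_devn_mul _ _ hω a).const_mul _
  · rw [integral_const_mul]
    refine (mul_le_mul_of_nonneg_left (integral_sq_sum_devn_mul_le _ _ hω a) (by positivity)).trans ?_
    rcases Nat.eq_zero_or_pos n with h0 | h0
    · subst h0; simpa using H.nonneg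
    · have hn' : (n : ℝ) ≠ 0 := by positivity
      rw [mul_comm (16 * M), inv_mul_cancel_left₀ hn']

omit H [IsProbabilityMeasure μ] in
theorem bddP_avg_pow_four {f g : (n : ℕ) → Fin n → Ω → ℝ} (hf : ∀ n i, Measurable (f n i))
    (hle : ∀ n ω, ∑ i, f n i ω ^ 4 ≤ 16 * ∑ i, g n i ω ^ 4) {M : ℝ} (hM : 0 ≤ M)
    (hgi : ∀ n i, Integrable (fun ω => g n i ω ^ 4) μ) (hg : ∀ n i, ∫ ω, g n i ω ^ 4 ∂μ ≤ M) :
    BddP μ fun x => avg fun i => f x.1 i x.2 ^ 4 := by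
  have h0 : ∀ x : ℕ × Ω, 0 ≤ avg fun i => f x.1 i x.2 ^ 4 := fun x => avg_nonneg fun i => by positivity
  refine BddP.of_lintegral_le (C := 16 * M) h0 (fun n => ?_) fun n => ?_
  · change Measurable fun ω => (n : ℝ)⁻¹ * ∑ i, f n i ω ^ 4
    exact (Finset.measurable_fun_sum _ fun i _ => (hf n i).pow_const 4).const_mul _
  · have hi : Integrable (fun ω => (n : ℝ)⁻¹ * (16 * ∑ i, g n i ω ^ 4)) μ :=
      ((integrable_finsetSum _ fun i _ => hgi n i).const_mul 16).const_mul _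
    refine (lintegral_mono fun ω => ENNReal.ofReal_le_ofReal (mul_le_mul_of_nonneg_left (hle n ω) (by positivity))).trans ?_
    rw [← ofReal_integral_eq_lintegral_ofReal hi (ae_of_all _ fun ω => by positivity)]
    refine ENNReal.ofReal_le_ofReal ?_
    rw [integral_const_mul, integral_const_mul, integral_finsetSum _ fun i _ => hgi n i]
    have h2 := Finset.sum_le_sum fun i (_ : i ∈ Finset.univ) => hg n i
    simp only [Finset.sum_const, Finset.card_univ, Fintype.card_fin, nsmul_eq_mul] at h2
    rw [inv_mul_eq_div]
    refine div_le_of_le_mul₀ (Nat.cast_nonneg n) (by positivity) ?_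
    linarith

omit H in
theorem measurable_demeaned (hX : ∀ n i, Measurable (X n i)) (hZ : ∀ n i, Measurable (Z n i)) (n : ℕ) (i : Fin n) (a : Fin k) :
    Measurable fun ω => demeaned X Z n ω i a := by
  have hm : ∀ j, Measurable fun ω => X n j ω a := fun j => by
    have := hX n j
    fun_prop
  simp only [demeaned, Xtilde_apply]
  exact (hm i).sub (measurable_sMean (hZ n) hm i)

omit H in
theorem measurable_errMean (hZ : ∀ n i, Measurable (Z n i)) (hu : ∀ n i, Measurable (u n i)) (n : ℕ) (i : Fin n) :
    Measurable (errMean Z u n i) := measurable_sMean (hZ n) (hu n) i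

theorem UnitArray.bddP_fourth (a : Fin k) : BddP μ fun x => avg fun i => demeaned X Z x.1 x.2 i a ^ 4 := by
  have hi : ∀ n i, Integrable (fun ω => X n i ω a ^ 4) μ := fun n i => by
    have := H.measurable_X n i
    refine (H.x4_int n i).mono' (by fun_prop) (ae_of_all _ fun ω => ?_)
    rw [Real.norm_of_nonneg (by positivity)]
    exact coord_pow_four_le _ a
  refine bddP_avg_pow_four (f := fun n i ω => demeaned X Z n ω i a) (g := fun n i ω => X n i ω a)
    (fun n i => measurable_demeaned H.measurable_X H.measurable_Z n i a) (fun n ω => ?_) H.nonneg hi fun n i => ?_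
  · simp only [demeaned, Xtilde_apply]
    exact sum_demean_pow_four_le _ _
  · exact (integral_mono (hi n i) (H.x4_int n i) fun ω => coord_pow_four_le _ a).trans (H.x4_le n i)

theorem UnitArray.bddP_fourth_u : BddP μ fun x => avg fun i => (u x.1 i x.2 - errMean Z u x.1 i x.2) ^ 4 :=
  bddP_avg_pow_four (f := fun n i ω => u n i ω - errMean Z u n i ω) (g := u)
    (fun n i => (H.measurable_u n i).sub (measurable_errMean H.measurable_Z H.measurable_u n i))
    (fun _ _ => sum_demean_pow_four_le _ _) H.nonneg H.u4_int H.u4_le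

theorem UnitArray.bddP_condOmega (a : Fin k) : BddP μ fun x => condOmega μ X Z u x.1 x.2 a a := by
  refine (BddP.const ((2 + 2 * k * (1 + M)) * (1 + 2 * M))).mono (eventually_whp_of_ae fun n => ?_)
  filter_upwards [H.bounds n] with ω hω
  have hM := H.nonneg
  rw [abs_of_nonneg (a := _ * _) (by positivity)]
  simp only [condOmega, omegaOf, Matrix.of_apply]
  rw [abs_mul, abs_of_nonneg (show (0 : ℝ) ≤ (n : ℝ)⁻¹ by positivity), inv_mul_eq_div]
  refine div_le_of_le_mul₀ (Nat.cast_nonneg n) (by positivity) ((Finset.abs_sum_le_sum_abs _ _).trans ?_)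
  have h1 : ∀ i, |∫ e, devn (condLaw μ X Z u n ω) (fun j => Z n j ω) a i e * devn (condLaw μ X Z u n ω) (fun j => Z n j ω) a i e *
      e.2 ^ 2 ∂(condLaw μ X Z u n ω i)| ≤ (2 + 2 * k * (1 + M)) * (1 + 2 * M) := fun i => by
    refine abs_integral_le_integral_abs.trans ((integral_mono_of_nonneg (ae_of_all _ fun e => abs_nonneg _)
      ((hω i).integrable_envelope.const_mul (2 + 2 * k * (1 + M)))
      (ae_of_all _ fun e => abs_devn_mul_devn_mul_le _ _ hω a a i e)).trans ?_)
    rw [integral_const_mul]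
    exact mul_le_mul_of_nonneg_left (hω i).integral_envelope_le (by positivity)
  refine (Finset.sum_le_sum fun i _ => h1 i).trans (le_of_eq ?_)
  simp only [Finset.sum_const, Finset.card_univ, Fintype.card_fin, nsmul_eq_mul]
  ring

/-- The regressor moment matrix approaches its mean. -/
theorem UnitArray.tendsto_gram (a b : Fin k) :
    Tendsto (fun x : ℕ × Ω => (avg fun i => demeaned X Z x.1 x.2 i a * demeaned X Z x.1 x.2 i b) - meanGram μ (X x.1) (Z x.1) a b)
      (whp μ) (𝓝 0) := by
  refine (tendsto_zero_iff_abs_tendsto_zero _).2 ?_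
  change Tendsto (fun x : ℕ × Ω => |(avg fun i => demeaned X Z x.1 x.2 i a * demeaned X Z x.1 x.2 i b) -
    meanGram μ (X x.1) (Z x.1) a b|) (whp μ) (𝓝 0)
  have hm : ∀ n, Measurable fun ω => ∑ i, demeaned X Z n ω i a * demeaned X Z n ω i b := fun n =>
    Finset.measurable_fun_sum _ fun i _ => (measurable_demeaned H.measurable_X H.measurable_Z n i a).mul
      (measurable_demeaned H.measurable_X H.measurable_Z n i b)
  have e : ∀ n, meanGram μ (X n) (Z n) a b = (n : ℝ)⁻¹ * ∫ ω, ∑ i, demeaned X Z n ω i a * demeaned X Z n ω i b ∂μ := fun n => by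
    simp only [meanGram, Matrix.of_apply, Matrix.mul_apply, Matrix.transpose_apply, integral_const_mul, demeaned]
  have e2 : ∀ n ω, |(avg fun i => demeaned X Z n ω i a * demeaned X Z n ω i b) - meanGram μ (X n) (Z n) a b| =
      (n : ℝ)⁻¹ * |∑ i, demeaned X Z n ω i a * demeaned X Z n ω i b - ∫ ω, ∑ i, demeaned X Z n ω i a * demeaned X Z n ω i b ∂μ| := by
    intro n ω
    rw [e, avg, ← mul_sub, abs_mul, abs_of_nonneg (show (0 : ℝ) ≤ (n : ℝ)⁻¹ by positivity)]
  refine tendsto_whp_zero_of_lintegral (fun x => abs_nonneg _) (fun n => ?_) ?_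
  · change Measurable fun ω => |(n : ℝ)⁻¹ * (∑ i, demeaned X Z n ω i a * demeaned X Z n ω i b) - meanGram μ (X n) (Z n) a b|
    exact (((hm n).const_mul _).sub_const _).norm
  have hlim : Tendsto (fun n : ℕ => ENNReal.ofReal ((n : ℝ)⁻¹ * (24 * √(M * n)))) atTop (𝓝 0) := by
    have h1 : Tendsto (fun n : ℕ => 24 * √M * (√(n : ℝ))⁻¹) atTop (𝓝 0) := by
      simpa using (tendsto_inv_atTop_zero.comp (Real.tendsto_sqrt_atTop.comp tendsto_natCast_atTop_atTop)).const_mul (24 * √M)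
    rw [← ENNReal.ofReal_zero]
    refine ENNReal.tendsto_ofReal (h1.congr fun n => ?_)
    rw [Real.sqrt_mul H.nonneg, ← Real.sqrt_div_self]; ring
  refine tendsto_of_tendsto_of_tendsto_of_le_of_le tendsto_const_nhds hlim (fun _ => zero_le) fun n => ?_
  have hind : iIndepFun (fun i ω => (X n i ω, Z n i ω)) μ :=
    (H.indep n).comp (fun _ (t : Vec k × Vec p × ℝ) => (t.1, t.2.1)) fun _ => by fun_prop
  obtain ⟨g1, g2⟩ := integral_abs_gram_sub_le (H.measurable_X n) (H.measurable_Z n) hind (H.x4_int n) (H.x4_le n) a b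
  have hi : Integrable (fun ω => |∑ i, demeaned X Z n ω i a * demeaned X Z n ω i b -
      ∫ ω, ∑ i, demeaned X Z n ω i a * demeaned X Z n ω i b ∂μ|) μ := (g1.sub (integrable_const _)).abs
  simp only [e2]
  rw [← ofReal_integral_eq_lintegral_ofReal (hi.const_mul _) (ae_of_all _ fun ω => by positivity), integral_const_mul]
  exact ENNReal.ofReal_le_ofReal (mul_le_mul_of_nonneg_left g2 (by positivity))

theorem UnitArray.eventually_dev_sq_mul_le :
    ∀ᶠ x : ℕ × Ω in whp μ, ∀ i, (∑ a, dev μ X Z u x.1 i a x.2 ^ 2) * u x.1 i x.2 ^ 2 ≤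
      (2 + 2 * k * (1 + M)) * envelope (X x.1 i x.2, u x.1 i x.2) := by
  refine eventually_whp_of_ae fun n => ?_
  filter_upwards [H.bounds n] with ω hω i
  have := sum_sq_devn_le (condLaw μ X Z u n ω) (fun j => Z n j ω) hω i (X n i ω, u n i ω)
  simp only [envelope, dev]
  rw [← mul_assoc]
  exact mul_le_mul_of_nonneg_right this (sq_nonneg _)

/-- With probability at least one half, large values of the envelope contribute little to its average, by Markov's
inequality. -/
theorem UnitArray.envelope_tail {ε : ℝ} (hε : 0 < ε) : ∃ K > 0, ∀ n, 1 / 2 ≤ μ {ω |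
    (avg fun i => if K < envelope (X n i ω, u n i ω) then envelope (X n i ω, u n i ω) else 0) < ε} := by
  obtain ⟨K, hK, hK0⟩ := ((H.tail.abs.eventually_le_const (show |(0 : ℝ)| < ε / 2 by simpa using hε)).and (eventually_gt_atTop 0)).exists
  refine ⟨K, hK0, fun n => ?_⟩
  have hind : ∀ e : Vec k × ℝ, (if K < envelope e then envelope e else 0) = {e | K < envelope e}.indicator envelope e := fun e => by
    simp [Set.indicator_apply]
  have him : Measurable fun e : Vec k × ℝ => if K < envelope e then envelope e else 0 :=
    Measurable.ite (measurableSet_lt measurable_const measurable_envelope) measurable_envelope measurable_const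
  have hi0 : ∀ e : Vec k × ℝ, 0 ≤ if K < envelope e then envelope e else 0 := fun e => by
    split_ifs
    · exact envelope_nonneg e
    · exact le_rfl
  set F : (Fin n → Vec p) × (Fin n → Vec k × ℝ) → ℝ := fun q => avg fun i => if K < envelope (q.2 i) then envelope (q.2 i) else 0 with hF
  have hFm : Measurable F := (Finset.measurable_fun_sum _ fun i _ => him.comp (by fun_prop)).const_mul _
  have hle := lintegral_data_le (H.measurable_X n) (H.measurable_Z n) (H.measurable_u n) (H.indep n) hFm
    (fun q => avg_nonneg fun i => hi0 _) (G := fun _ => ε / 2) (by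
      filter_upwards [H.bounds n] with ω hω
      have hint : ∀ i, Integrable (fun e : Vec k × ℝ => if K < envelope e then envelope e else 0) (condLaw μ X Z u n ω i) := fun i => by
        simp_rw [hind]
        exact (hω i).integrable_envelope.indicator (measurableSet_lt measurable_const measurable_envelope)
      have hint' : ∀ i, Integrable (fun w : Fin n → Vec k × ℝ => if K < envelope (w i) then envelope (w i) else 0)
          (Measure.pi (condLaw μ X Z u n ω)) := fun i => integrable_pi_eval _ i (hint i)
      refine ⟨(integrable_finsetSum _ fun i _ => hint' i).const_mul _, ?_⟩
      change ∫ w, (n : ℝ)⁻¹ * ∑ i, (if K < envelope (w i) then envelope (w i) else 0) ∂(Measure.pi (condLaw μ X Z u n ω)) ≤ _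
      rw [integral_const_mul, integral_finsetSum _ fun i _ => hint' i, inv_mul_eq_div]
      refine div_le_of_le_mul₀ (Nat.cast_nonneg n) (by positivity) ?_
      have h1 : ∀ i, ∫ w : Fin n → Vec k × ℝ, (if K < envelope (w i) then envelope (w i) else 0) ∂(Measure.pi (condLaw μ X Z u n ω)) ≤ ε / 2 := fun i => by
        rw [integral_pi_eval (condLaw μ X Z u n ω) i him]
        simp_rw [hind]
        exact ((hω i).tail K hK0).trans ((le_abs_self _).trans hK)
      refine (Finset.sum_le_sum fun i _ => h1 i).trans (le_of_eq ?_)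
      simp only [Finset.sum_const, Finset.card_univ, Fintype.card_fin, nsmul_eq_mul]
      ring)
  have hmeas : Measurable fun ω => F (fun i => Z n i ω, fun i => (X n i ω, u n i ω)) := hFm.comp
    ((measurable_pi_lambda _ (H.measurable_Z n)).prodMk
      (measurable_pi_lambda _ fun i => (H.measurable_X n i).prodMk (H.measurable_u n i)))
  have h2 := meas_ge_le_lintegral_div (μ := μ) hmeas.ennreal_ofReal.aemeasurable (ε := ENNReal.ofReal ε) (by simpa using hε) ENNReal.ofReal_ne_top
  have h3 : μ {ω | ε ≤ F (fun i => Z n i ω, fun i => (X n i ω, u n i ω))} ≤ 1 / 2 := by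
    refine (measure_mono fun ω hω => ?_).trans (h2.trans ((ENNReal.div_le_div_right hle _).trans ?_))
    · exact ENNReal.ofReal_le_ofReal hω
    · simp only [lintegral_const, measure_univ, mul_one]
      rw [← ENNReal.ofReal_div_of_pos hε, show ε / 2 / ε = 1 / 2 by field_simp]
      rw [ENNReal.ofReal_div_of_pos (by norm_num)]; simp
  have h4 : {ω | F (fun i => Z n i ω, fun i => (X n i ω, u n i ω)) < ε} =
      {ω | ε ≤ F (fun i => Z n i ω, fun i => (X n i ω, u n i ω))}ᶜ := by ext ω; simp
  change 1 / 2 ≤ μ {ω | F (fun i => Z n i ω, fun i => (X n i ω, u n i ω)) < ε}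
  rw [h4, prob_compl_eq_one_sub (measurableSet_le measurable_const hmeas)]
  refine ENNReal.le_sub_of_add_le_right (measure_ne_top _ _) ((add_le_add le_rfl h3).trans ?_)
  rw [ENNReal.add_halves]

end array

/-! ### The central limit theorem for the normalized score -/

/-- If `φ` is within `ε` of a constant off the event `A`, then its mean is so up to the probability of `A`. The event need
not be measurable. -/
theorem norm_integral_sub_const_le {Ω : Type*} [MeasurableSpace Ω] {μ : Measure Ω} [IsProbabilityMeasure μ] {φ : Ω → ℂ} {c : ℂ}
    (hm : AEStronglyMeasurable φ μ) (hφ : ∀ ω, ‖φ ω‖ ≤ 1) (hc : ‖c‖ ≤ 1) {A : Set Ω} {ε : ℝ} (hε : 0 ≤ ε)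
    (h : ∀ᵐ ω ∂μ, ω ∉ A → ‖φ ω - c‖ ≤ ε) : ‖∫ ω, φ ω ∂μ - c‖ ≤ ε + 2 * μ.real A := by
  have hi : Integrable φ μ := (integrable_const (1 : ℝ)).mono' hm (ae_of_all _ hφ)
  have e : ∫ ω, φ ω ∂μ - c = ∫ ω, (φ ω - c) ∂μ := by
    rw [integral_sub hi (integrable_const c)]; simp
  have hA := measurableSet_toMeasurable μ A
  have hb : Integrable (fun ω => ε + (toMeasurable μ A).indicator (fun _ => (2 : ℝ)) ω) μ :=
    (integrable_const ε).fun_add ((integrable_const (2 : ℝ)).indicator hA)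
  rw [e]
  refine (norm_integral_le_of_norm_le hb ?_).trans (le_of_eq ?_)
  · filter_upwards [h] with ω hω
    by_cases hA' : ω ∈ toMeasurable μ A
    · rw [Set.indicator_of_mem hA']
      have := norm_sub_le (φ ω) c
      linarith [hφ ω]
    · rw [Set.indicator_of_notMem hA', add_zero]
      exact hω fun hA'' => hA' (subset_toMeasurable μ A hA'')
  · rw [integral_add (integrable_const ε) ((integrable_const (2 : ℝ)).indicator hA), integral_indicator_const _ hA]
    simp [Measure.real, mul_comm]

section clt
variable {Ω : Type*} [MeasurableSpace Ω] {μ : Measure Ω} [IsProbabilityMeasure μ] {k p : ℕ}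
    {X : (n : ℕ) → Fin n → Ω → Vec k} {Z : (n : ℕ) → Fin n → Ω → Vec p} {u : (n : ℕ) → Fin n → Ω → ℝ}
    {M : ℝ} {ρ : ℝ → ℝ} (H : UnitArray μ X Z u M ρ)

theorem inner_invSqrt_score {n : ℕ} {k : ℕ} (A : Matrix (Fin k) (Fin k) ℝ) (f : Fin n → Fin k → ℝ) (v : Fin n → ℝ) (t : Vec k) :
    inner ℝ (WithLp.toLp 2 (invSqrt A *ᵥ fun a => (√(n : ℝ))⁻¹ * ∑ i, f i a * v i) : Vec k) t =
      (√(n : ℝ))⁻¹ * ∑ i, (∑ a, (invSqrt A *ᵥ t.ofLp) a * f i a) * v i := by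
  have h1 : inner ℝ (WithLp.toLp 2 (invSqrt A *ᵥ fun a => (√(n : ℝ))⁻¹ * ∑ i, f i a * v i) : Vec k) t =
      t.ofLp ⬝ᵥ (invSqrt A *ᵥ fun a => (√(n : ℝ))⁻¹ * ∑ i, f i a * v i) := by
    simp [EuclideanSpace.inner_eq_star_dotProduct]
  rw [h1, dotProduct_mulVec_of_symm (invSqrt_transpose A)]
  simp only [dotProduct, Finset.mul_sum, Finset.sum_mul]
  rw [Finset.sum_comm]
  exact Finset.sum_congr rfl fun i _ => Finset.sum_congr rfl fun a _ => by ring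

include H in
/-- The characteristic function of the normalized score at a fixed sample size. The normalization depends on the
strata only, so that the bound for independent units with fixed strata applies conditionally. -/
theorem UnitArray.norm_charFun_sub_le {lam : ℝ} (hlam : 0 < lam) {n : ℕ} (hn : 0 < n) (t : Vec k) {η : ℝ} (hη : 0 < η) (hη1 : η ≤ 1)
    {B : ℝ} (hB0 : 0 < B) (hB : (2 + 2 * k * (1 + M)) * ((t.ofLp ⬝ᵥ t.ofLp) / lam) ≤ B) :
    ‖∫ ω, Complex.exp (((inner ℝ (WithLp.toLp 2 (invSqrt (condOmega μ X Z u n ω) *ᵥ fun a =>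
        (√(n : ℝ))⁻¹ * ∑ i, dev μ X Z u n i a ω * u n i ω) : Vec k) t : ℝ) : ℂ) * Complex.I) ∂μ -
      Complex.exp (-((t.ofLp ⬝ᵥ t.ofLp) / 2 : ℝ))‖ ≤
    η * (t.ofLp ⬝ᵥ t.ofLp) + 4 * (B * ρ (n * η ^ 2 / B)) + B / n * (1 + 2 * M) * (t.ofLp ⬝ᵥ t.ofLp) +
      2 * μ.real {ω | ¬ ∀ v : Fin k → ℝ, lam * (v ⬝ᵥ v) ≤ v ⬝ᵥ (condOmega μ X Z u n ω *ᵥ v)} := by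
  have hτ : 0 ≤ t.ofLp ⬝ᵥ t.ofLp := dotProduct_self_nonneg' _
  have hM := H.nonneg
  have hρ : 0 ≤ ρ (n * η ^ 2 / B) := by
    obtain ⟨ω, hω⟩ := (H.bounds n).exists
    exact (integral_nonneg fun e => Set.indicator_nonneg (fun e _ => envelope_nonneg e) e).trans
      ((hω ⟨0, hn⟩).tail _ (by positivity))
  set Om : (Fin n → Vec p) → Matrix (Fin k) (Fin k) ℝ := fun z =>
    omegaOf (fun i => unitKernel μ (X n) (Z n) (u n) i (z i)) z with hOm
  set L : (Fin n → Vec p) × (Fin n → Vec k × ℝ) → ℝ := fun q => (√(n : ℝ))⁻¹ * ∑ i, (∑ a, (invSqrt (Om q.1) *ᵥ t.ofLp) a *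
    devn (fun i => unitKernel μ (X n) (Z n) (u n) i (q.1 i)) q.1 a i (q.2 i)) * (q.2 i).2 with hL
  have hθm : ∀ a, Measurable fun q : (Fin n → Vec p) × (Fin n → Vec k × ℝ) => (invSqrt (Om q.1) *ᵥ t.ofLp) a := fun a => by
    change Measurable fun q : (Fin n → Vec p) × (Fin n → Vec k × ℝ) => ∑ b, invSqrt (Om q.1) a b * t.ofLp b
    exact Finset.measurable_fun_sum _ fun b _ => (measurable_invSqrt_apply (fun q => omegaOf_isHermitian _ _)
      (fun a b => measurable_omegaOf_kernel (by fun_prop) a b) a b).mul_const _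
  have hLm : Measurable L := by
    refine (Finset.measurable_fun_sum _ fun i _ => (Finset.measurable_fun_sum _ fun a _ => (hθm a).mul
      (measurable_devn_kernel (by fun_prop) (by fun_prop) a i)).mul ?_).const_mul _
    fun_prop
  have hFm : Measurable fun q => Complex.exp ((L q : ℂ) * Complex.I) :=
    Complex.measurable_exp.comp ((Complex.measurable_ofReal.comp hLm).mul_const _)
  have hdm : Measurable fun ω => ((fun i => Z n i ω, fun i => (X n i ω, u n i ω)) : (Fin n → Vec p) × (Fin n → Vec k × ℝ)) :=
    (measurable_pi_lambda _ (H.measurable_Z n)).prodMk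
      (measurable_pi_lambda _ fun i => (H.measurable_X n i).prodMk (H.measurable_u n i))
  have hF1 : ∀ q, ‖Complex.exp ((L q : ℂ) * Complex.I)‖ ≤ 1 := fun q => (Complex.norm_exp_ofReal_mul_I _).le
  have e1 : ∀ ω, Complex.exp (((inner ℝ (WithLp.toLp 2 (invSqrt (condOmega μ X Z u n ω) *ᵥ fun a =>
        (√(n : ℝ))⁻¹ * ∑ i, dev μ X Z u n i a ω * u n i ω) : Vec k) t : ℝ) : ℂ) * Complex.I) =
      Complex.exp ((L (fun i => Z n i ω, fun i => (X n i ω, u n i ω)) : ℂ) * Complex.I) := fun ω => by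
    rw [inner_invSqrt_score (condOmega μ X Z u n ω) (fun i a => dev μ X Z u n i a ω)]
    rfl
  simp_rw [e1]
  rw [integral_data (H.measurable_X n) (H.measurable_Z n) (H.measurable_u n) (H.indep n)
    (F := fun q => Complex.exp ((L q : ℂ) * Complex.I)) hFm.stronglyMeasurable
    ((integrable_const (1 : ℝ)).mono' (hFm.comp hdm).aestronglyMeasurable (ae_of_all _ fun ω => hF1 _))]
  refine norm_integral_sub_const_le ?_ (fun ω => ?_) ?_ (by positivity) ?_
  · have h1 := hFm.stronglyMeasurable.integral_kernel_prod_right' (κ := piKernel (unitKernel μ (X n) (Z n) (u n)))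
    exact (h1.comp_measurable (measurable_pi_lambda _ (H.measurable_Z n))).aestronglyMeasurable
  · refine (norm_integral_le_of_norm_le_const (C := 1) (ae_of_all _ fun w => hF1 _)).trans ?_
    simp
  · rw [← Complex.ofReal_neg, ← Complex.ofReal_exp, Complex.norm_real, Real.norm_of_nonneg (Real.exp_pos _).le]
    exact Real.exp_le_one_iff.2 (by linarith)
  · filter_upwards [H.bounds n] with ω hω hA
    have hA' : ∀ v : Fin k → ℝ, lam * (v ⬝ᵥ v) ≤ v ⬝ᵥ (condOmega μ X Z u n ω *ᵥ v) := not_not.1 hA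
    have hH : (condOmega μ X Z u n ω).IsHermitian := omegaOf_isHermitian _ _
    -- in the direction `Ω_n ^ (-1 / 2) t` the form of `Ω_n` does not depend on the strata
    have q1 : (invSqrt (condOmega μ X Z u n ω) *ᵥ t.ofLp) ⬝ᵥ (condOmega μ X Z u n ω *ᵥ (invSqrt (condOmega μ X Z u n ω) *ᵥ t.ofLp)) =
        t.ofLp ⬝ᵥ t.ofLp := by
      rw [← dotProduct_mulVec_of_symm (invSqrt_transpose _), Matrix.mulVec_mulVec, Matrix.mulVec_mulVec,
        invSqrt_mul_mul_invSqrt hH hlam hA', Matrix.one_mulVec]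
    have q2 : (invSqrt (condOmega μ X Z u n ω) *ᵥ t.ofLp) ⬝ᵥ (invSqrt (condOmega μ X Z u n ω) *ᵥ t.ofLp) ≤
        (t.ofLp ⬝ᵥ t.ofLp) / lam := by
      rw [le_div_iff₀ hlam, mul_comm]
      exact invSqrt_mulVec_self_le hH hlam hA' _
    have h3 := norm_charFun_score_sub_le (condLaw μ X Z u n ω) (fun j => Z n j ω) hω hn
      (invSqrt (condOmega μ X Z u n ω) *ᵥ t.ofLp) hη hη1 hB0
      ((mul_le_mul_of_nonneg_left q2 (by positivity)).trans hB)
    change ‖_ - Complex.exp (-(((invSqrt (condOmega μ X Z u n ω) *ᵥ t.ofLp) ⬝ᵥ (condOmega μ X Z u n ω *ᵥ (invSqrt (condOmega μ X Z u n ω) *ᵥ t.ofLp))) / 2 : ℝ))‖ ≤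
      η * ((invSqrt (condOmega μ X Z u n ω) *ᵥ t.ofLp) ⬝ᵥ (condOmega μ X Z u n ω *ᵥ (invSqrt (condOmega μ X Z u n ω) *ᵥ t.ofLp))) + _ +
      B / n * (1 + 2 * M) * ((invSqrt (condOmega μ X Z u n ω) *ᵥ t.ofLp) ⬝ᵥ (condOmega μ X Z u n ω *ᵥ (invSqrt (condOmega μ X Z u n ω) *ᵥ t.ofLp))) at h3
    rw [q1] at h3
    exact h3

include H in
theorem UnitArray.measurable_normalized_score (n : ℕ) :
    Measurable fun ω => (WithLp.toLp 2 (invSqrt (condOmega μ X Z u n ω) *ᵥ fun a =>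
        (√(n : ℝ))⁻¹ * ∑ i, dev μ X Z u n i a ω * u n i ω) : Vec k) := by
  refine (WithLp.measurable_toLp 2 (Fin k → ℝ)).comp (measurable_pi_lambda _ fun a => ?_)
  change Measurable fun ω => ∑ b, invSqrt (condOmega μ X Z u n ω) a b * ((√(n : ℝ))⁻¹ * ∑ i, dev μ X Z u n i b ω * u n i ω)
  refine Finset.measurable_fun_sum _ fun b _ => (measurable_invSqrt_apply (fun ω => omegaOf_isHermitian _ _)
      (fun a b => measurable_omegaOf_kernel (H.measurable_Z n) a b) a b).mul ?_
  refine (Finset.measurable_fun_sum _ fun i _ => (measurable_devn_kernel (H.measurable_Z n) ?_ b i).mul (H.measurable_u n i)).const_mul _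
  exact (H.measurable_X n i).prodMk (H.measurable_u n i)

include H in
/-- The leading score normalized by `Ω_n ^ (-1 / 2)` is asymptotically standard Gaussian, by pointwise convergence of
characteristic functions. -/
theorem UnitArray.tendstoInDistribution_score {lam : ℝ} (hlam : 0 < lam)
    (hOm : ∀ᶠ x : ℕ × Ω in whp μ, ∀ v : Fin k → ℝ, lam * (v ⬝ᵥ v) ≤ v ⬝ᵥ (condOmega μ X Z u x.1 x.2 *ᵥ v)) :
    TendstoInDistribution (fun n ω => (WithLp.toLp 2 (invSqrt (condOmega μ X Z u n ω) *ᵥ fun a =>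
        (√(n : ℝ))⁻¹ * ∑ i, dev μ X Z u n i a ω * u n i ω) : Vec k)) atTop id (fun _ => μ) (stdGaussian (Vec k)) where
  forall_aemeasurable n := (H.measurable_normalized_score n).aemeasurable
  tendsto := by
    refine ProbabilityMeasure.tendsto_iff_tendsto_charFun.2 fun t => ?_
    rw! [Measure.map_id]
    simp only [ProbabilityMeasure.coe_mk, charFun_stdGaussian]
    rw [Metric.tendsto_atTop']
    intro ε hε
    obtain ⟨τ, hτ⟩ : ∃ τ, τ = t.ofLp ⬝ᵥ t.ofLp := ⟨_, rfl⟩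
    have hτ0 : 0 ≤ τ := hτ ▸ dotProduct_self_nonneg' _
    have hnorm : ‖t‖ ^ 2 = τ := by rw [hτ, EuclideanSpace.real_norm_sq_eq]; simp [dotProduct, sq]
    have hM := H.nonneg
    obtain ⟨B, hB⟩ : ∃ B, B = (2 + 2 * k * (1 + M)) * (τ / lam) + 1 := ⟨_, rfl⟩
    have hB0 : 0 < B := by rw [hB]; positivity
    -- `η` controls the only term of the bound that does not vanish as `n → ∞`
    obtain ⟨η, hη, hη1, hητ⟩ : ∃ η : ℝ, 0 < η ∧ η ≤ 1 ∧ η * τ < ε / 2 := by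
      refine ⟨min 1 (ε / (4 * (τ + 1))), by positivity, min_le_left _ _, ?_⟩
      have h1 : ε / (4 * (τ + 1)) * τ ≤ ε / 4 := by
        rw [div_mul_eq_mul_div, div_le_div_iff₀ (by positivity) (by norm_num)]
        nlinarith
      calc _ ≤ ε / (4 * (τ + 1)) * τ := mul_le_mul_of_nonneg_right (min_le_right _ _) hτ0
        _ < ε / 2 := by linarith
    have hbad : Tendsto (fun n => μ.real {ω | ¬ ∀ v : Fin k → ℝ, lam * (v ⬝ᵥ v) ≤ v ⬝ᵥ (condOmega μ X Z u n ω *ᵥ v)}) atTop (𝓝 0) := by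
      have h1 := (ENNReal.tendsto_toReal (by simp : (0 : ENNReal) ≠ ⊤)).comp (eventually_whp.1 hOm)
      rw [ENNReal.toReal_zero] at h1
      exact h1.congr fun _ => rfl
    have hlim : Tendsto (fun n : ℕ => 4 * (B * |ρ (n * η ^ 2 / B)|) + B / n * (1 + 2 * M) * τ +
        2 * μ.real {ω | ¬ ∀ v : Fin k → ℝ, lam * (v ⬝ᵥ v) ≤ v ⬝ᵥ (condOmega μ X Z u n ω *ᵥ v)}) atTop (𝓝 0) := by
      have h1 : Tendsto (fun n : ℕ => (n : ℝ) * η ^ 2 / B) atTop atTop :=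
        ((tendsto_natCast_atTop_atTop).atTop_mul_const (by positivity)).atTop_div_const hB0
      have h2 := (((H.tail.comp h1).abs.const_mul B).const_mul 4).add
        (((tendsto_const_div_atTop_nhds_zero_nat B).mul_const (1 + 2 * M)).mul_const τ) |>.add (hbad.const_mul 2)
      simpa using h2
    obtain ⟨N, hN⟩ := (Filter.eventually_atTop.1 (hlim.eventually_lt_const (show 0 < ε / 2 by positivity)))
    refine ⟨N + 1, fun n hn => ?_⟩
    have hn0 : 0 < n := by omega
    have h1 := H.norm_charFun_sub_le hlam hn0 t hη hη1 hB0 (by rw [← hτ, hB]; linarith)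
    have h2 := hN n (by omega)
    rw [← hτ] at h1
    have h3 : 4 * (B * ρ (n * η ^ 2 / B)) ≤ 4 * (B * |ρ (n * η ^ 2 / B)|) := by
      gcongr
      exact le_abs_self _
    rw [charFun_apply, integral_map (H.measurable_normalized_score n).aemeasurable (by fun_prop), dist_eq_norm]
    have e : Complex.exp (-((‖t‖ : ℂ) ^ 2 / 2)) = Complex.exp (-((τ / 2 : ℝ) : ℂ)) := by
      rw [← hnorm]; push_cast; rfl
    rw [neg_div, e]
    linarith

end clt

/-! ### The array of the model -/

section assembly
variable {Ω : Type*} [MeasurableSpace Ω] {μ : Measure Ω} [IsProbabilityMeasure μ] {k p : ℕ}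
    {X : (n : ℕ) → Fin n → Ω → Vec k} {Z : (n : ℕ) → Fin n → Ω → Vec p} {u : (n : ℕ) → Fin n → Ω → ℝ}

/-- Arrays of independent units with few strata and nondegenerate `Ω_n` satisfy all limit facts. -/
theorem UnitArray.waldLimits {M : ℝ} {ρ : ℝ → ℝ} (H : UnitArray μ X Z u M ρ) {lam : ℝ} (hlam : 0 < lam)
    (hOm : ∀ᶠ x : ℕ × Ω in whp μ, ∀ v : Fin k → ℝ, lam * (v ⬝ᵥ v) ≤ v ⬝ᵥ (condOmega μ X Z u x.1 x.2 *ᵥ v)) :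
    WaldLimits μ (demeaned X Z) (dev μ X Z u) (err μ X Z u) u (errMean Z u) (condOmega μ X Z u)
      (fun n => meanGram μ (X n) (Z n)) lam where
  measurable_Y := measurable_demeaned H.measurable_X H.measurable_Z
  measurable_u := H.measurable_u
  measurable_r := measurable_errMean H.measurable_Z H.measurable_u
  measurable_Om n a b := measurable_omegaOf_kernel (H.measurable_Z n) a b
  split n i a ω := by
    simp only [demeaned, Xtilde_apply, dev, err, devn, meanErr, sMean_sub]
    ring
  sum_split n a ω := by
    have h := sum_Xtilde_mul_demean (fun i => X n i ω) (fun i => Z n i ω) (fun i => u n i ω) (unitMean (condLaw μ X Z u n ω) a) a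
    exact h
  dev_mean := H.tendsto_dev_mean
  err_u := H.tendsto_err_u
  err_mean := H.tendsto_err_mean
  remainder := H.tendsto_remainder
  score_gram := H.tendsto_score_gram
  gram := H.tendsto_gram
  fourth := H.bddP_fourth
  fourth_u := H.bddP_fourth_u
  score_bdd := H.bddP_score
  om_bdd := H.bddP_condOmega
  om_herm _ _ := omegaOf_isHermitian _ _
  lam_pos := hlam
  om_ge := hOm
  clt := H.tendstoInDistribution_score hlam hOm

omit [MeasurableSpace Ω] in
theorem integral_pow_four_le {m' : MeasurableSpace Ω} {mΩ : MeasurableSpace Ω} (hm' : m' ≤ mΩ) {μ : Measure Ω} [IsProbabilityMeasure μ]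
    {f : Ω → ℝ} (hf : Measurable f) (hf0 : ∀ ω, 0 ≤ f ω) {m M₀ : ℝ} (hm : 2 < m)
    (hi : Integrable (fun ω => f ω ^ (2 * m)) μ) (hM : ∀ᵐ ω ∂μ, (μ[fun ω' => f ω' ^ (2 * m) | m']) ω < M₀) :
    Integrable (fun ω => f ω ^ 4) μ ∧ ∫ ω, f ω ^ 4 ∂μ ≤ 1 + M₀ := by
  have h1 := (integrable_const (1 : ℝ) (μ := μ)).fun_add hi
  have h4 : Integrable (fun ω => f ω ^ 4) μ := by
    refine h1.mono' (by fun_prop) (ae_of_all _ fun ω => ?_)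
    rw [Real.norm_of_nonneg (by positivity)]
    exact pow_four_le_one_add_rpow hm (hf0 ω)
  refine ⟨h4, (integral_mono h4 h1 fun ω => pow_four_le_one_add_rpow hm (hf0 ω)).trans ?_⟩
  rw [integral_add (integrable_const _) hi, ← integral_condExp hm' (f := fun ω => f ω ^ (2 * m))]
  have h2 : ∫ ω, (μ[fun ω' => f ω' ^ (2 * m) | m']) ω ∂μ ≤ ∫ _, M₀ ∂μ :=
    integral_mono_ae integrable_condExp (integrable_const _) (hM.mono fun ω h => h.le)
  simpa using h2

/-- Moments of order `2 m` with `m > 2` give the fourth moments and the uniform integrability of an array. -/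
theorem LargeSample.exists_unitArray {c : ℕ → ℝ} (hA : LargeSample μ c X Z u) :
    ∃ (M : ℝ) (ρ : ℝ → ℝ), UnitArray μ X Z u M ρ := by
  obtain ⟨m, hm, M₀, hmom⟩ := hA.moments
  have hb : ∀ n, ∀ᵐ ω ∂μ, ∀ i, UnitBounds (unitKernel μ (X n) (Z n) (u n) i (Z n i ω)) (1 + M₀) (tailBound m M₀) := fun n =>
    ae_all_iff.2 fun i => ae_unitBounds (hA.measurable_X n i) (hA.measurable_Z n i) (hA.measurable_u n i) hm
      (hmom n i).1 (hmom n i).2.1 (hmom n i).2.2.1 (hmom n i).2.2.2 (hA.exog_X n i) (hA.exog_one n i)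
  have hx : ∀ n i, Integrable (fun ω => ‖X n i ω‖ ^ 4) μ ∧ ∫ ω, ‖X n i ω‖ ^ 4 ∂μ ≤ 1 + M₀ := fun n i =>
    integral_pow_four_le (hA.measurable_Z n i).comap_le (hA.measurable_X n i).norm (fun _ => norm_nonneg _) hm (hmom n i).1 (hmom n i).2.2.1
  have hu : ∀ n i, Integrable (fun ω => u n i ω ^ 4) μ ∧ ∫ ω, u n i ω ^ 4 ∂μ ≤ 1 + M₀ := fun n i => by
    have h := integral_pow_four_le (hA.measurable_Z n i).comap_le (hA.measurable_u n i).norm (fun _ => norm_nonneg _) hm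
      (hmom n i).2.1 (hmom n i).2.2.2
    simpa only [Real.norm_eq_abs, (by decide : Even 4).pow_abs] using h
  refine ⟨1 + M₀, tailBound m M₀, hA.measurable_X, hA.measurable_Z, hA.measurable_u, hA.indep, hb, tendsto_tailBound hm,
    fun n i => (hx n i).1, fun n i => (hx n i).2, fun n i => (hu n i).1, fun n i => (hu n i).2, hA.few_strata, ?_⟩
  obtain ⟨ω, hω⟩ := (hb 1).exists
  exact (hω 0).nonneg

theorem UnitArray.ae_omegaMat_eq_condOmega {M : ℝ} {ρ : ℝ → ℝ} (H : UnitArray μ X Z u M ρ) (n : ℕ) :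
    ∀ᵐ ω ∂μ, omegaMat μ (X n) (Z n) (u n) ω = condOmega μ X Z u n ω :=
  ae_omegaMat_eq (H.measurable_X n) (H.measurable_Z n) (H.measurable_u n) (H.indep n) (H.x4_int n) (H.u4_int n) (H.bounds n)

/-- An almost sure lower bound on the lower limit of the smallest eigenvalue bounds the quadratic form with
probability tending to one. -/
theorem UnitArray.eventually_le_condOmega {M : ℝ} {ρ : ℝ → ℝ} (H : UnitArray μ X Z u M ρ) {lam : ℝ}
    (h : ∀ᵐ ω ∂μ, (lam : EReal) < liminf (fun n => ((lambdaMin (omegaMat μ (X n) (Z n) (u n) ω) : ℝ) : EReal)) atTop) :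
    ∀ᶠ x : ℕ × Ω in whp μ, ∀ v : Fin k → ℝ, lam * (v ⬝ᵥ v) ≤ v ⬝ᵥ (condOmega μ X Z u x.1 x.2 *ᵥ v) := by
  refine eventually_whp_of_ae_eventually (fun n => ?_) ?_
  · have hcl : IsClosed {A : Fin k → Fin k → ℝ | ∀ v : Fin k → ℝ, lam * (v ⬝ᵥ v) ≤ v ⬝ᵥ (Matrix.of A *ᵥ v)} := by
      simp only [Set.ofPred_forall]
      refine isClosed_iInter fun v => isClosed_le continuous_const ?_
      simp only [dotProduct, Matrix.mulVec, Matrix.of_apply]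
      fun_prop
    have hm : Measurable fun ω => (fun a b => condOmega μ X Z u n ω a b : Fin k → Fin k → ℝ) :=
      measurable_pi_lambda _ fun a => measurable_pi_lambda _ fun b => measurable_omegaOf_kernel (H.measurable_Z n) a b
    exact hm hcl.measurableSet
  · filter_upwards [h, ae_all_iff.2 H.ae_omegaMat_eq_condOmega] with ω hω he
    filter_upwards [eventually_lt_of_lt_liminf hω] with n hn v
    rw [he n, EReal.coe_lt_coe_iff] at hn
    exact le_of_lt_lambdaMin (omegaOf_isHermitian _ _) hn v

end assembly

end StratifiedWald

open StratifiedWald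

theorem theorem3 {Ω : Type*} [MeasurableSpace Ω] (μ : MeasureTheory.Measure Ω)
    [MeasureTheory.IsProbabilityMeasure μ] {k p : ℕ} (c : ℕ → ℝ)
    (X : (n : ℕ) → Fin n → Ω → StratifiedWald.Vec k)
    (Z : (n : ℕ) → Fin n → Ω → StratifiedWald.Vec p)
    (u y : (n : ℕ) → Fin n → Ω → ℝ)
    (β : ℕ → StratifiedWald.Vec k) (β₀ : StratifiedWald.Vec k) (γ : ℕ → StratifiedWald.Vec p)
    (hmodel : ∀ n i ω, y n i ω = inner ℝ (X n i ω) (β n) + inner ℝ (Z n i ω) (γ n) + u n i ω)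
    (hA : StratifiedWald.LargeSample μ c X Z u) :
    -- local alternatives
    (∀ (h : StratifiedWald.Vec k) (G : Matrix (Fin k) (Fin k) ℝ),
      (∀ n : ℕ, 1 ≤ n → β n = β₀ + (√(n : ℝ))⁻¹ • h) →
      (∀ a b, TendstoInMeasure μ
        (fun n ω => (StratifiedWald.invSqrt (StratifiedWald.omegaMat μ (X n) (Z n) (u n) ω) *
          StratifiedWald.meanGram μ (X n) (Z n)) a b) atTop (fun _ => G a b)) →
      TendstoInDistribution
        (fun n ω => StratifiedWald.wald (fun i => X n i ω) (fun i => Z n i ω)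
          (fun i => y n i ω) β₀)
        atTop id (fun _ => μ)
        (StratifiedWald.noncentralChiSq k (‖WithLp.toLp 2 (G *ᵥ h.ofLp)‖ ^ 2))) ∧
    -- the null hypothesis, where the existence of the limit `G` is not needed
    ((∀ n : ℕ, 1 ≤ n → β n = β₀) →
      TendstoInDistribution
        (fun n ω => StratifiedWald.wald (fun i => X n i ω) (fun i => Z n i ω)
          (fun i => y n i ω) β₀)
        atTop id (fun _ => μ) (StratifiedWald.noncentralChiSq k 0)) ∧
    -- alternatives away from the null hypothesis
    (Tendsto (fun n : ℕ => √(n : ℝ) *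
        ‖WithLp.toLp 2 (StratifiedWald.meanGram μ (X n) (Z n) *ᵥ (β n - β₀).ofLp)‖)
        atTop atTop →
      ∀ M : ℝ, Tendsto
        (fun n => μ {ω | StratifiedWald.wald (fun i => X n i ω) (fun i => Z n i ω)
          (fun i => y n i ω) β₀ ≤ M}) atTop (𝓝 0)) := by
  obtain ⟨M, ρ, H⟩ := hA.exists_unitArray
  obtain ⟨lam, hlam, hOm, -, -⟩ := hA.nondegenerate
  have L := H.waldLimits hlam (H.eventually_le_condOmega hOm)
  have hW : (fun n ω => wald (fun i => X n i ω) (fun i => Z n i ω) (fun i => y n i ω) β₀) = fun n ω =>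
      waldForm (demeaned X Z n ω) (resid (demeaned X Z n ω) (β n - β₀).ofLp (fun i => u n i ω) fun i => errMean Z u n i ω) := by
    funext n ω
    exact wald_eq_waldForm _ _ (fun i => u n i ω) _ (β n) β₀ (γ n) fun i => hmodel n i ω
  refine ⟨fun h G hβ hG => ?_, fun hβ => ?_, fun hδ K => ?_⟩
  · rw [hW]
    refine L.tendstoInDistribution (h := h.ofLp) (fun n hn => ?_) fun a => ?_
    · rw [hβ n hn, add_sub_cancel_left]; rfl
    · have h1 : Tendsto (fun x : ℕ × Ω => ∑ b, (invSqrt (omegaMat μ (X x.1) (Z x.1) (u x.1) x.2) *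
          meanGram μ (X x.1) (Z x.1)) a b * h.ofLp b) (whp μ) (𝓝 (∑ b, G a b * h.ofLp b)) :=
        tendsto_finsetSum _ fun b _ => (tendstoInMeasure_iff_tendsto_whp.1 (hG a b)).mul_const _
      refine h1.congr' ?_
      filter_upwards [eventually_whp_of_ae (P := fun x => omegaMat μ (X x.1) (Z x.1) (u x.1) x.2 = condOmega μ X Z u x.1 x.2)
        H.ae_omegaMat_eq_condOmega] with x hx
      rw [hx, Matrix.mulVec_mulVec]
      rfl
  · rw [hW]
    have := L.tendstoInDistribution (δ := fun n => (β n - β₀).ofLp) (h := 0) (fun n hn => by rw [hβ n hn]; simp) (g := 0) fun a => by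
      simpa using tendsto_const_nhds
    simpa using this
  · have hn : ∀ v : Fin k → ℝ, ‖(WithLp.toLp 2 v : Vec k)‖ = √(v ⬝ᵥ v) := fun v => by
      rw [EuclideanSpace.norm_eq]; simp [dotProduct, sq]
    have hM := H.nonneg
    obtain ⟨b, hb, hΓ⟩ := L.exists_gram_ge (env := fun n i ω => envelope (X n i ω, u n i ω)) (B := 2 + 2 * k * (1 + M))
      (fun n i ω => by simp only [envelope]; nlinarith [mul_nonneg (sq_nonneg ‖X n i ω‖) (sq_nonneg (u n i ω))])
      H.eventually_dev_sq_mul_le (by positivity) fun ε hε => H.envelope_tail hε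
    have h1 := L.tendsto_wald_atTop hb hΓ (δ := fun n => (β n - β₀).ofLp) (by simpa only [hn] using hδ) K
    refine (eventually_whp.1 h1).congr fun n => ?_
    congr 1
    ext ω
    rw [Set.mem_ofPred_eq, Set.mem_ofPred_eq, not_lt, congrFun (congrFun hW n) ω]
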